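/- **Setting.** Let $(M,g)$ be a smooth oriented 4-dimensional Lorentzian manifold of signature $(-+++)$ that is Ricci-flat, with $[\nabla_\alpha,\nabla_\beta]A_\mu=-R^\lambda{}_{\mu\alpha\beta}A_\lambda$ and volume form $\epsilon$. Round and square brackets denote symmetrization and antisymmetrization with weight one. A left star denotes the Hodge dual on the first two indices, ${}^*A_{\alpha\beta\dots}=\frac12\epsilon_{\alpha\beta}{}^{\rho\sigma}A_{\rho\sigma\dots}$, and $R^*_{\alpha\beta\gamma\delta}=\frac12\epsilon_{\gamma\delta}{}^{\rho\sigma}R_{\alpha\beta\rho\sigma}$. Let $Y_{\alpha\beta}=Y_{[\alpha\beta]}$ be a Killing–Yano tensor, $\nabla_{(\alpha}Y_{\beta)\gamma}=0$, and put $$K_{\alpha\beta}=Y_{\alpha\lambda}Y^\lambda{}_\beta,\quad K=K^\alpha{}_\alpha,\quad \mathcal Z=\tfrac14\,{}^*Y_{\alpha\beta}Y^{\alpha\beta},\quad \xi^\alpha=-\tfrac13\nabla_\lambda {}^*Y^{\lambda\alpha},\quad \lambda_{\alpha\beta\gamma}=2\nabla_{[\alpha}K_{\beta]\gamma}.$$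 **Motion.** States are triples $(x,p,S)$ with $p^\mu$ timelike, $S^{\mu\nu}=-S^{\nu\mu}$ and $S^{\mu\nu}p_\nu=0$. Write $\mu=\sqrt{-p_\alpha p^\alpha}$, $\hat p=p/\mu$ and $S^\alpha=\frac12\epsilon^{\alpha\beta\gamma\delta}\hat p_\beta S_{\gamma\delta}$. States evolve by the Mathisson–Papapetrou–Tulczyjew equations $$\tfrac{D p^\mu}{d\tau}=-\tfrac12R^\mu{}_{\nu\alpha\beta}v^\nu S^{\alpha\beta},\qquad \tfrac{D S^{\mu\nu}}{d\tau}=p^\mu v^\nu-p^\nu v^\mu,$$ $$v^\mu=\tfrac{\mathfrak m}{\mu^2}\Big(p^\mu+\tfrac{D^\mu{}_\alpha p^\alpha}{1-d/2}\Big),\qquad D^\nu{}_\beta=\tfrac1{2\mu^2}S^{\nu\alpha}R_{\alpha\beta\gamma\delta}S^{\gamma\delta},\qquad d=D^\alpha{}_\alpha,$$ with $\mathfrak m>0$ fixed by $v_\mu v^\mu=-1$. A function $\mathcal Q(x,p,S)$ is a *quasi-invariant* if, for every $x$ and every timelike $p$, $d\mathcal Q/d\tau=O(S^2)$ as $S\to0$.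 Functions are compared on the set of states. For a smooth $L_{\mu\nu\rho}=L_{[\mu\nu]\rho}$ put $$\mathcal Q_L=K_{\mu\nu}p^\mu p^\nu+L_{\mu\nu\rho}S^{\mu\nu}p^\rho .$$ *Rüdiger's invariant* is, with $L_\alpha=Y_{\alpha\lambda}p^\lambda$, $$\mathcal Q_R=-L_\alpha L^\alpha-2\mu S^\alpha\partial_\alpha\mathcal Z-2\mu^{-1}L_\alpha S^\alpha\,\xi_\beta p^\beta .$$ A *mixed-symmetry Killing tensor* is a smooth tensor field $T_{\alpha\beta\gamma}=N_{\alpha(\beta\gamma)}$, for some smooth $N_{\alpha\beta\gamma}=N_{[\alpha\beta]\gamma}$, with $T_{\alpha(\beta\gamma;\delta)}=0$. **Variables.** Given $L$, let $\tilde X_{\alpha\beta\gamma}=L_{\alpha\beta\gamma}-\frac13(\lambda_{\alpha\beta\gamma}+g_{\gamma[\alpha}\nabla_{\beta]}K)$, $X_{\alpha\beta\gamma}=\tilde X_{\alpha\beta\gamma}-\tilde X_{[\alpha\beta\gamma]}$, $X^\alpha=\frac16\epsilon^{\alpha\beta\gamma\delta}\tilde X_{\beta\gamma\delta}$, $Y_\alpha=X_\alpha-\frac43\nabla_\alpha\mathcal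 Z$. Let $D_{\alpha\beta\gamma}$ be the trace-free part of $X_{\alpha\beta\gamma}$, and let $W_{\alpha\beta\gamma}=D_{\alpha\beta\gamma}-\epsilon_{\mu\alpha\beta\gamma}Y^\mu$. **Theorem.** $K_{\alpha\beta}$ is a Killing tensor, and the following hold. 1. For every smooth $L_{\mu\nu\rho}=L_{[\mu\nu]\rho}$ these are equivalent: * (a) $\mathcal Q_L$ is a quasi-invariant; * (b) ${}^*V_{\alpha(\beta\gamma\delta)}=0$, where $V_{\alpha\beta\gamma\delta}=\nabla_\delta L_{\alpha\beta\gamma}-K_{\lambda\gamma}R^\lambda{}_{\delta\alpha\beta}+\frac23K_{\lambda\rho}R^\lambda{}_{\delta[\alpha}{}^\rho g_{\beta]\gamma}$; * (c) ${}^*X_{\alpha(\beta\gamma;\delta)}+X_{\alpha;(\beta}g_{\gamma\delta)}-g_{\alpha(\beta}X_{\gamma;\delta)}+\frac13\big(g_{\alpha(\beta}R^{*\lambda}{}_{\gamma\delta)}{}^\rho-R^{*\lambda}{}_{\alpha(\beta}{}^\rho g_{\gamma\delta)}\big)K_{\lambda\rho}=0$; * (d) ${}^*X_{\alpha(\beta\gamma;\delta)}+Y_{\alpha;(\beta}g_{\gamma\delta)}-g_{\alpha(\beta}Y_{\gamma;\delta)}=0$;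 * (e) ${}^*W_{\alpha(\beta\gamma;\delta)}=0$. The fields $D$, $Y_\alpha$, $W$, ${}^*W$ are smooth tensor fields; $D$, $W$, ${}^*W$ are antisymmetric in their first two indices, $D$ and $W$ are trace-free, and $D_{[\alpha\beta\gamma]}=0$. For every $L$, quasi-invariant or not, $\mathcal Q_L$ equals the function $\mathcal Q_{L'}$ with $L'_{\alpha\beta\gamma}=D_{\alpha\beta\gamma}+\frac13\lambda_{\alpha\beta\gamma}+\epsilon_{\alpha\beta\gamma\delta}(Y^\delta+\frac43\nabla^\delta\mathcal Z)$, and $$\mathcal Q_L=\mathcal Q_R+2\mu\,{}^*W_{\alpha(\beta\gamma)}S^\alpha\hat p^\beta\hat p^\gamma .$$ 2. Conversely, let $D_{\alpha\beta\gamma}=D_{[\alpha\beta]\gamma}$ be a smooth trace-free tensor field with $D_{[\alpha\beta\gamma]}=0$ and $Y_\alpha$ a smooth covector field, both arbitrary. Put $W_{\alpha\beta\gamma}=D_{\alpha\beta\gamma}-\epsilon_{\mu\alpha\beta\gamma}Y^\mu$, so that ${}^*W_{\alpha\beta\gamma}={}^*D_{\alpha\beta\gamma}-2g_{\gamma[\alpha}Y_{\beta]}$,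 and let $L'$ be given by the formula in 1. Then $L'$ is a smooth tensor field antisymmetric in its first two indices, the tensor ${}^*W$ belonging to $L'$ is the given one, and $\mathcal Q_{L'}$ is a quasi-invariant if and only if ${}^*W_{\alpha(\beta\gamma;\delta)}=0$. Moreover $$(D_{\alpha\beta\gamma}+\epsilon_{\alpha\beta\gamma\delta}Y^\delta)S^{\alpha\beta}p^\gamma=2\mu\,{}^*W_{\alpha(\beta\gamma)}S^\alpha\hat p^\beta\hat p^\gamma,$$ and this function vanishes identically if and only if ${}^*W_{\alpha(\beta\gamma)}=0$. 3. With $D=0$ and $Y_\alpha=0$ in 2, $\mathcal Q_{L'}$ is a quasi-invariant, and it equals $\mathcal Q_R$. 4. The formula $\mathcal Q=\mathcal Q_R+2\mu\,T_{\alpha\beta\gamma}S^\alpha\hat p^\beta\hat p^\gamma$ is a one-to-one correspondence between the mixed-symmetry Killing tensors $T$ and the quasi-invariants of the form $\mathcal Q_L$. Likewise, $T\mapsto2\mu\,T_{\alpha\beta\gamma}S^\alpha\hat p^\beta\hat p^\gamma$ is a one-to-one correspondence between the mixed-symmetry Killing tensors and the quasi-invariants of the form $L_{\mu\nu\rho}S^{\mu\nu}p^\rho$.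 -/

import Mathlib

open scoped ContDiff Manifold Topology
open Asymptotics

namespace SpinKY

noncomputable section

/-- Spacetime indices `0, 1, 2, 3`. -/
abbrev Idx : Type := Fin 4

/-- Coordinate values (also: components of a vector). -/
abbrev Coord : Type := Fin 4 → ℝ

/-- Components of a contravariant 2-tensor at a point. -/
abbrev Biv : Type := Idx → Idx → ℝ

/-- Component fields, in one chart, of tensors of rank 1 to 4. -/
abbrev F1 : Type := Coord → Idx → ℝ
abbrev F2 : Type := Coord → Idx → Idx → ℝ
abbrev F3 : Type := Coord → Idx → Idx → Idx → ℝ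
abbrev F4 : Type := Coord → Idx → Idx → Idx → Idx → ℝ

/-! ## Tensor calculus in one chart. All indices are down unless said otherwise. -/

/-- Partial derivative `∂_α f` at `y`. -/
def pd (α : Idx) (f : Coord → ℝ) (y : Coord) : ℝ := fderiv ℝ f y (Pi.single α 1)

/-- Inverse metric `g^{αβ}`. -/
def ginv (g : F2) : F2 := fun y α β => (Matrix.of (g y))⁻¹ α β

/-- Christoffel symbols `Γ^l_{αβ}`, the upper index first. -/
def christoffel (g : F2) : F3 := fun y l α β =>
  (1 / 2) * ∑ s, ginv g y l s *
    (pd α (fun z => g z s β) y + pd β (fun z => g z s α) y - pd s (fun z => g z α β) y)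

/-- `R^l_{μαβ}`, the upper index first, with `[∇_α, ∇_β] A_μ = - R^l_{μαβ} A_l`. -/
def riemannUp (g : F2) : F4 := fun y l μ α β =>
  pd α (fun z => christoffel g z l β μ) y - pd β (fun z => christoffel g z l α μ) y
    + ∑ s, (christoffel g y l α s * christoffel g y s β μ
        - christoffel g y l β s * christoffel g y s α μ)

/-- `R_{λμαβ}`. -/
def riemann (g : F2) : F4 := fun y l μ α β => ∑ s, g y l s * riemannUp g y s μ α β

/-- Ricci tensor `R_{μν} = R^l_{μlν}`. -/
def ricci (g : F2) : F2 := fun y μ ν => ∑ l, riemannUp g y l μ l ν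

/-- `∇_β A_α` stored as `A_{α;β}`: the derivative index comes last. -/
def cov1 (g : F2) (A : F1) : F2 := fun y α β =>
  pd β (fun z => A z α) y - ∑ l, christoffel g y l β α * A y l

/-- `A_{αβ;γ}`. -/
def cov2 (g : F2) (A : F2) : F3 := fun y α β γ =>
  pd γ (fun z => A z α β) y
    - ∑ l, (christoffel g y l γ α * A y l β + christoffel g y l γ β * A y α l)

/-- `A_{αβγ;δ}`. -/
def cov3 (g : F2) (A : F3) : F4 := fun y α β γ δ =>
  pd δ (fun z => A z α β γ) y
    - ∑ l, (christoffel g y l δ α * A y l β γ + christoffel g y l δ β * A y α l γ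
        + christoffel g y l δ γ * A y α β l)

/-- Permutation symbol, with `[0123] = 1`. -/
def permSymbol (α β γ δ : Idx) : ℝ :=
  (Matrix.of fun i j : Idx => if ![α, β, γ, δ] i = j then (1 : ℝ) else 0).det

/-- Levi-Civita tensor `ε_{αβγδ}`. -/
def eps (g : F2) : F4 := fun y α β γ δ =>
  Real.sqrt (-(Matrix.of (g y)).det) * permSymbol α β γ δ

/-- `ε_{αβ}^{ρσ}`. -/
def epsMixed (g : F2) : F4 := fun y α β ρ σ =>
  ∑ k, ∑ l, ginv g y ρ k * ginv g y σ l * eps g y α β k l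

/-- `ε_α^{βγδ}`. -/
def epsUp3 (g : F2) : F4 := fun y α β γ δ =>
  ∑ k, ginv g y β k * epsMixed g y α k γ δ

/-- `A^α`. -/
def raise1 (g : F2) (A : F1) : F1 := fun y α => ∑ β, ginv g y α β * A y β

/-- `A^{αβ}`. -/
def raise2 (g : F2) (A : F2) : F2 := fun y α β =>
  ∑ k, ∑ l, ginv g y α k * ginv g y β l * A y k l

/-- Gradient of a scalar. -/
def grad (f : Coord → ℝ) : F1 := fun y α => pd α f y

/-- Hodge dual `*A_{αβ} = ½ ε_{αβ}^{ρσ} A_{ρσ}`. -/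
def star2 (g : F2) (A : F2) : F2 := fun y α β =>
  (1 / 2) * ∑ ρ, ∑ σ, epsMixed g y α β ρ σ * A y ρ σ

/-- Left dual `*A_{αβγ} = ½ ε_{αβ}^{ρσ} A_{ρσγ}`. -/
def star3 (g : F2) (A : F3) : F3 := fun y α β γ =>
  (1 / 2) * ∑ ρ, ∑ σ, epsMixed g y α β ρ σ * A y ρ σ γ

/-- Left dual `*A_{αβγδ} = ½ ε_{αβ}^{ρσ} A_{ρσγδ}`. -/
def star4 (g : F2) (A : F4) : F4 := fun y α β γ δ =>
  (1 / 2) * ∑ ρ, ∑ σ, epsMixed g y α β ρ σ * A y ρ σ γ δ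

/-- Right dual of the Riemann tensor, `R*_{αβγδ} = ½ ε_{γδ}^{ρσ} R_{αβρσ}`. -/
def riemannStar (g : F2) : F4 := fun y α β γ δ =>
  (1 / 2) * ∑ ρ, ∑ σ, epsMixed g y γ δ ρ σ * riemann g y α β ρ σ

/-- Total symmetrization `F_{(βγδ)}`, with weight one. -/
def sym3 (F : Idx → Idx → Idx → ℝ) (β γ δ : Idx) : ℝ :=
  (1 / 6) * (F β γ δ + F β δ γ + F γ β δ + F γ δ β + F δ β γ + F δ γ β)

/-- Total antisymmetrization `F_{[αβγ]}`, with weight one. -/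
def alt3 (F : Idx → Idx → Idx → ℝ) (α β γ : Idx) : ℝ :=
  (1 / 6) * (F α β γ + F β γ α + F γ α β - F α γ β - F β α γ - F γ β α)

/-- `A_{α(βγ)}`. -/
def symLast (A : F3) : F3 := fun y α β γ => (1 / 2) * (A y α β γ + A y α γ β)

/-! ## Killing-Yano data in one chart -/

/-- `K_{αβ} = Y_{αλ} Y^λ_β`. -/
def kySquare (g Y : F2) : F2 := fun y α β => ∑ k, ∑ l, Y y α k * ginv g y k l * Y y l β

/-- `𝒵 = ¼ Y*_{αβ} Y^{αβ}`. -/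
def kyScalar (g Y : F2) : Coord → ℝ := fun y =>
  (1 / 4) * ∑ α, ∑ β, star2 g Y y α β * raise2 g Y y α β

/-- `ξ_α = -⅓ ∇^λ Y*_{λα}`. -/
def kyXi (g Y : F2) : F1 := fun y α =>
  -(1 / 3) * ∑ k, ∑ l, ginv g y k l * cov2 g (star2 g Y) y k α l

/-! ## The variables of the reduction, in one chart -/

/-- `λ_{αβγ} = 2 ∇_{[α} K_{β]γ}`. -/
def lamT (g K : F2) : F3 := fun y α β γ => cov2 g K y β γ α - cov2 g K y α γ β

/-- The trace `K^α_α`. -/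
def trK (g K : F2) : Coord → ℝ := fun y => ∑ α, ∑ β, ginv g y α β * K y α β

/-- `X̃_{αβγ} = L_{αβγ} - ⅓ (λ_{αβγ} + g_{γ[α} ∇_{β]} K)`. -/
def xTilde (g K : F2) (L : F3) : F3 := fun y α β γ =>
  L y α β γ - (1 / 3) * (lamT g K y α β γ
    + (1 / 2) * (g y γ α * grad (trK g K) y β - g y γ β * grad (trK g K) y α))

/-- `X_{αβγ} = X̃_{αβγ} - X̃_{[αβγ]}`. -/
def xHook (g K : F2) (L : F3) : F3 := fun y α β γ =>
  xTilde g K L y α β γ - alt3 (xTilde g K L y) α β γ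

/-- `X_α = (1/6) ε_α^{βγδ} X̃_{βγδ}`. -/
def xVec (g K : F2) (L : F3) : F1 := fun y α =>
  (1 / 6) * ∑ β, ∑ γ, ∑ δ, epsUp3 g y α β γ δ * xTilde g K L y β γ δ

/-- `Y_α = X_α - (4/3) ∇_α 𝒵`, where `K = Y·Y`. -/
def yVec (g Y : F2) (L : F3) : F1 := fun y α =>
  xVec g (kySquare g Y) L y α - (4 / 3) * grad (kyScalar g Y) y α

/-- The trace vector `⅓ g^{βγ} A_{αβγ}`. -/
def traceVec (g : F2) (A : F3) : F1 := fun y α =>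
  (1 / 3) * ∑ β, ∑ γ, ginv g y β γ * A y α β γ

/-- Trace-free part of a tensor antisymmetric in its first two indices:
`A_{αβγ} = a_α g_{βγ} - a_β g_{αγ} + A^{tf}_{αβγ}`. -/
def traceFree (g : F2) (A : F3) : F3 := fun y α β γ =>
  A y α β γ - (traceVec g A y α * g y β γ - traceVec g A y β * g y α γ)

/-- `D^{tf}_{αβγ}`, the trace-free part of `X_{αβγ}`. -/
def dTf (g Y : F2) (L : F3) : F3 := traceFree g (xHook g (kySquare g Y) L)

/-- `W_{αβγ} = D_{αβγ} - Ỹ_{αβγ}` with `Ỹ_{αβγ} = ε_{μαβγ} A^μ`, for given `D` and `A`. -/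
def wOf (g : F2) (D : F3) (A : F1) : F3 := fun y α β γ =>
  D y α β γ - ∑ μ, eps g y μ α β γ * raise1 g A y μ

/-- The tensor `W_{αβγ}` of `L`. -/
def wOfL (g Y : F2) (L : F3) : F3 := wOf g (dTf g Y L) (yVec g Y L)

/-- The tensor `*W_{αβγ}` of `L`. -/
def starW (g Y : F2) (L : F3) : F3 := star3 g (wOfL g Y L)

/-- `L_{αβγ} = D_{αβγ} + ⅓ λ_{αβγ} + ε_{αβγδ} (A^δ + (4/3) ∇^δ 𝒵)`. -/
def recon (g Y : F2) (D : F3) (A : F1) : F3 := fun y α β γ =>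
  D y α β γ + (1 / 3) * lamT g (kySquare g Y) y α β γ
    + ∑ δ, eps g y α β γ δ *
        (raise1 g A y δ + (4 / 3) * raise1 g (grad (kyScalar g Y)) y δ)

/-- `K_{λρ} R^λ_{δα}^ρ`. -/
def kRiem (g K : F2) : F2 := fun y δ α =>
  ∑ l, ∑ r, raise2 g K y l r * riemann g y l δ α r

/-- `K_{λρ} R*^λ_{βγ}^ρ`. -/
def kRiemStar (g K : F2) : F2 := fun y β γ =>
  ∑ l, ∑ r, raise2 g K y l r * riemannStar g y l β γ r

/-- `V_{αβγδ} = ∇_δ L_{αβγ} - K_{λγ} R^λ_{δαβ} + ⅔ K_{λρ} R^λ_{δ[α}^ρ g_{β]γ}`. -/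
def vTensor (g K : F2) (L : F3) : F4 := fun y α β γ δ =>
  cov3 g L y α β γ δ - ∑ l, K y l γ * riemannUp g y l δ α β
    + (1 / 3) * (kRiem g K y δ α * g y β γ - kRiem g K y δ β * g y α γ)

/-- `*V_{α(βγδ)}`. -/
def constraintV (g K : F2) (L : F3) : F4 := fun y α =>
  sym3 fun β γ δ => star4 g (vTensor g K L) y α β γ δ

/-- `*X_{α(βγ;δ)} + X_{α;(β} g_{γδ)} - g_{α(β} X_{γ;δ)}
+ ⅓ (g_{α(β} R*^λ_{γδ)}^ρ - R*^λ_{α(β}^ρ g_{γδ)}) K_{λρ}`. -/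
def constraintX (g K : F2) (L : F3) : F4 := fun y α =>
  sym3 fun β γ δ => cov3 g (star3 g (xHook g K L)) y α β γ δ
    + cov1 g (xVec g K L) y α β * g y γ δ - g y α β * cov1 g (xVec g K L) y γ δ
    + (1 / 3) * (g y α β * kRiemStar g K y γ δ - kRiemStar g K y α β * g y γ δ)

/-- `*X_{α(βγ;δ)} + ∇_{(β|} [X_α - (4/3) ∇_α 𝒵] g_{|γδ)}
- g_{α(β} ∇_δ [X_{γ)} - (4/3) ∇_{γ)} 𝒵]`. -/
def constraintKY (g Y : F2) (L : F3) : F4 := fun y α =>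
  sym3 fun β γ δ => cov3 g (star3 g (xHook g (kySquare g Y) L)) y α β γ δ
    + cov1 g (yVec g Y L) y α β * g y γ δ - g y α β * cov1 g (yVec g Y L) y γ δ

/-- `N_{α(βγ;δ)}`. -/
def killingMixed (g : F2) (N : F3) : F4 := fun y α =>
  sym3 fun β γ δ => cov3 g N y α β γ δ

/-! ## The spinning particle, in one chart -/

/-- Phase-space coordinates `(x^μ, p^μ, S^{μν})`. -/
abbrev Phase : Type := Coord × Coord × Biv

/-- `g_{μν} u^μ w^ν`. -/
def dot (g : F2) (y u w : Coord) : ℝ := ∑ α, ∑ β, g y α β * u α * w β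

/-- Dynamical mass `μ = √(-p_α p^α)`. -/
def mass (g : F2) (y p : Coord) : ℝ := Real.sqrt (-dot g y p p)

/-- `p̂^α = p^α / μ`. -/
def phat (g : F2) (y p : Coord) : Coord := fun α => p α / mass g y p

/-- `S^{μν} = -S^{νμ}` and the Tulczyjew condition `S^{μν} p_ν = 0`. -/
def IsSpin (g : F2) (y p : Coord) (S : Biv) : Prop :=
  (∀ α β, S α β = -S β α) ∧ ∀ α, ∑ β, ∑ γ, S α β * (g y β γ * p γ) = 0

/-- Spin vector `S^α = ½ ε^{αβγδ} p̂_β S_{γδ}`. -/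
def spinVec (g : F2) (y p : Coord) (S : Biv) : Coord := fun α =>
  (1 / 2) * ∑ k, ∑ β, ∑ γ, ∑ δ, ginv g y α k * eps g y k β γ δ * phat g y p β * S γ δ

/-- `D^α_β = S^{αν} R_{νβγδ} S^{γδ} / (2 μ²)`. -/
def dMat (g : F2) (y p : Coord) (S : Biv) (α β : Idx) : ℝ :=
  (1 / (2 * mass g y p ^ 2)) * ∑ ν, ∑ γ, ∑ δ, S α ν * riemann g y ν β γ δ * S γ δ

/-- `D^α_β p^β / (1 - d/2)` with `d = D^α_α`. -/
def dVec (g : F2) (y p : Coord) (S : Biv) : Coord := fun α =>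
  (∑ β, dMat g y p S α β * p β) / (1 - (∑ β, dMat g y p S β β) / 2)

/-- Kinetic mass `𝔪`, fixed by `v_α v^α = -1` and `𝔪 > 0`. -/
def kineticMass (g : F2) (y p : Coord) (S : Biv) : ℝ :=
  mass g y p / Real.sqrt (1 - dot g y (dVec g y p S) (dVec g y p S) / mass g y p ^ 2)

/-- The 4-velocity `v^α = (𝔪/μ²) (p^α + D^α_β p^β / (1 - d/2))`. -/
def velocity (g : F2) (y p : Coord) (S : Biv) : Coord := fun α =>
  (kineticMass g y p S / mass g y p ^ 2) * (p α + dVec g y p S α)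

/-- The Mathisson-Papapetrou-Tulczyjew equations as a vector field on phase space:
`dx^μ/dτ = v^μ`, `Dp^μ/dτ = -½ R^μ_{ναβ} v^ν S^{αβ}`, `DS^{μν}/dτ = p^μ v^ν - p^ν v^μ`. -/
def mptField (g : F2) : Phase → Phase := fun (y, p, S) =>
  (velocity g y p S,
   fun μ => -(∑ α, ∑ β, christoffel g y μ α β * velocity g y p S α * p β)
      - (1 / 2) * ∑ ν, ∑ α, ∑ β, riemannUp g y μ ν α β * velocity g y p S ν * S α β,
   fun μ ν => -(∑ α, ∑ β, (christoffel g y μ α β * velocity g y p S α * S β ν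
        + christoffel g y ν α β * velocity g y p S α * S μ β))
      + (p μ * velocity g y p S ν - p ν * velocity g y p S μ))

/-- `d𝒬/dτ` along the Mathisson-Papapetrou-Tulczyjew equations. -/
def rate (g : F2) (Q : Phase → ℝ) (z : Phase) : ℝ := fderiv ℝ Q z (mptField g z)

/-- `K_{μν} p^μ p^ν + L_{μνρ} S^{μν} p^ρ`. -/
def quadInv (K : F2) (L : F3) : Phase → ℝ := fun (y, p, S) =>
  (∑ μ, ∑ ν, K y μ ν * p μ * p ν) + ∑ μ, ∑ ν, ∑ ρ, L y μ ν ρ * S μ ν * p ρ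

/-- `L_α = Y_{αλ} p^λ`. -/
def lVec (Y : F2) (y p : Coord) : Idx → ℝ := fun α => ∑ l, Y y α l * p l

/-- The quadratic invariant
`𝒬_R = -L_α L^α - 2 μ S^α ∂_α 𝒵 - 2 μ⁻¹ L_α S^α ξ_β p^β`. -/
def rudiger (g Y : F2) : Phase → ℝ := fun (y, p, S) =>
  -(∑ α, ∑ β, ginv g y α β * lVec Y y p α * lVec Y y p β)
    - 2 * mass g y p * (∑ α, spinVec g y p S α * grad (kyScalar g Y) y α)
    - 2 * (mass g y p)⁻¹ * (∑ α, lVec Y y p α * spinVec g y p S α)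
      * (∑ β, kyXi g Y y β * p β)

/-- `2 μ T_{αβγ} S^α p̂^β p̂^γ`. -/
def mixedInv (g : F2) (T : F3) : Phase → ℝ := fun (y, p, S) =>
  2 * mass g y p * ∑ α, ∑ β, ∑ γ, T y α β γ * spinVec g y p S α
    * phat g y p β * phat g y p γ

/-! ## Tensor fields on a manifold -/

section Manifold

variable (M : Type*) [TopologicalSpace M] [ChartedSpace Coord M]

/-- Coordinate charts; only those of the atlas are used. -/
abbrev Chart : Type _ := OpenPartialHomeomorph M Coord

variable {M}

/-- Jacobian `∂x'^a/∂x^b` at `x`, where `x^b` are the coordinates of `e` and `x'^a` those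
of `e'`. -/
def jac (e e' : Chart M) (x : M) (a b : Idx) : ℝ :=
  fderiv ℝ (fun y => e' (e.symm y)) (e x) (Pi.single b 1) a

variable (M) in
/-- The charts of the atlas have the same orientation. -/
def IsOriented : Prop :=
  ∀ e ∈ atlas Coord M, ∀ e' ∈ atlas Coord M, ∀ x ∈ e.source ∩ e'.source,
    0 < (Matrix.of (jac e e' x)).det

/-- `T` gives the components, in the charts of the atlas, of a smooth covector field. -/
structure IsTensor1 (T : Chart M → F1) : Prop where
  smooth : ∀ e ∈ atlas Coord M, ∀ α, ContDiffOn ℝ ∞ (fun y => T e y α) e.target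
  transform : ∀ e ∈ atlas Coord M, ∀ e' ∈ atlas Coord M, ∀ x ∈ e.source ∩ e'.source, ∀ α,
    T e (e x) α = ∑ a, jac e e' x a α * T e' (e' x) a

/-- `T` gives the components of a smooth covariant 2-tensor field. -/
structure IsTensor2 (T : Chart M → F2) : Prop where
  smooth : ∀ e ∈ atlas Coord M, ∀ α β, ContDiffOn ℝ ∞ (fun y => T e y α β) e.target
  transform : ∀ e ∈ atlas Coord M, ∀ e' ∈ atlas Coord M, ∀ x ∈ e.source ∩ e'.source,
    ∀ α β, T e (e x) α β =
      ∑ a, ∑ b, jac e e' x a α * jac e e' x b β * T e' (e' x) a b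

/-- `T` gives the components of a smooth covariant 3-tensor field. -/
structure IsTensor3 (T : Chart M → F3) : Prop where
  smooth : ∀ e ∈ atlas Coord M, ∀ α β γ, ContDiffOn ℝ ∞ (fun y => T e y α β γ) e.target
  transform : ∀ e ∈ atlas Coord M, ∀ e' ∈ atlas Coord M, ∀ x ∈ e.source ∩ e'.source,
    ∀ α β γ, T e (e x) α β γ =
      ∑ a, ∑ b, ∑ c, jac e e' x a α * jac e e' x b β * jac e e' x c γ * T e' (e' x) a b c

/-- Smooth metric of signature `(-,+,+,+)`. -/
structure IsLorentzMetric (g : Chart M → F2) : Prop where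
  tensor : IsTensor2 g
  symm : ∀ e ∈ atlas Coord M, ∀ y ∈ e.target, ∀ α β, g e y α β = g e y β α
  signature : ∀ e ∈ atlas Coord M, ∀ y ∈ e.target, ∃ A : Matrix Idx Idx ℝ,
    A.transpose * Matrix.of (g e y) * A = Matrix.diagonal ![-1, 1, 1, 1]

/-- `R_{μν} = 0`. -/
def IsRicciFlat (g : Chart M → F2) : Prop :=
  ∀ e ∈ atlas Coord M, ∀ y ∈ e.target, ∀ μ ν, ricci (g e) y μ ν = 0

/-- Smooth antisymmetric `Y_{αβ}` with `∇_{(α} Y_{β)γ} = 0`. -/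
structure IsKillingYano (g Y : Chart M → F2) : Prop where
  tensor : IsTensor2 Y
  antisymm : ∀ e ∈ atlas Coord M, ∀ y ∈ e.target, ∀ α β, Y e y α β = -Y e y β α
  killing : ∀ e ∈ atlas Coord M, ∀ y ∈ e.target, ∀ α β γ,
    cov2 (g e) (Y e) y β γ α + cov2 (g e) (Y e) y α γ β = 0

/-- `K_{(αβ;γ)} = 0` for the symmetric tensor field `K`. -/
structure IsKillingTensor (g K : Chart M → F2) : Prop where
  tensor : IsTensor2 K
  symm : ∀ e ∈ atlas Coord M, ∀ y ∈ e.target, ∀ α β, K e y α β = K e y β α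
  killing : ∀ e ∈ atlas Coord M, ∀ y ∈ e.target, ∀ α β γ,
    sym3 (cov2 (g e) (K e) y) α β γ = 0

/-- Smooth tensor field with `L_{αβγ} = -L_{βαγ}`. -/
structure IsAntisymmFirst (L : Chart M → F3) : Prop where
  tensor : IsTensor3 L
  antisymm : ∀ e ∈ atlas Coord M, ∀ y ∈ e.target, ∀ α β γ, L e y α β γ = -L e y β α γ

/-- Moreover `g^{βγ} D_{αβγ} = 0`. -/
structure IsTraceFree (g : Chart M → F2) (D : Chart M → F3) : Prop
    extends IsAntisymmFirst D where
  trace : ∀ e ∈ atlas Coord M, ∀ y ∈ e.target, ∀ α,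
    ∑ β, ∑ γ, ginv (g e) y β γ * D e y α β γ = 0

/-- Moreover `D_{[αβγ]} = 0`. -/
structure IsTraceFreeHook (g : Chart M → F2) (D : Chart M → F3) : Prop
    extends IsTraceFree g D where
  hook : ∀ e ∈ atlas Coord M, ∀ y ∈ e.target, ∀ α β γ, alt3 (D e y) α β γ = 0

/-- The component field `C` vanishes on all charts. -/
def Vanishes4 (C : Chart M → F4) : Prop :=
  ∀ e ∈ atlas Coord M, ∀ y ∈ e.target, ∀ α β γ δ, C e y α β γ δ = 0

/-- Mixed-symmetry Killing tensor: `T_{αβγ} = N_{α(βγ)}` for some `N_{αβγ} = N_{[αβ]γ}`, and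
`T_{α(βγ;δ)} = 0`. -/
structure IsMixedKilling (g : Chart M → F2) (T : Chart M → F3) : Prop where
  young : ∃ N : Chart M → F3, IsAntisymmFirst N ∧
    ∀ e ∈ atlas Coord M, ∀ y ∈ e.target, ∀ α β γ, T e y α β γ = symLast (N e) y α β γ
  tensor : IsTensor3 T
  killing : Vanishes4 fun e => killingMixed (g e) (T e)

/-- `𝒬` is a quasi-invariant: at every point, for every timelike `p`, `d𝒬/dτ = O(S²)` as
`S → 0` within the spin tensors that satisfy `S^{μν} p_ν = 0`. -/
def IsQuasiInvariant (g : Chart M → F2) (Q : Chart M → Phase → ℝ) : Prop :=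
  ∀ e ∈ atlas Coord M, ∀ y ∈ e.target, ∀ p : Coord, dot (g e) y p p < 0 →
    (fun S : Biv => rate (g e) (Q e) (y, p, S))
      =O[𝓝[{S | IsSpin (g e) y p S}] 0] fun S => ‖S‖ ^ 2

/-- `P` and `Q` agree at all `(x, p, S)` with `p` timelike and `S^{μν} p_ν = 0`. -/
def AgreeOnPhase (g : Chart M → F2) (P Q : Chart M → Phase → ℝ) : Prop :=
  ∀ e ∈ atlas Coord M, ∀ y ∈ e.target, ∀ p : Coord, dot (g e) y p p < 0 →
    ∀ S : Biv, IsSpin (g e) y p S → P e (y, p, S) = Q e (y, p, S)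

/-- `T` and `T'` are the same tensor field. -/
def SameField (T T' : Chart M → F3) : Prop :=
  ∀ e ∈ atlas Coord M, ∀ y ∈ e.target, ∀ α β γ, T e y α β γ = T' e y α β γ

end Manifold

end

end SpinKY

open SpinKY

open scoped ContDiff Manifold Topology
open Asymptotics

namespace SpinKY

noncomputable section

/-! ## Partial derivatives and smooth functions on an open set -/

section Calculus

variable {U : Set Coord} {y : Coord} {f h : Coord → ℝ}

/-! Quasi-invariance. The corrections to the velocity p/μ are quadratic in the spin
(`isBigO_velocity`). The rate of change of 𝒬_L is linear in v. At v = p the term p ∧ v disappears,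
the cubic term in ∇K vanishes because K is a Killing tensor, and what remains is V_{αβγδ} S^{αβ} p^γ
p^δ up to a term quadratic in S (`rateForm_self`); the metric terms of V cost nothing because S^{αβ}
p_β = 0. A linear function of S that is O(S²) is zero (`isBigO_rate_iff`). In a frame with time axis
p̂ the spin is an arbitrary spatial bivector, so vanishing for all spins means that the frame
components *V_{i000} vanish. Letting p run through the open cone of timelike vectors and polarizing
gives *V_{α(βγδ)} = 0 (`LocMetric.spinForm_eq_zero_iff`).

Reduction. The derivative ∇ commutes with the dual and with the metric, and the dual of a product
v_α g_{βγ} - v_β g_{αγ} is a 3-form, which is lost when the last two indices are symmetrized. Hence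
the trace of X and the gradient of the trace of K do not matter, and *X + X_α ∧ g has the same
symmetric part as *L - ⅓ *λ (`LocMetric.symLast_star3_xHook`). Two curvature identities do the rest.
`LocKY.sym3_curvature` comes from the Ricci identity for K together with the Killing equation.
`LocKY.hess_kyScalar` says 4 ∇_i ∇_0 𝒵 = (K·R*)_{i0} for spatial i; it comes from the Ricci identity
for Y together with the total antisymmetry of ∇Y. Both are verified on frame components, where a
Ricci-flat curvature has ten independent entries (`IsWeyl.eq_weylTab`), and are lifted to tensor
identities by `LocMetric.sym3_eq_zero`. As a result the tensors in (b), (c), (d) and (e) are equal,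
not merely simultaneously zero.

Invariants. In an adapted frame the decomposition of 𝒬_L into Rüdiger's invariant and the
contribution of *W is a polynomial identity in the components of Y and ∇Y (`rudiger_identity`). A
tensor of mixed symmetry is determined by its components T_{i00} in all adapted frames, which the
invariant detects (`LocMetric.eq_zero_of_mixedInv`); this gives uniqueness. For existence, if T is
the symmetrization of N, subtract *N from the L of Rüdiger's invariant: since ** = -1, this adds
exactly N to *L. The quasi-invariants linear in the spin are the case of the zero Killing-Yano
tensor.

Covariance. `Rel` describes one metric as the pull-back of another. With a Jacobian it yields
independence of the chart, with a frame matrix it reduces identities to Minkowski components. The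
transformation law of the Christoffel symbols is never needed: ∇Y is one third of dY, and ∇K is
algebraic in Y and ∇Y. -/

/-- Smooth real functions on `U`. -/
abbrev Sm (U : Set Coord) (f : Coord → ℝ) : Prop := ContDiffOn ℝ ∞ f U

theorem Sm.diff (hf : Sm U f) (hU : IsOpen U) (hy : y ∈ U) : DifferentiableAt ℝ f y :=
  (hf.contDiffAt (hU.mem_nhds hy)).differentiableAt (by simp)

theorem Sm.add (hf : Sm U f) (hh : Sm U h) : Sm U fun z => f z + h z := ContDiffOn.add hf hh
theorem Sm.sub (hf : Sm U f) (hh : Sm U h) : Sm U fun z => f z - h z := ContDiffOn.sub hf hh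
theorem Sm.mul (hf : Sm U f) (hh : Sm U h) : Sm U fun z => f z * h z := ContDiffOn.mul hf hh
theorem Sm.neg (hf : Sm U f) : Sm U fun z => -f z := ContDiffOn.neg hf
theorem Sm.const (c : ℝ) : Sm U fun _ => c := contDiffOn_const
theorem Sm.cmul (c : ℝ) (hf : Sm U f) : Sm U fun z => c * f z := (Sm.const c).mul hf
theorem Sm.sum {ι : Type*} {s : Finset ι} {F : ι → Coord → ℝ} (hF : ∀ i, Sm U (F i)) :
    Sm U fun z => ∑ i ∈ s, F i z := ContDiffOn.sum fun i _ => hF i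
theorem Sm.congr (hf : Sm U f) (e : ∀ z ∈ U, h z = f z) : Sm U h := ContDiffOn.congr hf e

theorem pd_congr (hU : IsOpen U) (hy : y ∈ U) (e : ∀ z ∈ U, f z = h z) (α : Idx) :
    pd α f y = pd α h y := by
  have : f =ᶠ[𝓝 y] h := Filter.eventuallyEq_of_mem (hU.mem_nhds hy) e
  rw [pd, pd, this.fderiv_eq]

theorem pd_add (hf : DifferentiableAt ℝ f y) (hh : DifferentiableAt ℝ h y) (α : Idx) :
    pd α (fun z => f z + h z) y = pd α f y + pd α h y := by
  simp only [pd]; rw [fderiv_fun_add hf hh]; rfl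

theorem pd_sub (hf : DifferentiableAt ℝ f y) (hh : DifferentiableAt ℝ h y) (α : Idx) :
    pd α (fun z => f z - h z) y = pd α f y - pd α h y := by
  simp only [pd]; rw [fderiv_fun_sub hf hh]; rfl

theorem pd_neg (α : Idx) : pd α (fun z => -f z) y = -pd α f y := by
  simp only [pd]; rw [fderiv_fun_neg]; rfl

theorem pd_const (c : ℝ) (α : Idx) : pd α (fun _ => c) y = 0 := by
  simp [pd]

theorem pd_mul (hf : DifferentiableAt ℝ f y) (hh : DifferentiableAt ℝ h y) (α : Idx) :
    pd α (fun z => f z * h z) y = pd α f y * h y + f y * pd α h y := by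
  simp only [pd]; rw [fderiv_fun_mul hf hh]
  simp [mul_comm, add_comm]

theorem pd_cmul (c : ℝ) (hf : DifferentiableAt ℝ f y) (α : Idx) :
    pd α (fun z => c * f z) y = c * pd α f y := by
  rw [pd_mul (differentiableAt_const c) hf, pd_const]; ring

theorem pd_sum {ι : Type*} {s : Finset ι} {F : ι → Coord → ℝ}
    (hF : ∀ i, DifferentiableAt ℝ (F i) y) (α : Idx) :
    pd α (fun z => ∑ i ∈ s, F i z) y = ∑ i ∈ s, pd α (F i) y := by
  simp only [pd]; rw [fderiv_fun_sum fun i _ => hF i]; simp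

theorem Sm.pd (hU : IsOpen U) (hf : Sm U f) (α : Idx) : Sm U fun z => SpinKY.pd α f z :=
  (hf.fderiv_of_isOpen hU (m := ∞) (by simp)).clm_apply contDiffOn_const

theorem pd_comm (hU : IsOpen U) (hy : y ∈ U) (hf : Sm U f) (α β : Idx) :
    pd α (fun z => pd β f z) y = pd β (fun z => pd α f z) y := by
  have hd : DifferentiableAt ℝ (fderiv ℝ f) y :=
    ((hf.fderiv_of_isOpen hU (m := ∞) (by simp)).contDiffAt (hU.mem_nhds hy)).differentiableAt
      (by simp)
  have key : ∀ u w : Coord, fderiv ℝ (fun z => fderiv ℝ f z u) y w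
      = fderiv ℝ (fderiv ℝ f) y w u := by
    intro u w
    rw [fderiv_clm_apply hd (differentiableAt_const u)]; simp
  simp only [pd, key]
  have hs : IsSymmSndFDerivAt ℝ f y :=
    ContDiffAt.isSymmSndFDerivAt (n := ∞) (hf.contDiffAt (hU.mem_nhds hy))
      (by simpa using WithTop.coe_le_coe.2 (le_top : (2 : ℕ∞) ≤ ⊤))
  exact hs _ _

theorem fderiv_eq_sum_pd (f : Coord → ℝ) (y v : Coord) :
    fderiv ℝ f y v = ∑ α, v α * pd α f y := by
  conv_lhs => rw [← Finset.univ_sum_single v]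
  rw [map_sum]
  refine Finset.sum_congr rfl fun α _ => ?_
  have : (Pi.single α (v α) : Coord) = v α • Pi.single α (1 : ℝ) := by
    rw [← Pi.single_smul]; simp
  rw [this, map_smul, pd, smul_eq_mul]

end Calculus

/-! ## Determinants and the permutation symbol -/

/-- The determinant of the matrix with rows `u, v, w, x`. -/
def det4 (u v w x : Idx → ℝ) : ℝ :=
  u 0 * v 1 * w 2 * x 3 - u 0 * v 1 * w 3 * x 2 - u 0 * v 2 * w 1 * x 3
    + u 0 * v 2 * w 3 * x 1 + u 0 * v 3 * w 1 * x 2 - u 0 * v 3 * w 2 * x 1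
    - u 1 * v 0 * w 2 * x 3 + u 1 * v 0 * w 3 * x 2 + u 1 * v 2 * w 0 * x 3
    - u 1 * v 2 * w 3 * x 0 - u 1 * v 3 * w 0 * x 2 + u 1 * v 3 * w 2 * x 0
    + u 2 * v 0 * w 1 * x 3 - u 2 * v 0 * w 3 * x 1 - u 2 * v 1 * w 0 * x 3
    + u 2 * v 1 * w 3 * x 0 + u 2 * v 3 * w 0 * x 1 - u 2 * v 3 * w 1 * x 0
    - u 3 * v 0 * w 1 * x 2 + u 3 * v 0 * w 2 * x 1 + u 3 * v 1 * w 0 * x 2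
    - u 3 * v 1 * w 2 * x 0 - u 3 * v 2 * w 0 * x 1 + u 3 * v 2 * w 1 * x 0
   

theorem det_eq_det4 (A : Matrix Idx Idx ℝ) : A.det = det4 (A 0) (A 1) (A 2) (A 3) := by
  simp only [Matrix.det_succ_row_zero, Fin.sum_univ_succ, Matrix.submatrix_apply, det4,
    Matrix.det_unique, Fin.default_eq_zero, Fin.succ_zero_eq_one, Fin.succ_one_eq_two]
  simp [Fin.succAbove, Fin.lt_def, Fin.succ]
  ring

theorem permSymbol_eq (α β γ δ : Idx) : permSymbol α β γ δ =
    det4 (Pi.single α 1) (Pi.single β 1) (Pi.single γ 1) (Pi.single δ 1) := by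
  rw [permSymbol, det_eq_det4]
  simp [Pi.single_apply, det4, eq_comm]

theorem det4_lin₀ (u v w x : Idx → ℝ) :
    det4 u v w x = ∑ a, u a * det4 (Pi.single a 1) v w x := by
  simp [Fin.sum_univ_four, det4]; ring

theorem det4_lin₁ (u v w x : Idx → ℝ) :
    det4 u v w x = ∑ a, v a * det4 u (Pi.single a 1) w x := by
  simp [Fin.sum_univ_four, det4]; ring

theorem det4_lin₂ (u v w x : Idx → ℝ) :
    det4 u v w x = ∑ a, w a * det4 u v (Pi.single a 1) x := by
  simp [Fin.sum_univ_four, det4]; ring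

theorem det4_lin₃ (u v w x : Idx → ℝ) :
    det4 u v w x = ∑ a, x a * det4 u v w (Pi.single a 1) := by
  simp [Fin.sum_univ_four, det4]; ring

/-- Multilinearity in each row. As a sum of products the determinant becomes accessible to the
product rule and to smoothness of products. -/
theorem det4_sum (u v w x : Idx → ℝ) : det4 u v w x =
    ∑ a, ∑ b, ∑ c, ∑ d, permSymbol a b c d * (u a * v b * w c * x d) := by
  rw [det4_lin₀]
  refine Finset.sum_congr rfl fun a _ => ?_
  rw [det4_lin₁, Finset.mul_sum]
  refine Finset.sum_congr rfl fun b _ => ?_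
  rw [det4_lin₂, Finset.mul_sum, Finset.mul_sum]
  refine Finset.sum_congr rfl fun c _ => ?_
  rw [det4_lin₃, Finset.mul_sum, Finset.mul_sum, Finset.mul_sum]
  refine Finset.sum_congr rfl fun d _ => ?_
  rw [permSymbol_eq]; ring

/-- A linear map acting as a derivation on a form of top degree multiplies it by its trace. Here the
map mixes the entries within each row. -/
theorem det4_trace (N : Idx → Idx → ℝ) (u v w x : Idx → ℝ) :
    det4 (fun j => ∑ l, u l * N l j) v w x + det4 u (fun j => ∑ l, v l * N l j) w x
      + det4 u v (fun j => ∑ l, w l * N l j) x + det4 u v w (fun j => ∑ l, x l * N l j)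
      = (∑ l, N l l) * det4 u v w x := by
  simp only [det4, Fin.sum_univ_four]; ring

/-- The same trace formula with the map mixing the rows. Both versions are needed because the
derivative of the metric carries one connection term per index. -/
theorem det4_trace_row (N : Idx → Idx → ℝ) (u : Idx → Idx → ℝ) :
    det4 (fun j => ∑ l, N 0 l * u l j) (u 1) (u 2) (u 3)
      + det4 (u 0) (fun j => ∑ l, N 1 l * u l j) (u 2) (u 3)
      + det4 (u 0) (u 1) (fun j => ∑ l, N 2 l * u l j) (u 3)
      + det4 (u 0) (u 1) (u 2) (fun j => ∑ l, N 3 l * u l j)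
      = (∑ l, N l l) * det4 (u 0) (u 1) (u 2) (u 3) := by
  simp only [det4, Fin.sum_univ_four]; ring

theorem sum_permSymbol (N : Idx → Idx → ℝ) (α β γ δ : Idx) :
    ∑ l, (N α l * permSymbol l β γ δ + N β l * permSymbol α l γ δ
      + N γ l * permSymbol α β l δ + N δ l * permSymbol α β γ l)
      = (∑ l, N l l) * permSymbol α β γ δ := by
  have hs : ∀ i, (fun j => ∑ l, (Pi.single i 1 : Idx → ℝ) l * N l j) = N i := by
    intro i; funext j; simp [Pi.single_apply]
  have h := det4_trace N (Pi.single α 1) (Pi.single β 1) (Pi.single γ 1) (Pi.single δ 1)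
  rw [hs, hs, hs, hs, det4_lin₀ (N α), det4_lin₁ _ (N β), det4_lin₂ _ _ (N γ),
    det4_lin₃ _ _ _ (N δ)] at h
  simp only [Finset.sum_add_distrib, permSymbol_eq]
  exact h

theorem pd_det4 {y : Coord} {u v w x : Coord → Idx → ℝ}
    (hu : ∀ i, DifferentiableAt ℝ (fun z => u z i) y)
    (hv : ∀ i, DifferentiableAt ℝ (fun z => v z i) y)
    (hw : ∀ i, DifferentiableAt ℝ (fun z => w z i) y)
    (hx : ∀ i, DifferentiableAt ℝ (fun z => x z i) y) (δ : Idx) :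
    pd δ (fun z => det4 (u z) (v z) (w z) (x z)) y =
      det4 (fun i => pd δ (fun z => u z i) y) (v y) (w y) (x y)
      + det4 (u y) (fun i => pd δ (fun z => v z i) y) (w y) (x y)
      + det4 (u y) (v y) (fun i => pd δ (fun z => w z i) y) (x y)
      + det4 (u y) (v y) (w y) (fun i => pd δ (fun z => x z i) y) := by
  simp only [det4_sum, ← Finset.sum_add_distrib]
  rw [pd_sum fun a => by fun_prop]
  refine Finset.sum_congr rfl fun a _ => ?_
  rw [pd_sum fun a => by fun_prop]
  refine Finset.sum_congr rfl fun b _ => ?_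
  rw [pd_sum fun a => by fun_prop]
  refine Finset.sum_congr rfl fun c _ => ?_
  rw [pd_sum fun a => by fun_prop]
  refine Finset.sum_congr rfl fun d _ => ?_
  rw [pd_cmul _ (by fun_prop), pd_mul (by fun_prop) (by fun_prop),
    pd_mul (by fun_prop) (by fun_prop), pd_mul (by fun_prop) (by fun_prop)]
  ring

theorem Sm.det4 {U : Set Coord} {u v w x : Coord → Idx → ℝ} (hu : ∀ i, Sm U fun z => u z i)
    (hv : ∀ i, Sm U fun z => v z i) (hw : ∀ i, Sm U fun z => w z i)
    (hx : ∀ i, Sm U fun z => x z i) : Sm U fun z => SpinKY.det4 (u z) (v z) (w z) (x z) := by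
  simp only [det4_sum]
  exact Sm.sum fun a => Sm.sum fun b => Sm.sum fun c => Sm.sum fun d =>
    Sm.cmul _ ((((hu a).mul (hv b)).mul (hw c)).mul (hx d))

/-! ## A Lorentz metric in one chart -/

/-- A smooth metric of signature `(-,+,+,+)` on the open set `U`. -/
structure LocMetric (U : Set Coord) (g : F2) : Prop where
  isOpen : IsOpen U
  smooth : ∀ α β, Sm U fun z => g z α β
  symm : ∀ y ∈ U, ∀ α β, g y α β = g y β α
  signature : ∀ y ∈ U, ∃ A : Matrix Idx Idx ℝ,
    A.transpose * Matrix.of (g y) * A = Matrix.diagonal ![-1, 1, 1, 1]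

section Local

variable {U : Set Coord} {g : F2} {y : Coord} (hg : LocMetric U g) (hy : y ∈ U)
include hg hy

theorem LocMetric.det_neg : (Matrix.of (g y)).det < 0 := by
  obtain ⟨A, hA⟩ := hg.signature y hy
  have h := congrArg Matrix.det hA
  rw [Matrix.det_mul, Matrix.det_mul, Matrix.det_transpose, Matrix.det_diagonal] at h
  simp [Fin.prod_univ_four] at h
  by_contra hn
  nlinarith [mul_nonneg (mul_self_nonneg A.det) (not_lt.1 hn)]

theorem LocMetric.isUnit_det : IsUnit (Matrix.of (g y)).det :=
  isUnit_iff_ne_zero.2 (hg.det_neg hy).ne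

theorem LocMetric.ginv_mul (a b : Idx) :
    ∑ k, ginv g y a k * g y k b = if a = b then 1 else 0 := by
  have := congrFun (congrFun (Matrix.nonsing_inv_mul _ (hg.isUnit_det hy)) a) b
  rwa [Matrix.mul_apply, Matrix.one_apply] at this

theorem LocMetric.mul_ginv (a b : Idx) :
    ∑ k, g y a k * ginv g y k b = if a = b then 1 else 0 := by
  have := congrFun (congrFun (Matrix.mul_nonsing_inv _ (hg.isUnit_det hy)) a) b
  rwa [Matrix.mul_apply, Matrix.one_apply] at this

theorem LocMetric.ginv_symm (a b : Idx) : ginv g y a b = ginv g y b a := by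
  have : (Matrix.of (g y)).transpose = Matrix.of (g y) := by
    ext i j; exact hg.symm y hy j i
  have h2 := Matrix.transpose_nonsing_inv (Matrix.of (g y))
  rw [this] at h2
  exact congrFun (congrFun h2 b) a

theorem LocMetric.christoffel_symm (l a b : Idx) :
    christoffel g y l a b = christoffel g y l b a := by
  unfold christoffel
  congr 1
  refine Finset.sum_congr rfl fun s _ => ?_
  rw [pd_congr hg.isOpen hy (fun z hz => hg.symm z hz a b)]
  ring

theorem LocMetric.sum_christoffel (s a b : Idx) :
    ∑ l, g y s l * christoffel g y l a b =
      (1 / 2) * (pd a (fun z => g z s b) y + pd b (fun z => g z s a) y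
        - pd s (fun z => g z a b) y) := by
  have h : ∀ F : Idx → ℝ, ∑ l, g y s l * ((1 / 2) * ∑ t, ginv g y l t * F t)
      = (1 / 2) * F s := by
    intro F
    have : ∀ t, ∑ l, g y s l * ginv g y l t * F t = (if s = t then 1 else 0) * F t := by
      intro t; rw [← Finset.sum_mul, hg.mul_ginv hy]
    simp only [Finset.mul_sum]
    rw [Finset.sum_comm]
    calc _ = ∑ t, (1 / 2) * ∑ l, g y s l * ginv g y l t * F t := by
            refine Finset.sum_congr rfl fun t _ => ?_
            rw [Finset.mul_sum]
            exact Finset.sum_congr rfl fun l _ => by ring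
      _ = _ := by simp only [this]; simp
  exact h _

/-- This is ∇g = 0. Adding the two lowered Christoffel symbols with `a` and `b` exchanged cancels
all derivatives of the metric but one. -/
theorem LocMetric.pd_metric (δ a b : Idx) : pd δ (fun z => g z a b) y =
    ∑ l, (christoffel g y l δ a * g y l b + christoffel g y l δ b * g y a l) := by
  have h1 := hg.sum_christoffel hy b δ a
  have h2 := hg.sum_christoffel hy a δ b
  have e1 : pd a (fun z => g z b δ) y = pd a (fun z => g z δ b) y :=
    pd_congr hg.isOpen hy (fun z hz => hg.symm z hz _ _) a
  have e2 : pd δ (fun z => g z b a) y = pd δ (fun z => g z a b) y :=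
    pd_congr hg.isOpen hy (fun z hz => hg.symm z hz _ _) δ
  have e3 : pd b (fun z => g z a δ) y = pd b (fun z => g z δ a) y :=
    pd_congr hg.isOpen hy (fun z hz => hg.symm z hz _ _) b
  rw [e1, e2] at h1
  rw [e3] at h2
  have e4 : ∑ l, christoffel g y l δ a * g y l b = ∑ l, g y b l * christoffel g y l δ a :=
    Finset.sum_congr rfl fun l _ => by rw [hg.symm y hy l b]; ring
  have e5 : ∑ l, christoffel g y l δ b * g y a l = ∑ l, g y a l * christoffel g y l δ b :=
    Finset.sum_congr rfl fun l _ => by ring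
  rw [Finset.sum_add_distrib, e4, e5]
  linarith

omit hy in
theorem LocMetric.smooth_det : Sm U fun z => (Matrix.of (g z)).det := by
  simp only [det_eq_det4]
  exact Sm.det4 (hg.smooth 0) (hg.smooth 1) (hg.smooth 2) (hg.smooth 3)

omit hy in
-- Cramer's rule: the entries are quotients of determinants of smooth entries, and the denominator
-- is negative everywhere on `U`.
theorem LocMetric.smooth_ginv (a b : Idx) : Sm U fun z => ginv g z a b := by
  have h : ∀ z, ginv g z a b =
      ((Matrix.of (g z)).det)⁻¹ * (Matrix.of (g z)).adjugate a b := by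
    intro z; simp [ginv, Matrix.inv_def]
  simp only [h]
  refine Sm.mul (hg.smooth_det.inv fun z hz => (hg.det_neg hz).ne) ?_
  have := hg.smooth
  have hs : ∀ i j, Sm U fun z => (Matrix.of (g z)).updateRow b (Pi.single a 1) i j := by
    intro i j
    by_cases hi : i = b
    · subst hi; simp only [Matrix.updateRow_self]; exact Sm.const _
    · simp only [Matrix.updateRow_ne hi, Matrix.of_apply]; exact this i j
  simp only [Matrix.adjugate_apply, det_eq_det4]
  exact Sm.det4 (hs 0) (hs 1) (hs 2) (hs 3)

omit hy in
theorem LocMetric.smooth_vol : Sm U fun z => Real.sqrt (-(Matrix.of (g z)).det) :=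
  hg.smooth_det.neg.sqrt fun _ hz => (neg_pos.2 (hg.det_neg hz)).ne'

omit hy in
theorem LocMetric.smooth_eps (a b c d : Idx) : Sm U fun z => eps g z a b c d :=
  hg.smooth_vol.mul (Sm.const _)

omit hy in
theorem LocMetric.smooth_epsMixed (a b c d : Idx) : Sm U fun z => epsMixed g z a b c d :=
  Sm.sum fun _ => Sm.sum fun _ =>
    ((hg.smooth_ginv _ _).mul (hg.smooth_ginv _ _)).mul (hg.smooth_eps _ _ _ _)

omit hy in
theorem LocMetric.smooth_christoffel (a b c : Idx) : Sm U fun z => christoffel g z a b c :=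
  Sm.cmul _ <| Sm.sum fun _ => (hg.smooth_ginv _ _).mul <|
    (((hg.smooth _ _).pd hg.isOpen _).add ((hg.smooth _ _).pd hg.isOpen _)).sub
      ((hg.smooth _ _).pd hg.isOpen _)

end Local

/-! ## Metric compatibility -/

section Local

variable {U : Set Coord} {g : F2} {y : Coord} (hg : LocMetric U g) (hy : y ∈ U)
include hg hy

/-- Differentiate the relation of the inverse metric to the metric, insert ∇g = 0, and multiply by
the inverse metric from the right. -/
theorem LocMetric.pd_ginv (δ a b : Idx) : pd δ (fun z => ginv g z a b) y =
    -∑ l, (ginv g y a l * christoffel g y b δ l + christoffel g y a δ l * ginv g y l b) := by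
  set P : Matrix Idx Idx ℝ := Matrix.of fun a b => pd δ (fun z => ginv g z a b) y with hP
  set G : Matrix Idx Idx ℝ := Matrix.of (g y) with hG
  set N : Matrix Idx Idx ℝ := Matrix.of fun k l => christoffel g y l δ k with hN
  have hu : IsUnit G.det := hg.isUnit_det hy
  have hPG : P * G + G⁻¹ * (N * G + G * N.transpose) = 0 := by
    ext i j
    have h0 : pd δ (fun z => ∑ k, ginv g z i k * g z k j) y = 0 := by
      rw [pd_congr hg.isOpen hy (fun z hz => hg.ginv_mul hz i j), pd_const]
    have hd1 := fun k => (hg.smooth_ginv i k).diff hg.isOpen hy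
    have hd2 := fun k => (hg.smooth k j).diff hg.isOpen hy
    rw [pd_sum (fun k => by fun_prop)] at h0
    simp only [Matrix.add_apply, Matrix.mul_apply, Matrix.zero_apply, ← Finset.sum_add_distrib]
    rw [← h0]
    refine Finset.sum_congr rfl fun k _ => ?_
    rw [pd_mul (hd1 k) (hd2 k), hg.pd_metric hy]
    simp only [hP, hG, hN, Matrix.of_apply, Matrix.transpose_apply, ginv]
    rw [Finset.sum_add_distrib, Finset.sum_add_distrib]
    congr 3
    exact Finset.sum_congr rfl fun l _ => mul_comm _ _
  have h1 : P = -(G⁻¹ * N) - N.transpose * G⁻¹ := by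
    have e1 : P * G = -(G⁻¹ * (N * G + G * N.transpose)) := eq_neg_of_add_eq_zero_left hPG
    calc P = P * G * G⁻¹ := by rw [Matrix.mul_assoc, Matrix.mul_nonsing_inv _ hu, mul_one]
      _ = _ := by
        rw [e1, Matrix.mul_add, ← Matrix.mul_assoc G⁻¹ G, Matrix.nonsing_inv_mul _ hu, one_mul,
          neg_mul, add_mul, ← Matrix.mul_assoc G⁻¹ N G, Matrix.mul_assoc (G⁻¹ * N),
          Matrix.mul_nonsing_inv _ hu, mul_one, neg_add, sub_eq_add_neg]
  have h2 := congrFun (congrFun h1 a) b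
  simp only [Matrix.sub_apply, Matrix.neg_apply, Matrix.mul_apply, Matrix.transpose_apply] at h2
  rw [Finset.sum_add_distrib, neg_add, ← sub_eq_add_neg]
  exact h2

/-- Jacobi's formula. The two connection terms in the derivative of the metric act on rows and on
columns, and each contributes one trace, whence the factor 2. -/
theorem LocMetric.pd_det (δ : Idx) : pd δ (fun z => (Matrix.of (g z)).det) y =
    2 * (∑ l, christoffel g y l δ l) * (Matrix.of (g y)).det := by
  have hs := fun i j => (hg.smooth i j).diff hg.isOpen hy
  simp only [det_eq_det4]
  change pd δ (fun z => det4 (g z 0) (g z 1) (g z 2) (g z 3)) y =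
    2 * (∑ l, christoffel g y l δ l) * det4 (g y 0) (g y 1) (g y 2) (g y 3)
  rw [pd_det4 (hs 0) (hs 1) (hs 2) (hs 3)]
  simp only [hg.pd_metric hy, Finset.sum_add_distrib]
  have h1 := det4_trace_row (fun i l => christoffel g y l δ i) (g y)
  have h2 := det4_trace (fun l i => christoffel g y l δ i) (g y 0) (g y 1) (g y 2) (g y 3)
  simp only [mul_comm (g y _ _)] at h2
  -- Multilinearity separates the row action from the column action, so that each trace formula
  -- applies on its own.
  have hadd : ∀ u v w x u0 v0 w0 x0 u1 v1 w1 x1 : Idx → ℝ,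
      det4 (fun i => u0 i + u1 i) v w x + det4 u (fun i => v0 i + v1 i) w x
      + det4 u v (fun i => w0 i + w1 i) x + det4 u v w (fun i => x0 i + x1 i)
      = (det4 u0 v w x + det4 u v0 w x + det4 u v w0 x + det4 u v w x0)
        + (det4 u1 v w x + det4 u v1 w x + det4 u v w1 x + det4 u v w x1) := by
    intros; simp only [det4]; ring
  rw [hadd, h1, h2]
  ring

/-- Differentiating the square of the volume factor and dividing by the factor, which is positive,
halves the formula for the determinant. -/
theorem LocMetric.pd_vol (δ : Idx) : pd δ (fun z => Real.sqrt (-(Matrix.of (g z)).det)) y =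
    (∑ l, christoffel g y l δ l) * Real.sqrt (-(Matrix.of (g y)).det) := by
  set v : Coord → ℝ := fun z => Real.sqrt (-(Matrix.of (g z)).det)
  have hv : DifferentiableAt ℝ v y := hg.smooth_vol.diff hg.isOpen hy
  have hpos : 0 < v y := Real.sqrt_pos.2 (neg_pos.2 (hg.det_neg hy))
  have hsq : ∀ z ∈ U, v z * v z = -(Matrix.of (g z)).det := fun z hz =>
    Real.mul_self_sqrt (neg_pos.2 (hg.det_neg hz)).le
  have h := pd_congr hg.isOpen hy hsq δ
  rw [pd_mul hv hv, pd_neg, hg.pd_det hy] at h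
  have h2 := hsq y hy
  have : v y * (pd δ v y - (∑ l, christoffel g y l δ l) * v y) = 0 := by
    linear_combination (1/2) * h - (∑ l, christoffel g y l δ l) * h2
  rcases mul_eq_zero.1 this with h3 | h3
  · exact absurd h3 hpos.ne'
  · linarith

/-- This is ∇ε = 0: the trace produced by the volume factor is exactly the trace produced by the
connection acting on the permutation symbol. -/
theorem LocMetric.pd_eps (δ a b c d : Idx) : pd δ (fun z => eps g z a b c d) y =
    ∑ l, (christoffel g y l δ a * eps g y l b c d + christoffel g y l δ b * eps g y a l c d
      + christoffel g y l δ c * eps g y a b l d + christoffel g y l δ d * eps g y a b c l) := by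
  have h := sum_permSymbol (fun i l => christoffel g y l δ i) a b c d
  simp only [eps]
  rw [pd_mul (hg.smooth_vol.diff hg.isOpen hy) (differentiableAt_const _), pd_const, mul_zero,
    add_zero, hg.pd_vol hy]
  have : ∀ l, christoffel g y l δ a * (Real.sqrt (-(Matrix.of (g y)).det) * permSymbol l b c d)
      + christoffel g y l δ b * (Real.sqrt (-(Matrix.of (g y)).det) * permSymbol a l c d)
      + christoffel g y l δ c * (Real.sqrt (-(Matrix.of (g y)).det) * permSymbol a b l d)
      + christoffel g y l δ d * (Real.sqrt (-(Matrix.of (g y)).det) * permSymbol a b c l)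
      = Real.sqrt (-(Matrix.of (g y)).det) * (christoffel g y l δ a * permSymbol l b c d
        + christoffel g y l δ b * permSymbol a l c d + christoffel g y l δ c * permSymbol a b l d
        + christoffel g y l δ d * permSymbol a b c l) := by intro l; ring
  simp only [this]
  rw [← Finset.mul_sum, h]
  ring

theorem LocMetric.pd_epsMixed (δ a b c d : Idx) : pd δ (fun z => epsMixed g z a b c d) y =
    ∑ l, (christoffel g y l δ a * epsMixed g y l b c d + christoffel g y l δ b * epsMixed g y a l c d
      - christoffel g y c δ l * epsMixed g y a b l d
      - christoffel g y d δ l * epsMixed g y a b c l) := by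
  have d1 := fun a b => (hg.smooth_ginv a b).diff hg.isOpen hy
  have d2 := fun a b c d => (hg.smooth_eps a b c d).diff hg.isOpen hy
  unfold epsMixed
  rw [pd_sum fun k => by fun_prop]
  have : ∀ k, pd δ (fun z => ∑ l, ginv g z c k * ginv g z d l * eps g z a b k l) y
      = ∑ l, ((pd δ (fun z => ginv g z c k) y * ginv g y d l
        + ginv g y c k * pd δ (fun z => ginv g z d l) y) * eps g y a b k l
        + ginv g y c k * ginv g y d l * pd δ (fun z => eps g z a b k l) y) := by
    intro k
    rw [pd_sum fun k => by fun_prop]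
    refine Finset.sum_congr rfl fun l _ => ?_
    rw [pd_mul (by fun_prop) (by fun_prop), pd_mul (by fun_prop) (by fun_prop)]
  simp only [this, hg.pd_ginv hy, hg.pd_eps hy]
  -- What is left is a polynomial identity: the connection terms on the two contracted index pairs
  -- cancel between the inverse metrics and ε.
  generalize ginv g y = G
  generalize eps g y = E
  generalize christoffel g y = C
  simp only [Fin.sum_univ_four]
  ring

end Local

/-! ## Rules for covariant derivatives -/

section Local

variable {U : Set Coord} {g : F2} {y : Coord}

theorem LocMetric.smooth_cov2 (hg : LocMetric U g) {A : F2} (hA : ∀ a b, Sm U fun z => A z a b)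
    (a b c : Idx) : Sm U fun z => cov2 g A z a b c :=
  ((hA a b).pd hg.isOpen c).sub <| Sm.sum fun l =>
    ((hg.smooth_christoffel l c a).mul (hA l b)).add ((hg.smooth_christoffel l c b).mul (hA a l))

theorem LocMetric.smooth_star2 (hg : LocMetric U g) {A : F2} (hA : ∀ a b, Sm U fun z => A z a b)
    (a b : Idx) : Sm U fun z => star2 g A z a b :=
  Sm.cmul _ <| Sm.sum fun _ => Sm.sum fun _ => (hg.smooth_epsMixed _ _ _ _).mul (hA _ _)

theorem LocMetric.smooth_star3 (hg : LocMetric U g) {A : F3}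
    (hA : ∀ a b c, Sm U fun z => A z a b c) (a b c : Idx) : Sm U fun z => star3 g A z a b c :=
  hg.smooth_star2 (A := fun z i j => A z i j c) (fun i j => hA i j c) a b

theorem LocMetric.smooth_raise2 (hg : LocMetric U g) {A : F2} (hA : ∀ a b, Sm U fun z => A z a b)
    (a b : Idx) : Sm U fun z => raise2 g A z a b :=
  Sm.sum fun _ => Sm.sum fun _ => ((hg.smooth_ginv _ _).mul (hg.smooth_ginv _ _)).mul (hA _ _)

theorem LocMetric.smooth_kySquare (hg : LocMetric U g) {Y : F2}
    (hY : ∀ a b, Sm U fun z => Y z a b) (a b : Idx) : Sm U fun z => kySquare g Y z a b :=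
  Sm.sum fun _ => Sm.sum fun _ => ((hY _ _).mul (hg.smooth_ginv _ _)).mul (hY _ _)

theorem LocMetric.smooth_kyScalar (hg : LocMetric U g) {Y : F2}
    (hY : ∀ a b, Sm U fun z => Y z a b) : Sm U (kyScalar g Y) :=
  Sm.cmul _ <| Sm.sum fun _ => Sm.sum fun _ => (hg.smooth_star2 hY _ _).mul (hg.smooth_raise2 hY _ _)

theorem pd_eq_cov2 (g A : F2) (y : Coord) (a b c : Idx) : pd c (fun z => A z a b) y =
    cov2 g A y a b c + ∑ l, (christoffel g y l c a * A y l b + christoffel g y l c b * A y a l) := by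
  simp only [cov2]; ring

/-- Freezing the third index turns a 3-tensor into a family of 2-tensors, so that rank 2 rules can
be reused. The price is the connection term of the frozen index. -/
theorem cov2_slice (g : F2) (A : F3) (y : Coord) (a b c d : Idx) :
    cov2 g (fun z i j => A z i j c) y a b d =
      cov3 g A y a b c d + ∑ l, christoffel g y l d c * A y a b l := by
  simp only [cov2, cov3, Finset.sum_add_distrib]; ring

/-- The derivative passes through the dual because ε with two indices raised is covariantly
constant. -/
theorem LocMetric.cov2_star2 (hg : LocMetric U g) (hy : y ∈ U) {A : F2}
    (hA : ∀ a b, Sm U fun z => A z a b) (a b c : Idx) :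
    cov2 g (star2 g A) y a b c = star3 g (cov2 g A) y a b c := by
  have d1 := fun a b c d => (hg.smooth_epsMixed a b c d).diff hg.isOpen hy
  have d2 := fun a b => (hA a b).diff hg.isOpen hy
  have : pd c (fun z => star2 g A z a b) y = (1 / 2) * ∑ r, ∑ s,
      (pd c (fun z => epsMixed g z a b r s) y * A y r s
        + epsMixed g y a b r s * pd c (fun z => A z r s) y) := by
    unfold star2
    rw [pd_cmul _ (by fun_prop), pd_sum (fun k => by fun_prop)]
    congr 1
    refine Finset.sum_congr rfl fun r _ => ?_
    rw [pd_sum (fun k => by fun_prop)]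
    exact Finset.sum_congr rfl fun s _ => pd_mul (by fun_prop) (by fun_prop) _
  rw [cov2, this]
  simp only [hg.pd_epsMixed hy, pd_eq_cov2 g A, star2, star3]
  generalize cov2 g A y = CA
  generalize epsMixed g y = E
  generalize christoffel g y = C
  simp only [Fin.sum_univ_four]
  ring

/-- The third index is a spectator of the dual. Its connection term is split off by `cov2_slice` on
both sides and agrees, since the dual is linear. -/
theorem LocMetric.cov3_star3 (hg : LocMetric U g) (hy : y ∈ U) {A : F3}
    (hA : ∀ a b c, Sm U fun z => A z a b c) (a b c d : Idx) :
    cov3 g (star3 g A) y a b c d = star4 g (cov3 g A) y a b c d := by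
  have h := hg.cov2_star2 hy (fun i j => hA i j c) a b d
  have h1 := cov2_slice g (star3 g A) y a b c d
  have h2 : cov2 g (fun z i j => star3 g A z i j c) y a b d
      = cov2 g (star2 g fun z i j => A z i j c) y a b d := rfl
  rw [h2, h] at h1
  simp only [star3, cov2_slice] at h1
  rw [eq_sub_of_add_eq h1.symm]
  simp only [star4, mul_add, Finset.sum_add_distrib]
  rw [add_sub_assoc, add_eq_left, sub_eq_zero]
  simp only [Fin.sum_univ_four]; ring

theorem LocMetric.pd_raise2 (hg : LocMetric U g) (hy : y ∈ U) {A : F2}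
    (hA : ∀ a b, Sm U fun z => A z a b) (a b c : Idx) :
    pd c (fun z => raise2 g A z a b) y = raise2 g (fun z i j => cov2 g A z i j c) y a b
      - ∑ l, (christoffel g y a c l * raise2 g A y l b
        + christoffel g y b c l * raise2 g A y a l) := by
  have d1 := fun a b => (hg.smooth_ginv a b).diff hg.isOpen hy
  have d2 := fun a b => (hA a b).diff hg.isOpen hy
  have : pd c (fun z => raise2 g A z a b) y = ∑ r, ∑ s,
      ((pd c (fun z => ginv g z a r) y * ginv g y b s
        + ginv g y a r * pd c (fun z => ginv g z b s) y) * A y r s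
        + ginv g y a r * ginv g y b s * pd c (fun z => A z r s) y) := by
    unfold raise2
    rw [pd_sum (fun k => by fun_prop)]
    refine Finset.sum_congr rfl fun r _ => ?_
    rw [pd_sum (fun k => by fun_prop)]
    refine Finset.sum_congr rfl fun s _ => ?_
    rw [pd_mul (by fun_prop) (by fun_prop), pd_mul (by fun_prop) (by fun_prop)]
  rw [this]
  simp only [hg.pd_ginv hy, pd_eq_cov2 g A, raise2]
  generalize cov2 g A y = CA
  generalize ginv g y = E
  generalize christoffel g y = C
  simp only [Fin.sum_univ_four]
  ring

/-- `A_{αβ} B^{αβ}`. -/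
def contr2 (g A B : F2) : Coord → ℝ := fun y => ∑ a, ∑ b, A y a b * raise2 g B y a b

/-- A full contraction is a scalar, so all connection terms cancel and only the Leibniz rule
remains. -/
theorem LocMetric.pd_contr2 (hg : LocMetric U g) (hy : y ∈ U) {A B : F2}
    (hA : ∀ a b, Sm U fun z => A z a b) (hB : ∀ a b, Sm U fun z => B z a b) (c : Idx) :
    pd c (contr2 g A B) y = contr2 g (fun z i j => cov2 g A z i j c) B y
      + contr2 g A (fun z i j => cov2 g B z i j c) y := by
  have d1 := fun a b => (hg.smooth_raise2 hB a b).diff hg.isOpen hy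
  have d2 := fun a b => (hA a b).diff hg.isOpen hy
  have : pd c (contr2 g A B) y = ∑ r, ∑ s, (pd c (fun z => A z r s) y * raise2 g B y r s
      + A y r s * pd c (fun z => raise2 g B z r s) y) := by
    unfold contr2
    rw [pd_sum (fun k => by fun_prop)]
    refine Finset.sum_congr rfl fun r _ => ?_
    rw [pd_sum (fun k => by fun_prop)]
    exact Finset.sum_congr rfl fun s _ => pd_mul (by fun_prop) (by fun_prop) _
  rw [this]
  simp only [hg.pd_raise2 hy hB, pd_eq_cov2 g A, contr2]
  generalize raise2 g (fun z i j => cov2 g B z i j c) y = CB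
  generalize raise2 g B y = RB
  generalize cov2 g A y = CA
  generalize christoffel g y = C
  simp only [Fin.sum_univ_four]
  ring

theorem LocMetric.smooth_contr2 (hg : LocMetric U g) {A B : F2}
    (hA : ∀ a b, Sm U fun z => A z a b) (hB : ∀ a b, Sm U fun z => B z a b) :
    Sm U (contr2 g A B) :=
  Sm.sum fun _ => Sm.sum fun _ => (hA _ _).mul (hg.smooth_raise2 hB _ _)

theorem contr2_add_right (g A B B' : F2) (y : Coord) :
    contr2 g A (fun z i j => B z i j + B' z i j) y = contr2 g A B y + contr2 g A B' y := by
  simp only [contr2, raise2, mul_add, Finset.sum_add_distrib]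

theorem contr2_sum_left (g B : F2) (A : F3) (c : Idx → ℝ) (y : Coord) :
    contr2 g (fun z i j => ∑ l, c l * A z i j l) B y
      = ∑ l, c l * contr2 g (fun z i j => A z i j l) B y := by
  simp only [contr2, Fin.sum_univ_four]; ring

theorem contr2_sum_right (g A : F2) (B : F3) (c : Idx → ℝ) (y : Coord) :
    contr2 g A (fun z i j => ∑ l, c l * B z i j l) y
      = ∑ l, c l * contr2 g A (fun z i j => B z i j l) y := by
  have : ∀ a b, raise2 g (fun z i j => ∑ l, c l * B z i j l) y a b
      = ∑ l, c l * raise2 g (fun z i j => B z i j l) y a b := by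
    intro a b; simp only [raise2, Fin.sum_univ_four]; ring
  simp only [contr2, this]
  generalize (fun l => raise2 g (fun z i j => B z i j l) y) = R
  simp only [Fin.sum_univ_four]; ring

theorem LocMetric.cov2_kySquare (hg : LocMetric U g) (hy : y ∈ U) {Y : F2}
    (hY : ∀ a b, Sm U fun z => Y z a b) (a b c : Idx) :
    cov2 g (kySquare g Y) y a b c = ∑ k, ∑ l, (cov2 g Y y a k c * ginv g y k l * Y y l b
      + Y y a k * ginv g y k l * cov2 g Y y l b c) := by
  have d1 := fun a b => (hg.smooth_ginv a b).diff hg.isOpen hy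
  have d2 := fun a b => (hY a b).diff hg.isOpen hy
  have : pd c (fun z => kySquare g Y z a b) y = ∑ k, ∑ l,
      ((pd c (fun z => Y z a k) y * ginv g y k l
        + Y y a k * pd c (fun z => ginv g z k l) y) * Y y l b
        + Y y a k * ginv g y k l * pd c (fun z => Y z l b) y) := by
    unfold kySquare
    rw [pd_sum (fun k => by fun_prop)]
    refine Finset.sum_congr rfl fun r _ => ?_
    rw [pd_sum (fun k => by fun_prop)]
    refine Finset.sum_congr rfl fun s _ => ?_
    rw [pd_mul (by fun_prop) (by fun_prop), pd_mul (by fun_prop) (by fun_prop)]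
  rw [cov2, this]
  simp only [hg.pd_ginv hy, pd_eq_cov2 g Y, kySquare]
  generalize cov2 g Y y = CA
  generalize ginv g y = E
  generalize christoffel g y = C
  simp only [Fin.sum_univ_four]
  ring

theorem kyScalar_eq (g Y : F2) : kyScalar g Y = fun y => (1 / 4) * contr2 g (star2 g Y) Y y := rfl

theorem LocMetric.pd_kyScalar (hg : LocMetric U g) (hy : y ∈ U) {Y : F2}
    (hY : ∀ a b, Sm U fun z => Y z a b) (c : Idx) :
    pd c (kyScalar g Y) y = (1 / 4) * (contr2 g (fun z i j => star3 g (cov2 g Y) z i j c) Y y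
      + contr2 g (star2 g Y) (fun z i j => cov2 g Y z i j c) y) := by
  rw [kyScalar_eq, pd_cmul _ ((hg.smooth_contr2 (hg.smooth_star2 hY) hY).diff hg.isOpen hy),
    hg.pd_contr2 hy (hg.smooth_star2 hY) hY]
  simp only [contr2, hg.cov2_star2 hy hY]

/-- Differentiating the gradient slice by slice leaves a connection term for the frozen index; it is
the one that the covariant derivative of the gradient subtracts. -/
theorem LocMetric.cov1_grad_kyScalar (hg : LocMetric U g) (hy : y ∈ U) {Y : F2}
    (hY : ∀ a b, Sm U fun z => Y z a b) (c d : Idx) :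
    cov1 g (grad (kyScalar g Y)) y c d = (1 / 4) *
      (contr2 g (fun z i j => star4 g (cov3 g (cov2 g Y)) z i j c d) Y y
      + contr2 g (fun z i j => star3 g (cov2 g Y) z i j c) (fun z i j => cov2 g Y z i j d) y
      + contr2 g (fun z i j => star3 g (cov2 g Y) z i j d) (fun z i j => cov2 g Y z i j c) y
      + contr2 g (star2 g Y) (fun z i j => cov3 g (cov2 g Y) z i j c d) y) := by
  have s1 := fun c i j => hg.smooth_star3 (hg.smooth_cov2 hY) i j c
  have s2 := fun c i j => hg.smooth_cov2 hY i j c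
  have s3 := hg.smooth_star2 hY
  have hp : pd d (fun z => pd c (kyScalar g Y) z) y = (1 / 4) *
      (contr2 g (fun z i j => cov2 g (fun z i j => star3 g (cov2 g Y) z i j c) z i j d) Y y
      + contr2 g (fun z i j => star3 g (cov2 g Y) z i j c) (fun z i j => cov2 g Y z i j d) y
      + (contr2 g (fun z i j => cov2 g (star2 g Y) z i j d) (fun z i j => cov2 g Y z i j c) y
      + contr2 g (star2 g Y)
        (fun z i j => cov2 g (fun z i j => cov2 g Y z i j c) z i j d) y)) := by
    rw [pd_congr hg.isOpen hy (fun z hz => hg.pd_kyScalar hz hY c)]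
    rw [pd_cmul _ (((hg.smooth_contr2 (s1 c) hY).add (hg.smooth_contr2 s3 (s2 c))).diff
      hg.isOpen hy), pd_add ((hg.smooth_contr2 (s1 c) hY).diff hg.isOpen hy)
      ((hg.smooth_contr2 s3 (s2 c)).diff hg.isOpen hy), hg.pd_contr2 hy (s1 c) hY,
      hg.pd_contr2 hy s3 (s2 c)]
  have e1 : contr2 g (fun z i j => cov2 g (fun z i j => star3 g (cov2 g Y) z i j c) z i j d) Y y
      = contr2 g (fun z i j => star4 g (cov3 g (cov2 g Y)) z i j c d) Y y
        + ∑ l, christoffel g y l d c * contr2 g (fun z i j => star3 g (cov2 g Y) z i j l) Y y := by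
    rw [← contr2_sum_left]
    simp only [contr2, cov2_slice, hg.cov3_star3 hy (hg.smooth_cov2 hY), add_mul,
      Finset.sum_add_distrib]
  have e2 : contr2 g (star2 g Y)
        (fun z i j => cov2 g (fun z i j => cov2 g Y z i j c) z i j d) y
      = contr2 g (star2 g Y) (fun z i j => cov3 g (cov2 g Y) z i j c d) y
        + ∑ l, christoffel g y l d c * contr2 g (star2 g Y) (fun z i j => cov2 g Y z i j l) y := by
    rw [← contr2_sum_right, ← contr2_add_right]
    simp only [contr2, cov2_slice, raise2]
  have e3 : contr2 g (fun z i j => cov2 g (star2 g Y) z i j d) (fun z i j => cov2 g Y z i j c) y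
      = contr2 g (fun z i j => star3 g (cov2 g Y) z i j d)
        (fun z i j => cov2 g Y z i j c) y := by
    simp only [contr2, hg.cov2_star2 hy hY]
  simp only [cov1, grad]
  rw [hp, e1, e2, e3]
  simp only [hg.pd_kyScalar hy hY, Fin.sum_univ_four]
  ring

theorem cov3_add {A B : F3} (hA : ∀ a b c, DifferentiableAt ℝ (fun z => A z a b c) y)
    (hB : ∀ a b c, DifferentiableAt ℝ (fun z => B z a b c) y) (a b c d : Idx) :
    cov3 g (fun z i j k => A z i j k + B z i j k) y a b c d
      = cov3 g A y a b c d + cov3 g B y a b c d := by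
  simp only [cov3]
  rw [pd_add (hA a b c) (hB a b c)]
  simp only [Fin.sum_univ_four]; ring

theorem cov3_cmul (r : ℝ) {A : F3} (hA : ∀ a b c, DifferentiableAt ℝ (fun z => A z a b c) y)
    (a b c d : Idx) :
    cov3 g (fun z i j k => r * A z i j k) y a b c d = r * cov3 g A y a b c d := by
  simp only [cov3]
  rw [pd_cmul r (hA a b c)]
  simp only [Fin.sum_univ_four]; ring

theorem cov3_congr (hU : IsOpen U) (hy : y ∈ U) {A B : F3}
    (h : ∀ z ∈ U, ∀ a b c, A z a b c = B z a b c) (a b c d : Idx) :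
    cov3 g A y a b c d = cov3 g B y a b c d := by
  simp only [cov3, h y hy]
  rw [pd_congr hU hy fun z hz => h z hz a b c]

/-- `v_α g_{βγ} - v_β g_{αγ}`. -/
def wedge (g : F2) (v : F1) : F3 := fun y a b c => v y a * g y b c - v y b * g y a c

theorem LocMetric.cov3_wedge (hg : LocMetric U g) (hy : y ∈ U) {v : F1}
    (hv : ∀ a, Sm U fun z => v z a) (a b c d : Idx) :
    cov3 g (wedge g v) y a b c d = cov1 g v y a d * g y b c - cov1 g v y b d * g y a c := by
  have d1 := fun a b => (hg.smooth a b).diff hg.isOpen hy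
  have d2 := fun a => (hv a).diff hg.isOpen hy
  simp only [cov3, wedge, cov1]
  rw [pd_sub (by fun_prop) (by fun_prop), pd_mul (d2 a) (d1 b c), pd_mul (d2 b) (d1 a c)]
  simp only [hg.pd_metric hy, Fin.sum_univ_four]
  ring

end Local

/-! ## The Ricci identity and the symmetries of the curvature -/

section Local

variable {U : Set Coord} {g : F2} {y : Coord}

/-- Second partial derivatives commute, and the connection terms on the derivative indices cancel
because the Christoffel symbols are symmetric. The derivative of the connection and its square
assemble into the curvature. -/
theorem LocMetric.ricci_identity (hg : LocMetric U g) (hy : y ∈ U) {A : F2}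
    (hA : ∀ a b, Sm U fun z => A z a b) (m n a b : Idx) :
    cov3 g (cov2 g A) y m n b a - cov3 g (cov2 g A) y m n a b =
      -∑ l, (riemannUp g y l m a b * A y l n + riemannUp g y l n a b * A y m l) := by
  have dC := fun a b c => (hg.smooth_christoffel a b c).diff hg.isOpen hy
  have dA := fun a b => (hA a b).diff hg.isOpen hy
  have dpA := fun a b c => ((hA a b).pd hg.isOpen c).diff hg.isOpen hy
  have hp : ∀ b a, pd a (fun z => cov2 g A z m n b) y =
      pd a (fun z => pd b (fun z => A z m n) z) y - ∑ l,
        (pd a (fun z => christoffel g z l b m) y * A y l n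
          + christoffel g y l b m * pd a (fun z => A z l n) y
          + (pd a (fun z => christoffel g z l b n) y * A y m l
          + christoffel g y l b n * pd a (fun z => A z m l) y)) := by
    intro b a
    unfold cov2
    rw [pd_sub (dpA m n b) (by fun_prop), pd_sum (fun k => by fun_prop)]
    congr 1
    refine Finset.sum_congr rfl fun l _ => ?_
    rw [pd_add (by fun_prop) (by fun_prop), pd_mul (by fun_prop) (by fun_prop),
      pd_mul (by fun_prop) (by fun_prop)]
  have hs := pd_comm hg.isOpen hy (hA m n) a b
  have hsym := hg.christoffel_symm hy
  simp only [cov3]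
  rw [hp, hp, hs]
  simp only [pd_eq_cov2 g A, riemannUp, fun l => hsym l b a]
  simp only [cov2]
  generalize A y = A0
  generalize christoffel g y = C
  simp only [Fin.sum_univ_four]
  ring

theorem riemannUp_antisymm (g : F2) (y : Coord) (l m a b : Idx) :
    riemannUp g y l m a b = -riemannUp g y l m b a := by
  simp only [riemannUp, Finset.sum_sub_distrib]; ring

theorem LocMetric.riemannUp_bianchi (hg : LocMetric U g) (hy : y ∈ U) (l m a b : Idx) :
    riemannUp g y l m a b + riemannUp g y l a b m + riemannUp g y l b m a = 0 := by
  have hs := fun c a b => pd_congr hg.isOpen hy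
    (fun z hz => hg.christoffel_symm hz l a b) c
  have hsym := hg.christoffel_symm hy
  simp only [riemannUp, Finset.sum_sub_distrib]
  rw [hs a b m, hs b a m, hs m b a]
  simp only [fun s => hsym s b m, fun s => hsym s a m, fun s => hsym s b a]
  ring

theorem riemann_antisymm_right (g : F2) (y : Coord) (l m a b : Idx) :
    riemann g y l m a b = -riemann g y l m b a := by
  simp only [riemann, riemannUp_antisymm g y _ m a b, mul_neg, Finset.sum_neg_distrib]

theorem LocMetric.riemann_bianchi (hg : LocMetric U g) (hy : y ∈ U) (l m a b : Idx) :
    riemann g y l m a b + riemann g y l a b m + riemann g y l b m a = 0 := by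
  simp only [riemann, ← Finset.sum_add_distrib, ← mul_add, hg.riemannUp_bianchi hy, mul_zero,
    Finset.sum_const_zero]

theorem LocMetric.cov2_metric (hg : LocMetric U g) (hy : y ∈ U) (a b c : Idx) :
    cov2 g g y a b c = 0 := by
  rw [cov2, hg.pd_metric hy, sub_self]

/-- The Ricci identity applied to the metric itself, whose covariant derivatives vanish. -/
theorem LocMetric.riemann_antisymm_left (hg : LocMetric U g) (hy : y ∈ U) (l m a b : Idx) :
    riemann g y l m a b = -riemann g y m l a b := by
  have h := hg.ricci_identity hy hg.smooth l m a b
  have h0 : ∀ i j, cov3 g (cov2 g g) y l m i j = 0 := by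
    intro i j
    rw [cov3_congr (B := fun _ _ _ _ => 0) hg.isOpen hy
      (fun z hz a b c => hg.cov2_metric hz a b c)]
    simp [cov3, pd_const]
  rw [h0, h0, sub_zero, zero_eq_neg, Finset.sum_add_distrib] at h
  have e : ∀ l m, ∑ s, riemannUp g y s l a b * g y s m = riemann g y m l a b := by
    intro l m
    exact Finset.sum_congr rfl fun s _ => by rw [hg.symm y hy s m, mul_comm]
  rw [e] at h
  have e2 : ∑ s, riemannUp g y s m a b * g y l s = riemann g y l m a b :=
    Finset.sum_congr rfl fun s _ => mul_comm _ _
  rw [e2] at h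
  linarith

/-- The classical argument: combine four cyclic identities with both antisymmetries. -/
theorem LocMetric.riemann_pair (hg : LocMetric U g) (hy : y ∈ U) (l m a b : Idx) :
    riemann g y l m a b = riemann g y a b l m := by
  have r := riemann_antisymm_right g y
  have s := hg.riemann_antisymm_left hy
  have c := hg.riemann_bianchi hy
  linarith [c l m a b, c m a b l, c a b l m, c b l m a, r l m a b, s l m a b, s l a b m,
    r l a b m, r l b m a, s l b m a, s m a b l, r m a b l, r m b l a, s m b l a, r m l a b,
    s m l a b, r a b l m, s a b l m, r a l m b, s a l m b, r a m b l, s a m b l, r b l m a,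
    s b l m a, r b m a l, s b m a l, r b a l m, s b a l m, r l a m b, r l m b a, r m a l b]

theorem LocMetric.riemannUp_eq (hg : LocMetric U g) (hy : y ∈ U) (l m a b : Idx) :
    riemannUp g y l m a b = ∑ k, ginv g y l k * riemann g y k m a b := by
  simp only [riemann, Finset.mul_sum]
  rw [Finset.sum_comm]
  simp only [← mul_assoc, ← Finset.sum_mul, hg.ginv_mul hy]
  simp

theorem LocMetric.ricci_eq (hg : LocMetric U g) (hy : y ∈ U) (m n : Idx) :
    ricci g y m n = ∑ k, ∑ l, ginv g y k l * riemann g y l m k n := by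
  simp only [ricci, hg.riemannUp_eq hy]

end Local

/-! ## Pulling tensors back along a linear map -/

/-- The pull-back of a covector; `J α a` is the component `α` of the image of the `a`-th basis
vector. -/
def pull1 (J : Matrix Idx Idx ℝ) (T : Idx → ℝ) (a : Idx) : ℝ := ∑ α, J α a * T α

def pull2 (J : Matrix Idx Idx ℝ) (T : Idx → Idx → ℝ) (a b : Idx) : ℝ :=
  ∑ α, ∑ β, J α a * J β b * T α β

def pull3 (J : Matrix Idx Idx ℝ) (T : Idx → Idx → Idx → ℝ) (a b c : Idx) : ℝ :=
  ∑ α, ∑ β, ∑ γ, J α a * J β b * J γ c * T α β γ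

def pull4 (J : Matrix Idx Idx ℝ) (T : Idx → Idx → Idx → Idx → ℝ) (a b c d : Idx) : ℝ :=
  ∑ α, ∑ β, ∑ γ, ∑ δ, J α a * J β b * J γ c * J δ d * T α β γ δ

section Pull

variable (J : Matrix Idx Idx ℝ)

theorem pull1_add (T S : Idx → ℝ) (a : Idx) :
    pull1 J (fun α => T α + S α) a = pull1 J T a + pull1 J S a := by
  simp only [pull1, mul_add, Finset.sum_add_distrib]

theorem pull1_sub (T S : Idx → ℝ) (a : Idx) :
    pull1 J (fun α => T α - S α) a = pull1 J T a - pull1 J S a := by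
  simp only [pull1, mul_sub, Finset.sum_sub_distrib]

theorem pull1_neg (T : Idx → ℝ) (a : Idx) :
    pull1 J (fun α => -T α) a = -pull1 J T a := by
  simp only [pull1, mul_neg, Finset.sum_neg_distrib]

theorem pull1_mul_left (c : ℝ) (T : Idx → ℝ) (a : Idx) :
    pull1 J (fun α => c * T α) a = c * pull1 J T a := by
  simp only [pull1, Finset.mul_sum]; exact Finset.sum_congr rfl fun _ _ => by ring

theorem pull1_mul_right (c : ℝ) (T : Idx → ℝ) (a : Idx) :
    pull1 J (fun α => T α * c) a = pull1 J T a * c := by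
  simp only [mul_comm _ c, pull1_mul_left]

theorem pull1_sum (T : Idx → Idx → ℝ) (a : Idx) :
    pull1 J (fun α => ∑ k, T k α) a = ∑ k, pull1 J (T k) a := by
  simp only [pull1, Finset.mul_sum]; exact Finset.sum_comm

theorem pull1_comm (T : Idx → Idx → ℝ) (a b : Idx) :
    pull1 J (fun α => pull1 J (fun β => T α β) b) a
      = pull1 J (fun β => pull1 J (fun α => T α β) a) b := by
  simp only [pull1, Finset.mul_sum]
  rw [Finset.sum_comm]
  exact Finset.sum_congr rfl fun _ _ => Finset.sum_congr rfl fun _ _ => by ring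

/-- Pull-backs of higher rank are iterated `pull1`, so linearity of `pull1` and the interchange
`pull1_comm` yield all rules for index permutations and partial contractions. -/
theorem pull2_eq (T : Idx → Idx → ℝ) (a b : Idx) :
    pull2 J T a b = pull1 J (fun α => pull1 J (fun β => T α β) b) a := by
  simp only [pull1, pull2, Finset.mul_sum, mul_assoc]

theorem pull3_eq (T : Idx → Idx → Idx → ℝ) (a b c : Idx) :
    pull3 J T a b c = pull1 J (fun α => pull2 J (fun β γ => T α β γ) b c) a := by
  simp only [pull1, pull2, pull3, Finset.mul_sum, mul_assoc]

theorem pull4_eq (T : Idx → Idx → Idx → Idx → ℝ) (a b c d : Idx) :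
    pull4 J T a b c d = pull1 J (fun α => pull3 J (fun β γ δ => T α β γ δ) b c d) a := by
  simp only [pull1, pull3, pull4, Finset.mul_sum, mul_assoc]

theorem pull2_swap (T : Idx → Idx → ℝ) (a b : Idx) :
    pull2 J (fun α β => T β α) a b = pull2 J T b a := by
  simp only [pull2_eq]; rw [pull1_comm]

theorem pull3_swap₁₂ (T : Idx → Idx → Idx → ℝ) (a b c : Idx) :
    pull3 J (fun α β γ => T β α γ) a b c = pull3 J T b a c := by
  simp only [pull3_eq, pull2_eq]; rw [pull1_comm]

theorem pull3_swap₂₃ (T : Idx → Idx → Idx → ℝ) (a b c : Idx) :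
    pull3 J (fun α β γ => T α γ β) a b c = pull3 J T a c b := by
  simp only [pull3_eq, pull2_swap J (fun β γ => T _ β γ)]

theorem pull3_cyc (T : Idx → Idx → Idx → ℝ) (a b c : Idx) :
    pull3 J (fun α β γ => T γ α β) a b c = pull3 J T c a b := by
  rw [pull3_swap₂₃ J (fun α γ β => T γ α β), pull3_swap₁₂ J (fun γ α β => T γ α β)]

theorem pull3_eq' (T : Idx → Idx → Idx → ℝ) (a b c : Idx) :
    pull3 J T a b c = pull2 J (fun α β => pull1 J (fun γ => T α β γ) c) a b := by
  simp only [pull3_eq, pull2_eq]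

theorem pull3_eq_last (T : Idx → Idx → Idx → ℝ) (a b c : Idx) :
    pull3 J T a b c = pull1 J (fun γ => pull2 J (fun α β => T α β γ) a b) c := by
  simp only [pull3_eq, pull2_eq]
  rw [pull1_comm J (fun γ α => pull1 J (fun β => T α β γ) b)]
  congr 1; funext α
  rw [pull1_comm]

theorem pull4_eq' (T : Idx → Idx → Idx → Idx → ℝ) (a b c d : Idx) :
    pull4 J T a b c d = pull2 J (fun α β => pull2 J (fun γ δ => T α β γ δ) c d) a b := by
  simp only [pull4_eq, pull3_eq, pull2_eq]

end Pull

theorem det4_mul (A : Matrix Idx Idx ℝ) (u v w x : Idx → ℝ) :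
    det4 (fun j => ∑ l, A j l * u l) (fun j => ∑ l, A j l * v l)
      (fun j => ∑ l, A j l * w l) (fun j => ∑ l, A j l * x l)
      = A.det * det4 u v w x := by
  have h := Matrix.det_mul (Matrix.of ![u, v, w, x]) A.transpose
  rw [Matrix.det_transpose, det_eq_det4, det_eq_det4 (Matrix.of ![u, v, w, x]), mul_comm] at h
  refine Eq.trans ?_ h
  congr 1 <;>
  · funext j
    simp [Matrix.mul_apply, mul_comm]

theorem pull4_permSymbol (J : Matrix Idx Idx ℝ) (a b c d : Idx) :
    pull4 J permSymbol a b c d = J.det * permSymbol a b c d := by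
  have h := det4_mul J (Pi.single a 1) (Pi.single b 1) (Pi.single c 1) (Pi.single d 1)
  rw [← permSymbol_eq, det4_sum] at h
  rw [← h]
  simp only [pull4, Pi.single_apply, mul_ite, mul_one, mul_zero, Finset.sum_ite_eq',
    Finset.mem_univ, if_true]
  refine Finset.sum_congr rfl fun _ _ => Finset.sum_congr rfl fun _ _ =>
    Finset.sum_congr rfl fun _ _ => Finset.sum_congr rfl fun _ _ => by ring

/-- `E^{ρσ} T_{ρσ}`. -/
def dcontr (g : F2) (y : Coord) (E T : Idx → Idx → ℝ) : ℝ :=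
  ∑ ρ, ∑ σ, (∑ k, ∑ l, ginv g y ρ k * ginv g y σ l * E k l) * T ρ σ

theorem star2_eq (g A : F2) (y : Coord) (a b : Idx) :
    star2 g A y a b = (1 / 2) * dcontr g y (eps g y a b) (A y) := rfl

theorem contr2_eq (g A B : F2) (y : Coord) : contr2 g A B y = dcontr g y (B y) (A y) := by
  simp only [contr2, raise2, dcontr, mul_comm]

/-- `G` is the pull-back of the non-degenerate metric `G'` along the orientation-preserving
linear map `J`. -/
structure Rel (J : Matrix Idx Idx ℝ) (G G' : Idx → Idx → ℝ) : Prop where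
  metric : ∀ a b, G a b = pull2 J G' a b
  det_pos : 0 < J.det
  symm : ∀ a b, G' a b = G' b a

/-! ### Contractions, duals and traces under an orientation-preserving change of basis -/

section Rel

variable {J : Matrix Idx Idx ℝ} {g g' : F2} {y y' : Coord} (h : Rel J (g y) (g' y'))
include h

theorem Rel.matrix : Matrix.of (g y) = J.transpose * Matrix.of (g' y') * J := by
  ext a b
  rw [Matrix.of_apply, h.metric, pull2, Finset.sum_comm]
  simp only [Matrix.mul_apply, Finset.sum_mul, Matrix.transpose_apply, Matrix.of_apply]
  exact Finset.sum_congr rfl fun _ _ => Finset.sum_congr rfl fun _ _ => by ring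

theorem Rel.vol : Real.sqrt (-(Matrix.of (g y)).det)
    = J.det * Real.sqrt (-(Matrix.of (g' y')).det) := by
  have : -(Matrix.of (g y)).det = J.det ^ 2 * -(Matrix.of (g' y')).det := by
    rw [h.matrix, Matrix.det_mul, Matrix.det_mul, Matrix.det_transpose]; ring
  -- Orientation enters here: the square root of the squared determinant is the determinant itself,
  -- not its absolute value.
  rw [this, Real.sqrt_mul (sq_nonneg _), Real.sqrt_sq h.det_pos.le]

theorem Rel.ginv_matrix : (Matrix.of (g' y'))⁻¹ = J * (Matrix.of (g y))⁻¹ * J.transpose := by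
  have hJ : IsUnit J.det := isUnit_iff_ne_zero.2 h.det_pos.ne'
  have hJt : IsUnit J.transpose.det := by rwa [Matrix.det_transpose]
  rw [h.matrix, Matrix.mul_inv_rev, Matrix.mul_inv_rev, ← Matrix.mul_assoc, ← Matrix.mul_assoc,
    Matrix.mul_nonsing_inv _ hJ, one_mul, Matrix.mul_assoc, Matrix.nonsing_inv_mul _ hJt, mul_one]

theorem Rel.ginv_eq (k l : Idx) :
    ginv g' y' k l = ∑ a, ∑ b, ginv g y a b * J k a * J l b := by
  have := congrFun (congrFun h.ginv_matrix k) l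
  rw [ginv, this]
  simp only [Matrix.mul_apply, Finset.sum_mul, Matrix.transpose_apply]
  rw [Finset.sum_comm]
  exact Finset.sum_congr rfl fun _ _ => Finset.sum_congr rfl fun _ _ => by
    simp only [ginv]; ring

theorem Rel.ginv_contr (u w : Idx → ℝ) : ∑ k, ∑ l, ginv g' y' k l * u k * w l
    = ∑ a, ∑ b, ginv g y a b * pull1 J u a * pull1 J w b := by
  have e : ∀ u w : Idx → ℝ, ∑ k, ∑ l, ginv g' y' k l * u k * w l
      = dotProduct u (Matrix.mulVec (Matrix.of (g' y'))⁻¹ w) := by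
    intro u w
    simp only [dotProduct, Matrix.mulVec, Finset.mul_sum, ginv]
    exact Finset.sum_congr rfl fun _ _ => Finset.sum_congr rfl fun _ _ => by ring
  have e' : ∀ u w : Idx → ℝ, ∑ k, ∑ l, ginv g y k l * u k * w l
      = dotProduct u (Matrix.mulVec (Matrix.of (g y))⁻¹ w) := by
    intro u w
    simp only [dotProduct, Matrix.mulVec, Finset.mul_sum, ginv]
    exact Finset.sum_congr rfl fun _ _ => Finset.sum_congr rfl fun _ _ => by ring
  have p : ∀ u, pull1 J u = Matrix.vecMul u J := by
    intro u; funext a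
    simp only [pull1, Matrix.vecMul, dotProduct]
    exact Finset.sum_congr rfl fun _ _ => mul_comm _ _
  rw [e, e', h.ginv_matrix, p, p, Matrix.mul_assoc, ← Matrix.mulVec_mulVec,
    Matrix.dotProduct_mulVec, ← Matrix.mulVec_mulVec, Matrix.mulVec_transpose]

theorem Rel.pull4_eps (a b c d : Idx) : pull4 J (eps g' y') a b c d = eps g y a b c d := by
  have : pull4 J (eps g' y') a b c d
      = Real.sqrt (-(Matrix.of (g' y')).det) * pull4 J permSymbol a b c d := by
    simp only [pull4, eps, Finset.mul_sum]
    exact Finset.sum_congr rfl fun _ _ => Finset.sum_congr rfl fun _ _ =>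
      Finset.sum_congr rfl fun _ _ => Finset.sum_congr rfl fun _ _ => by ring
  rw [this, pull4_permSymbol, eps, h.vol]; ring

theorem Rel.ginv_symm (k l : Idx) : ginv g' y' k l = ginv g' y' l k := by
  have : (Matrix.of (g' y')).transpose = Matrix.of (g' y') := by
    ext i j; exact h.symm j i
  have h2 := Matrix.transpose_nonsing_inv (Matrix.of (g' y'))
  rw [this] at h2
  exact congrFun (congrFun h2 l) k

/-- `ginv_contr` is applied to one contracted pair of indices at a time. The rearrangements `r` and
`s` move the pair that is to be transformed innermost. -/
theorem Rel.dcontr (T E : Idx → Idx → ℝ) : SpinKY.dcontr g' y' E T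
    = SpinKY.dcontr g y (pull2 J E) (pull2 J T) := by
  have r : ∀ (G : Idx → Idx → ℝ) (E T : Idx → Idx → ℝ),
      ∑ ρ, ∑ σ, (∑ k, ∑ l, G ρ k * G σ l * E k l) * T ρ σ
        = ∑ ρ, ∑ k, G ρ k * ∑ σ, ∑ l, G σ l * T ρ σ * E k l := by
    intro G E T
    refine Finset.sum_congr rfl fun ρ _ => ?_
    simp only [Finset.sum_mul, Finset.mul_sum]
    rw [Finset.sum_comm]
    exact Finset.sum_congr rfl fun _ _ => Finset.sum_congr rfl fun _ _ =>
      Finset.sum_congr rfl fun _ _ => by ring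
  have s : ∀ (G H : Idx → Idx → ℝ) (F : Idx → Idx → Idx → Idx → ℝ),
      ∑ ρ, ∑ k, G ρ k * ∑ c, ∑ d, H c d * F ρ k c d
        = ∑ c, ∑ d, H c d * ∑ ρ, ∑ k, G ρ k * F ρ k c d := by
    intro G H F
    simp only [Finset.mul_sum]
    have : ∀ ρ, ∑ k, ∑ c, ∑ d, G ρ k * (H c d * F ρ k c d)
        = ∑ c, ∑ d, ∑ k, G ρ k * (H c d * F ρ k c d) := by
      intro ρ
      rw [Finset.sum_comm]
      exact Finset.sum_congr rfl fun _ _ => Finset.sum_comm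
    simp only [this]
    rw [Finset.sum_comm]
    refine Finset.sum_congr rfl fun _ _ => ?_
    rw [Finset.sum_comm]
    exact Finset.sum_congr rfl fun _ _ => Finset.sum_congr rfl fun _ _ =>
      Finset.sum_congr rfl fun _ _ => by ring
  unfold SpinKY.dcontr
  rw [r, r]
  simp only [h.ginv_contr]
  simp only [mul_assoc]
  rw [s]
  simp only [← mul_assoc, h.ginv_contr]
  simp only [mul_assoc]
  rw [s]
  simp only [pull2_eq]

theorem Rel.contr2 {A B A' B' : F2} (hA : ∀ a b, A y a b = pull2 J (A' y') a b)
    (hB : ∀ a b, B y a b = pull2 J (B' y') a b) :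
    SpinKY.contr2 g' A' B' y' = SpinKY.contr2 g A B y := by
  rw [contr2_eq, contr2_eq, h.dcontr]
  congr 1 <;> (funext a b; simp only [hA, hB])

/-- The dual is a double contraction with ε. Contractions do not depend on the basis, and the two
free indices of ε pull back by `pull4_eps`. -/
theorem Rel.pull2_star2 {A A' : F2} (hA : ∀ a b, A y a b = pull2 J (A' y') a b) (a b : Idx) :
    pull2 J (star2 g' A' y') a b = star2 g A y a b := by
  have e : pull2 J (A' y') = A y := by funext a b; exact (hA a b).symm
  have e2 : ∀ c d, pull2 J (fun α β => pull2 J (eps g' y' α β) c d) a b = eps g y a b c d := by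
    intro c d; rw [← h.pull4_eps, pull4_eq']
  rw [star2_eq]
  have : pull2 J (star2 g' A' y') a b
      = (1 / 2) * SpinKY.dcontr g y (fun c d => pull2 J (fun α β => pull2 J (eps g' y' α β) c d) a b)
        (A y) := by
    have e3 : ∀ α β, star2 g' A' y' α β
        = (1 / 2) * SpinKY.dcontr g y (fun c d => pull2 J (eps g' y' α β) c d) (A y) := by
      intro α β; rw [star2_eq, h.dcontr, e]
    rw [pull2_eq]
    simp only [e3, SpinKY.dcontr, pull1_mul_left, pull1_sum, pull1_mul_right]
    simp only [pull2_eq]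
  rw [this]
  simp only [e2]

/-- The third index does not take part in the dual, so it may be pulled back beforehand; the case of
2-tensors then applies. -/
theorem Rel.pull3_star3 {A A' : F3} (hA : ∀ a b c, A y a b c = pull3 J (A' y') a b c)
    (a b c : Idx) : pull3 J (star3 g' A' y') a b c = star3 g A y a b c := by
  have := h.pull2_star2 (A := fun z i j => A z i j c)
    (A' := fun z i j => pull1 J (A' z i j) c) (fun a b => by rw [hA, pull3_eq']) a b
  rw [pull3_eq']
  refine Eq.trans ?_ this
  congr 1; funext α β
  simp only [star3, star2, pull1_mul_left, pull1_sum]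

theorem Rel.pull4_star4 {A A' : F4} (hA : ∀ a b c d, A y a b c d = pull4 J (A' y') a b c d)
    (a b c d : Idx) : pull4 J (star4 g' A' y') a b c d = star4 g A y a b c d := by
  have := h.pull2_star2 (A := fun z i j => A z i j c d)
    (A' := fun z i j => pull2 J (A' z i j) c d) (fun a b => by rw [hA, pull4_eq']) a b
  rw [pull4_eq']
  refine Eq.trans ?_ this
  congr 1; funext α β
  simp only [star4, star2, pull2_eq, pull1_mul_left, pull1_sum]

theorem Rel.ginv_trace (T : Idx → Idx → ℝ) : ∑ β, ∑ γ, ginv g' y' β γ * T β γ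
    = ∑ b, ∑ c, ginv g y b c * pull2 J T b c := by
  simp only [h.ginv_eq, pull2, Finset.sum_mul, Finset.mul_sum]
  have : ∀ F : Idx → Idx → Idx → Idx → ℝ, ∑ a, ∑ b, ∑ c, ∑ d, F a b c d
      = ∑ c, ∑ d, ∑ a, ∑ b, F a b c d := by
    intro F
    have e : ∀ a, ∑ b, ∑ c, ∑ d, F a b c d = ∑ c, ∑ d, ∑ b, F a b c d := by
      intro a
      rw [Finset.sum_comm]
      exact Finset.sum_congr rfl fun _ _ => Finset.sum_comm
    simp only [e]
    rw [Finset.sum_comm]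
    exact Finset.sum_congr rfl fun _ _ => Finset.sum_comm
  rw [this]
  exact Finset.sum_congr rfl fun _ _ => Finset.sum_congr rfl fun _ _ =>
    Finset.sum_congr rfl fun _ _ => Finset.sum_congr rfl fun _ _ => by ring

theorem Rel.pull1_traceVec {A A' : F3} (hA : ∀ a b c, A y a b c = pull3 J (A' y') a b c)
    (a : Idx) : pull1 J (traceVec g' A' y') a = traceVec g A y a := by
  have r : ∀ (T : Idx → Idx → Idx → ℝ) (b c : Idx),
      pull1 J (fun α => pull2 J (T α) b c) a = pull2 J (fun β γ => pull1 J (fun α => T α β γ) a) b c := by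
    intro T b c
    have := pull3_eq_last J (fun β γ α => T α β γ) b c a
    rw [pull3_eq'] at this
    exact this.symm
  unfold traceVec
  simp only [h.ginv_trace, pull1_mul_left, pull1_sum, hA, pull3_eq, r]

theorem Rel.pull3_wedge {v v' : F1} (hv : ∀ a, v y a = pull1 J (v' y') a) (a b c : Idx) :
    pull3 J (wedge g' v' y') a b c = wedge g v y a b c := by
  simp only [wedge, pull3_eq, pull2_eq, pull1_sub, pull1_mul_left, pull1_mul_right, hv, h.metric]

theorem Rel.pull2_kySquare {Y Y' : F2} (hY : ∀ a b, Y y a b = pull2 J (Y' y') a b) (a b : Idx) :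
    pull2 J (kySquare g' Y' y') a b = kySquare g Y y a b := by
  have e : ∀ α β, kySquare g' Y' y' α β
      = ∑ k, ∑ l, ginv g y k l * pull1 J (Y' y' α) k * pull1 J (fun l => Y' y' l β) l := by
    intro α β
    rw [← h.ginv_contr]
    exact Finset.sum_congr rfl fun _ _ => Finset.sum_congr rfl fun _ _ => by ring
  rw [pull2_eq]
  simp only [e, pull1_sum, pull1_mul_left, pull1_mul_right]
  refine Finset.sum_congr rfl fun k _ => Finset.sum_congr rfl fun l _ => ?_
  rw [hY, hY, pull2_eq, pull2_eq, pull1_comm J (fun β l => Y' y' l β)]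
  ring

end Rel

/-! ## Killing-Yano tensors in one chart -/

/-- A Killing-Yano tensor on the open set `U`. -/
structure LocKY (U : Set Coord) (g Y : F2) : Prop where
  smooth : ∀ a b, Sm U fun z => Y z a b
  antisymm : ∀ y ∈ U, ∀ a b, Y y a b = -Y y b a
  killing : ∀ y ∈ U, ∀ a b c, cov2 g Y y b c a + cov2 g Y y a c b = 0

/-- The exterior derivative of a 2-form. -/
def extd (A : F2) : F3 := fun y a b c =>
  pd c (fun z => A z a b) y + pd a (fun z => A z b c) y + pd b (fun z => A z c a) y

section Local

variable {U : Set Coord} {g Y : F2} {y : Coord}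

theorem LocKY.cov2_antisymm (hY : LocKY U g Y) (hg : LocMetric U g) (hy : y ∈ U) (a b c : Idx) :
    cov2 g Y y a b c = -cov2 g Y y b a c := by
  have h := pd_congr hg.isOpen hy (fun z hz => hY.antisymm z hz a b) c
  rw [pd_neg] at h
  simp only [cov2]
  rw [h]
  simp only [fun l => hY.antisymm y hy l b, fun l => hY.antisymm y hy a l, Fin.sum_univ_four]
  ring

/-- Antisymmetry in the first pair and, by the Killing-Yano equation, in the first and the
derivative index generate total antisymmetry. -/
theorem LocKY.cov2_cyc (hY : LocKY U g Y) (hg : LocMetric U g) (hy : y ∈ U) (a b c : Idx) :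
    cov2 g Y y a b c = cov2 g Y y b c a := by
  linarith [hY.killing y hy a b c, hY.cov2_antisymm hg hy a b c, hY.killing y hy c b a,
    hY.cov2_antisymm hg hy c b a, hY.cov2_antisymm hg hy a c b, hY.killing y hy b a c,
    hY.cov2_antisymm hg hy c a b]

/-- Total antisymmetry makes ∇Y a third of its cyclic sum, in which the Christoffel symbols cancel.
This shows that ∇Y is a tensor without any transformation law for the connection. -/
theorem LocKY.cov2_eq_extd (hY : LocKY U g Y) (hg : LocMetric U g) (hy : y ∈ U) (a b c : Idx) :
    cov2 g Y y a b c = (1 / 3) * extd Y y a b c := by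
  have h1 := hY.cov2_cyc hg hy a b c
  have h2 := hY.cov2_cyc hg hy b c a
  have : cov2 g Y y a b c + cov2 g Y y b c a + cov2 g Y y c a b = extd Y y a b c := by
    have hs := hg.christoffel_symm hy
    simp only [cov2, extd]
    simp only [fun l => hs l b a, fun l => hs l c a, fun l => hs l c b,
      fun l => hY.antisymm y hy a l, fun l => hY.antisymm y hy b l,
      fun l => hY.antisymm y hy c l, Fin.sum_univ_four]
    ring
  linarith

/-- `∇_γ K_{αβ}` for `K = Y·Y`, in terms of `Y` and `∇Y`. -/
def kyCov (g Y : F2) (dY : F3) : F3 := fun y a b c =>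
  ∑ k, ∑ l, (dY y a k c * ginv g y k l * Y y l b + Y y a k * ginv g y k l * dY y l b c)

theorem LocKY.cov2_eq_kyCov (hY : LocKY U g Y) (hg : LocMetric U g) (hy : y ∈ U) (a b c : Idx) :
    cov2 g (kySquare g Y) y a b c = kyCov g Y (cov2 g Y) y a b c :=
  hg.cov2_kySquare hy hY.smooth a b c

/-- The product rule expresses ∇K algebraically by Y and ∇Y, so its covariance follows from theirs
and from the invariance of contractions. -/
theorem Rel.pull3_kyCov {J : Matrix Idx Idx ℝ} {g g' : F2} {y y' : Coord}
    (h : Rel J (g y) (g' y')) {Y Y' : F2} {dY dY' : F3}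
    (hY : ∀ a b, Y y a b = pull2 J (Y' y') a b)
    (hdY : ∀ a b c, dY y a b c = pull3 J (dY' y') a b c) (a b c : Idx) :
    pull3 J (kyCov g' Y' dY' y') a b c = kyCov g Y dY y a b c := by
  have e : ∀ α β γ, kyCov g' Y' dY' y' α β γ
      = ∑ k, ∑ l, ginv g y k l * pull1 J (fun k => dY' y' α k γ) k * pull1 J (fun l => Y' y' l β) l
        + ∑ k, ∑ l, ginv g y k l * pull1 J (fun k => Y' y' α k) k
          * pull1 J (fun l => dY' y' l β γ) l := by
    intro α β γ
    rw [← h.ginv_contr, ← h.ginv_contr]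
    simp only [← Finset.sum_add_distrib]
    exact Finset.sum_congr rfl fun _ _ => Finset.sum_congr rfl fun _ _ => by ring
  have e1 : ∀ a k c, pull1 J (fun α => pull1 J (fun γ => pull1 J (fun k => dY' y' α k γ) k) c) a
      = dY y a k c := by
    intro a k c
    simp only [hdY, pull3_eq, pull2_eq]
    congr 1; funext α; rw [pull1_comm]
  have e2 : ∀ l b, pull1 J (fun β => pull1 J (fun l => Y' y' l β) l) b = Y y l b := by
    intro l b; rw [hY, pull2_eq, pull1_comm]
  have e3 : ∀ a k, pull1 J (fun α => pull1 J (fun k => Y' y' α k) k) a = Y y a k := by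
    intro l b; rw [hY, pull2_eq]
  have e4 : ∀ l b c, pull1 J (fun β => pull1 J (fun γ => pull1 J (fun l => dY' y' l β γ) l) c) b
      = dY y l b c := by
    intro l b c
    simp only [hdY, pull3_eq, pull2_eq]
    rw [pull1_comm J (fun l β => pull1 J (fun γ => dY' y' l β γ) c)]
    congr 1; funext β; rw [pull1_comm]
  simp only [pull3_eq, pull2_eq]
  simp only [e, pull1_add, pull1_sum, pull1_mul_left, pull1_mul_right, e1, e2, e3, e4]
  simp only [kyCov, Finset.sum_add_distrib]
  congr 1 <;>
  exact Finset.sum_congr rfl fun _ _ => Finset.sum_congr rfl fun _ _ => by ring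

end Local

/-! ## Changes of charts -/

section Manifold

variable {M : Type*} [TopologicalSpace M] [ChartedSpace Coord M]

/-- The transition map. -/
def trans (e e' : Chart M) (y : Coord) : Coord := e' (e.symm y)

/-- Its domain. -/
def overlap (e e' : Chart M) : Set Coord := (e.symm.trans e').source

omit [ChartedSpace Coord M] in
theorem isOpen_overlap (e e' : Chart M) : IsOpen (overlap e e') := (e.symm.trans e').open_source

omit [ChartedSpace Coord M] in
theorem mem_overlap {e e' : Chart M} {x : M} (hx : x ∈ e.source ∩ e'.source) :
    e x ∈ overlap e e' := by
  simp [overlap, hx.1, hx.2]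

omit [ChartedSpace Coord M] in
theorem of_mem_overlap {e e' : Chart M} {y : Coord} (hy : y ∈ overlap e e') :
    y ∈ e.target ∧ e.symm y ∈ e.source ∩ e'.source ∧ e (e.symm y) = y := by
  simp only [overlap, OpenPartialHomeomorph.trans_source, OpenPartialHomeomorph.symm_source,
    Set.mem_inter_iff, Set.mem_preimage] at hy
  exact ⟨hy.1, ⟨e.map_target hy.1, hy.2⟩, e.right_inv hy.1⟩

theorem smooth_trans [IsManifold 𝓘(ℝ, Coord) ∞ M] {e e' : Chart M} (he : e ∈ atlas Coord M)
    (he' : e' ∈ atlas Coord M) : ContDiffOn ℝ ∞ (trans e e') (overlap e e') := by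
  have h : e.symm.trans e' ∈ contDiffGroupoid ∞ 𝓘(ℝ, Coord) := HasGroupoid.compatible he he'
  rw [contDiffGroupoid, mem_groupoid_of_pregroupoid] at h
  have h1 := h.1
  simp only [contDiffPregroupoid, modelWithCornersSelf_coe, modelWithCornersSelf_coe_symm,
    Set.preimage_id, Set.range_id, Set.inter_univ, Function.id_comp, Function.comp_id] at h1
  exact h1

theorem smooth_trans_apply [IsManifold 𝓘(ℝ, Coord) ∞ M] {e e' : Chart M}
    (he : e ∈ atlas Coord M) (he' : e' ∈ atlas Coord M) (a : Idx) :
    Sm (overlap e e') fun z => trans e e' z a :=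
  contDiffOn_pi.1 (smooth_trans he he') a

theorem jac_eq_pd [IsManifold 𝓘(ℝ, Coord) ∞ M] {e e' : Chart M}
    (he : e ∈ atlas Coord M) (he' : e' ∈ atlas Coord M) {y : Coord} (hy : y ∈ overlap e e')
    (a b : Idx) : jac e e' (e.symm y) a b = pd b (fun z => trans e e' z a) y := by
  have hd : DifferentiableAt ℝ (trans e e') y :=
    ((smooth_trans he he').contDiffAt ((isOpen_overlap e e').mem_nhds hy)).differentiableAt
      (by simp)
  rw [jac, (of_mem_overlap hy).2.2, pd]
  have : fderiv ℝ (fun z => trans e e' z a) y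
      = (ContinuousLinearMap.proj a).comp (fderiv ℝ (trans e e') y) :=
    ((ContinuousLinearMap.proj (R := ℝ) (φ := fun _ : Idx => ℝ) a).hasFDerivAt.comp y
      hd.hasFDerivAt).fderiv
  rw [this]; rfl

theorem pd_comp_trans [IsManifold 𝓘(ℝ, Coord) ∞ M] {e e' : Chart M}
    (he : e ∈ atlas Coord M) (he' : e' ∈ atlas Coord M) {y : Coord} (hy : y ∈ overlap e e')
    {f : Coord → ℝ} (hf : Sm e'.target f) (b : Idx) :
    pd b (fun z => f (trans e e' z)) y
      = pull1 (Matrix.of (jac e e' (e.symm y))) (fun a => pd a f (trans e e' y)) b := by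
  have hd : DifferentiableAt ℝ (trans e e') y :=
    ((smooth_trans he he').contDiffAt ((isOpen_overlap e e').mem_nhds hy)).differentiableAt
      (by simp)
  have hm : trans e e' y ∈ e'.target := e'.map_source (of_mem_overlap hy).2.1.2
  have hfd := hf.diff e'.open_target hm
  have : fderiv ℝ (fun z => f (trans e e' z)) y
      = (fderiv ℝ f (trans e e' y)).comp (fderiv ℝ (trans e e') y) :=
    (hfd.hasFDerivAt.comp y hd.hasFDerivAt).fderiv
  rw [pd, this, ContinuousLinearMap.comp_apply, fderiv_eq_sum_pd, pull1]
  refine Finset.sum_congr rfl fun a _ => ?_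
  rw [Matrix.of_apply, jac, (of_mem_overlap hy).2.2]; rfl

end Manifold

/-! ## Tensor fields on the manifold -/

section Manifold

variable {M : Type*} [TopologicalSpace M] [ChartedSpace Coord M]

theorem IsLorentzMetric.loc {g : Chart M → F2} (hg : IsLorentzMetric g) {e : Chart M}
    (he : e ∈ atlas Coord M) : LocMetric e.target (g e) :=
  ⟨e.open_target, hg.tensor.smooth e he, hg.symm e he, hg.signature e he⟩

theorem IsKillingYano.loc {g Y : Chart M → F2} (hY : IsKillingYano g Y) {e : Chart M}
    (he : e ∈ atlas Coord M) : LocKY e.target (g e) (Y e) :=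
  ⟨hY.tensor.smooth e he, hY.antisymm e he, hY.killing e he⟩

/-- The Jacobian matrix of a change of charts. -/
def jacMat (e e' : Chart M) (x : M) : Matrix Idx Idx ℝ := Matrix.of (jac e e' x)

theorem IsLorentzMetric.rel {g : Chart M → F2} (hg : IsLorentzMetric g) (hor : IsOriented M)
    {e e' : Chart M} (he : e ∈ atlas Coord M) (he' : e' ∈ atlas Coord M) {x : M}
    (hx : x ∈ e.source ∩ e'.source) : Rel (jacMat e e' x) (g e (e x)) (g e' (e' x)) :=
  ⟨hg.tensor.transform e he e' he' x hx, hor e he e' he' x hx,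
    hg.symm e' he' _ (e'.map_source hx.2)⟩

theorem IsTensor1.pull {T : Chart M → F1} (hT : IsTensor1 T) {e e' : Chart M}
    (he : e ∈ atlas Coord M) (he' : e' ∈ atlas Coord M) {x : M}
    (hx : x ∈ e.source ∩ e'.source) (a : Idx) :
    T e (e x) a = pull1 (jacMat e e' x) (T e' (e' x)) a := hT.transform e he e' he' x hx a

theorem IsTensor2.pull {T : Chart M → F2} (hT : IsTensor2 T) {e e' : Chart M}
    (he : e ∈ atlas Coord M) (he' : e' ∈ atlas Coord M) {x : M}
    (hx : x ∈ e.source ∩ e'.source) (a b : Idx) :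
    T e (e x) a b = pull2 (jacMat e e' x) (T e' (e' x)) a b := hT.transform e he e' he' x hx a b

theorem IsTensor3.pull {T : Chart M → F3} (hT : IsTensor3 T) {e e' : Chart M}
    (he : e ∈ atlas Coord M) (he' : e' ∈ atlas Coord M) {x : M}
    (hx : x ∈ e.source ∩ e'.source) (a b c : Idx) :
    T e (e x) a b c = pull3 (jacMat e e' x) (T e' (e' x)) a b c :=
  hT.transform e he e' he' x hx a b c

theorem IsTensor1.congr {T S : Chart M → F1} (hT : IsTensor1 T)
    (h : ∀ e ∈ atlas Coord M, ∀ y ∈ e.target, ∀ a, S e y a = T e y a) : IsTensor1 S where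
  smooth e he a := Sm.congr (hT.smooth e he a) fun y hy => h e he y hy a
  transform e he e' he' x hx a := by
    rw [h e he _ (e.map_source hx.1), hT.transform e he e' he' x hx]
    simp only [h e' he' _ (e'.map_source hx.2)]

theorem IsTensor3.congr {T S : Chart M → F3} (hT : IsTensor3 T)
    (h : ∀ e ∈ atlas Coord M, ∀ y ∈ e.target, ∀ a b c, S e y a b c = T e y a b c) :
    IsTensor3 S where
  smooth e he a b c := Sm.congr (hT.smooth e he a b c) fun y hy => h e he y hy a b c
  transform e he e' he' x hx a b c := by
    rw [h e he _ (e.map_source hx.1), hT.transform e he e' he' x hx]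
    simp only [h e' he' _ (e'.map_source hx.2)]

theorem IsTensor1.add {T S : Chart M → F1} (hT : IsTensor1 T) (hS : IsTensor1 S) :
    IsTensor1 fun e y a => T e y a + S e y a where
  smooth e he a := Sm.add (hT.smooth e he a) (hS.smooth e he a)
  transform e he e' he' x hx a := by
    rw [hT.transform e he e' he' x hx, hS.transform e he e' he' x hx]
    exact (pull1_add _ _ _ _).symm

theorem IsTensor1.cmul (r : ℝ) {T : Chart M → F1} (hT : IsTensor1 T) :
    IsTensor1 fun e y a => r * T e y a where
  smooth e he a := Sm.cmul r (hT.smooth e he a)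
  transform e he e' he' x hx a := by
    rw [hT.transform e he e' he' x hx]
    exact (pull1_mul_left _ _ _ _).symm

theorem IsTensor1.zero : IsTensor1 (0 : Chart M → F1) where
  smooth _ _ _ := Sm.const 0
  transform _ _ _ _ _ _ _ := by simp

theorem pull3_add (J : Matrix Idx Idx ℝ) (T S : Idx → Idx → Idx → ℝ) (a b c : Idx) :
    pull3 J (fun α β γ => T α β γ + S α β γ) a b c = pull3 J T a b c + pull3 J S a b c := by
  simp only [pull3_eq, pull2_eq, pull1_add]

theorem pull3_cmul (J : Matrix Idx Idx ℝ) (r : ℝ) (T : Idx → Idx → Idx → ℝ) (a b c : Idx) :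
    pull3 J (fun α β γ => r * T α β γ) a b c = r * pull3 J T a b c := by
  simp only [pull3_eq, pull2_eq, pull1_mul_left]

theorem IsTensor3.add {T S : Chart M → F3} (hT : IsTensor3 T) (hS : IsTensor3 S) :
    IsTensor3 fun e y a b c => T e y a b c + S e y a b c where
  smooth e he a b c := Sm.add (hT.smooth e he a b c) (hS.smooth e he a b c)
  transform e he e' he' x hx a b c := by
    rw [hT.transform e he e' he' x hx, hS.transform e he e' he' x hx]
    exact (pull3_add _ _ _ _ _ _).symm

theorem IsTensor3.cmul (r : ℝ) {T : Chart M → F3} (hT : IsTensor3 T) :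
    IsTensor3 fun e y a b c => r * T e y a b c where
  smooth e he a b c := Sm.cmul r (hT.smooth e he a b c)
  transform e he e' he' x hx a b c := by
    rw [hT.transform e he e' he' x hx]
    exact (pull3_cmul _ _ _ _ _ _).symm

theorem IsTensor3.sub {T S : Chart M → F3} (hT : IsTensor3 T) (hS : IsTensor3 S) :
    IsTensor3 fun e y a b c => T e y a b c - S e y a b c :=
  (hT.add (hS.cmul (-1))).congr fun _ _ _ _ _ _ _ => by ring

theorem IsTensor3.zero : IsTensor3 (0 : Chart M → F3) where
  smooth _ _ _ _ _ := Sm.const 0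
  transform _ _ _ _ _ _ _ _ _ := by simp

theorem IsTensor3.swap₁₂ {T : Chart M → F3} (hT : IsTensor3 T) :
    IsTensor3 fun e y a b c => T e y b a c where
  smooth e he a b c := hT.smooth e he b a c
  transform e he e' he' x hx a b c := by
    rw [hT.transform e he e' he' x hx]
    exact (pull3_swap₁₂ _ _ _ _ _).symm

theorem IsTensor3.swap₂₃ {T : Chart M → F3} (hT : IsTensor3 T) :
    IsTensor3 fun e y a b c => T e y a c b where
  smooth e he a b c := hT.smooth e he a c b
  transform e he e' he' x hx a b c := by
    rw [hT.transform e he e' he' x hx]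
    exact (pull3_swap₂₃ _ _ _ _ _).symm

theorem IsTensor3.cyc {T : Chart M → F3} (hT : IsTensor3 T) :
    IsTensor3 fun e y a b c => T e y c a b := (hT.swap₁₂.swap₂₃)

theorem IsTensor3.symLast {T : Chart M → F3} (hT : IsTensor3 T) :
    IsTensor3 fun e => SpinKY.symLast (T e) :=
  (hT.add hT.swap₂₃).cmul (1 / 2)

theorem IsTensor3.alt3 {T : Chart M → F3} (hT : IsTensor3 T) :
    IsTensor3 fun e y => SpinKY.alt3 (T e y) :=
  (((((hT.add hT.cyc.cyc).add hT.cyc).sub hT.swap₂₃).sub hT.swap₁₂).sub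
    hT.cyc.swap₁₂).cmul (1 / 6) |>.congr fun _ _ _ _ _ _ _ => by
      simp only [SpinKY.alt3]

theorem IsTensor3.star3 {g : Chart M → F2} (hg : IsLorentzMetric g) (hor : IsOriented M)
    {T : Chart M → F3} (hT : IsTensor3 T) : IsTensor3 fun e => star3 (g e) (T e) where
  smooth e he := (hg.loc he).smooth_star3 (hT.smooth e he)
  transform e he e' he' x hx a b c :=
    ((hg.rel hor he he' hx).pull3_star3 (hT.pull he he' hx) a b c).symm

theorem IsTensor1.wedge {g : Chart M → F2} (hg : IsLorentzMetric g) (hor : IsOriented M)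
    {v : Chart M → F1} (hv : IsTensor1 v) : IsTensor3 fun e => wedge (g e) (v e) where
  smooth e he a b c := ((hv.smooth e he a).mul (hg.tensor.smooth e he b c)).sub
    ((hv.smooth e he b).mul (hg.tensor.smooth e he a c))
  transform e he e' he' x hx a b c :=
    ((hg.rel hor he he' hx).pull3_wedge (hv.pull he he' hx) a b c).symm

theorem IsTensor3.traceVec {g : Chart M → F2} (hg : IsLorentzMetric g) (hor : IsOriented M)
    {T : Chart M → F3} (hT : IsTensor3 T) : IsTensor1 fun e => traceVec (g e) (T e) where
  smooth e he a := Sm.cmul _ <| Sm.sum fun _ => Sm.sum fun _ =>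
    ((hg.loc he).smooth_ginv _ _).mul (hT.smooth e he _ _ _)
  transform e he e' he' x hx a :=
    ((hg.rel hor he he' hx).pull1_traceVec (hT.pull he he' hx) a).symm

theorem IsTensor2.kySquare {g : Chart M → F2} (hg : IsLorentzMetric g) (hor : IsOriented M)
    {Y : Chart M → F2} (hY : IsTensor2 Y) : IsTensor2 fun e => kySquare (g e) (Y e) where
  smooth e he := (hg.loc he).smooth_kySquare (hY.smooth e he)
  transform e he e' he' x hx a b :=
    ((hg.rel hor he he' hx).pull2_kySquare (hY.pull he he' hx) a b).symm

variable [IsManifold 𝓘(ℝ, Coord) ∞ M]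

theorem IsTensor1.grad {f : Chart M → Coord → ℝ}
    (hs : ∀ e ∈ atlas Coord M, Sm e.target (f e))
    (hf : ∀ e ∈ atlas Coord M, ∀ e' ∈ atlas Coord M, ∀ x ∈ e.source ∩ e'.source,
      f e (e x) = f e' (e' x)) : IsTensor1 fun e => SpinKY.grad (f e) where
  smooth e he a := (hs e he).pd e.open_target a
  transform e he e' he' x hx a := by
    have hy := mem_overlap hx
    have h1 : pd a (f e) (e x) = pd a (fun z => f e' (trans e e' z)) (e x) := by
      refine pd_congr (isOpen_overlap e e') hy (fun z hz => ?_) a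
      obtain ⟨_, h2, h3⟩ := of_mem_overlap hz
      have := hf e he e' he' _ h2
      rwa [h3] at this
    have h4 := pd_comp_trans he he' hy (hs e' he') a
    rw [e.left_inv hx.1] at h4
    simp only [SpinKY.grad]
    rw [h1, h4, pull1, trans, e.left_inv hx.1]
    rfl

/-- The inhomogeneous terms in the derivative of the components contain second derivatives of the
transition map. These are symmetric, so they cancel in the cyclic sum of an antisymmetric tensor. -/
theorem IsTensor2.extd {A : Chart M → F2} (hA : IsTensor2 A)
    (ha : ∀ e ∈ atlas Coord M, ∀ y ∈ e.target, ∀ a b, A e y a b = -A e y b a) :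
    IsTensor3 fun e => SpinKY.extd (A e) where
  smooth e he a b c :=
    ((Sm.pd e.open_target (hA.smooth e he a b) c).add
      (Sm.pd e.open_target (hA.smooth e he b c) a)).add
      (Sm.pd e.open_target (hA.smooth e he c a) b)
  transform e he e' he' x hx a b c := by
    have hO := isOpen_overlap e e'
    have hy := mem_overlap hx
    have hm : e' x ∈ e'.target := e'.map_source hx.2
    have hφ : trans e e' (e x) = e' x := by rw [trans, e.left_inv hx.1]
    have hj : ∀ m a, jac e e' x m a = pd a (fun z => trans e e' z m) (e x) := by
      intro m a
      have := jac_eq_pd he he' hy m a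
      rwa [e.left_inv hx.1] at this
    have st := smooth_trans_apply he he'
    have hmaps : Set.MapsTo (trans e e') (overlap e e') e'.target := fun z hz =>
      e'.map_source (of_mem_overlap hz).2.1.2
    have sA : ∀ m n, Sm (overlap e e') fun z => A e' (trans e e' z) m n := fun m n =>
      ContDiffOn.comp (hA.smooth e' he' m n) (smooth_trans he he') hmaps
    -- `B` collects the inhomogeneous terms. It is symmetric in its first two arguments because
    -- partial derivatives commute.
    set B : Idx → Idx → Idx → ℝ := fun c a b => ∑ m, ∑ n,
      pd c (fun z => pd a (fun z => trans e e' z m) z) (e x) * jac e e' x n b * A e' (e' x) m n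
    set P : Idx → Idx → Idx → ℝ := fun m n k => pd k (fun z => A e' z m n) (e' x)
    have key : ∀ a b c, pd c (fun z => A e z a b) (e x)
        = B c a b - B c b a + pull3 (jacMat e e' x) P a b c := by
      intro a b c
      have h1 : ∀ z ∈ overlap e e', A e z a b = ∑ m, ∑ n,
          pd a (fun z => trans e e' z m) z * pd b (fun z => trans e e' z n) z
            * A e' (trans e e' z) m n := by
        intro z hz
        obtain ⟨_, h2, h3⟩ := of_mem_overlap hz
        have := hA.transform e he e' he' _ h2 a b
        rw [h3] at this
        rw [this]
        simp only [jac_eq_pd he he' hz]; rfl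
      have d1 : ∀ m a, DifferentiableAt ℝ (fun z => pd a (fun z => trans e e' z m) z) (e x) :=
        fun m a => ((st m).pd hO a).diff hO hy
      have d2 : ∀ m n, DifferentiableAt ℝ (fun z => A e' (trans e e' z) m n) (e x) :=
        fun m n => (sA m n).diff hO hy
      have d3 : ∀ m n, DifferentiableAt ℝ (fun z => pd a (fun z => trans e e' z m) z
          * pd b (fun z => trans e e' z n) z * A e' (trans e e' z) m n) (e x) :=
        fun m n => ((d1 m a).fun_mul (d1 n b)).fun_mul (d2 m n)
      rw [pd_congr hO hy h1, pd_sum (fun k => DifferentiableAt.fun_sum fun n _ => d3 k n)]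
      have h2 : ∀ m, pd c (fun z => ∑ n, pd a (fun z => trans e e' z m) z
            * pd b (fun z => trans e e' z n) z * A e' (trans e e' z) m n) (e x)
          = ∑ n, (pd c (fun z => pd a (fun z => trans e e' z m) z) (e x) * jac e e' x n b
              * A e' (e' x) m n
            + pd c (fun z => pd b (fun z => trans e e' z n) z) (e x) * jac e e' x m a
              * A e' (e' x) m n
            + jac e e' x m a * jac e e' x n b * ∑ k, jac e e' x k c * P m n k) := by
        intro m
        rw [pd_sum (fun k => d3 m k)]
        refine Finset.sum_congr rfl fun n _ => ?_
        rw [pd_mul ((d1 m a).fun_mul (d1 n b)) (d2 m n), pd_mul (d1 m a) (d1 n b),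
          pd_comp_trans he he' hy (hA.smooth e' he' m n), e.left_inv hx.1, hφ, hj, hj]
        simp only [pull1, P, Matrix.of_apply]
        ring
      simp only [h2, Finset.sum_add_distrib]
      -- Renaming the summation indices and using the antisymmetry of `A` brings the second
      -- inhomogeneous term to the form of the first, with a sign.
      have h3 : ∑ m, ∑ n, pd c (fun z => pd b (fun z => trans e e' z n) z) (e x)
          * jac e e' x m a * A e' (e' x) m n = -B c b a := by
        rw [Finset.sum_comm]
        simp only [B, ← Finset.sum_neg_distrib]
        refine Finset.sum_congr rfl fun m _ => Finset.sum_congr rfl fun n _ => ?_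
        rw [ha e' he' _ hm n m]; ring
      have h4 : ∑ m, ∑ n, jac e e' x m a * jac e e' x n b * ∑ k, jac e e' x k c * P m n k
          = pull3 (jacMat e e' x) P a b c := by
        simp only [pull3, Finset.mul_sum, jacMat, Matrix.of_apply, mul_assoc]
      rw [h3, h4, ← sub_eq_add_neg]
    have hB : ∀ a b c, B a b c = B b a c := by
      intro a b c
      simp only [B, fun m => pd_comm hO hy (st m) a b]
    have e1 : (fun e y => SpinKY.extd (A e) y) e' (e' x)
        = fun m n k => P m n k + P n k m + P k m n := rfl
    have e2 := pull3_add (jacMat e e' x) (fun m n k => P m n k + P n k m) (fun m n k => P k m n) a b c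
    have e3 := pull3_add (jacMat e e' x) P (fun m n k => P n k m) a b c
    have e4 := pull3_cyc (jacMat e e' x) P a b c
    have e5 := pull3_cyc (jacMat e e' x) (fun m n k => P k m n) a b c
    have e6 := pull3_cyc (jacMat e e' x) P c a b
    change SpinKY.extd (A e) (e x) a b c = pull3 (jacMat e e' x) (SpinKY.extd (A e') (e' x)) a b c
    have e7 : SpinKY.extd (A e') (e' x) = fun m n k => P m n k + P n k m + P k m n := rfl
    rw [e7, e2, e3, e4, e5, e6]
    simp only [SpinKY.extd, key]
    linarith [hB c a b, hB c b a, hB a b c]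

variable {g Y : Chart M → F2}

theorem IsKillingYano.cov2_tensor (hY : IsKillingYano g Y) (hg : IsLorentzMetric g) :
    IsTensor3 fun e => cov2 (g e) (Y e) :=
  ((hY.tensor.extd hY.antisymm).cmul (1 / 3)).congr fun _ he _ hy _ _ _ =>
    (hY.loc he).cov2_eq_extd (hg.loc he) hy _ _ _

/-- Covariance of ∇K is obtained through `kyCov`, from that of Y and ∇Y. -/
theorem IsKillingYano.lamT_tensor (hY : IsKillingYano g Y) (hg : IsLorentzMetric g)
    (hor : IsOriented M) : IsTensor3 fun e => lamT (g e) (kySquare (g e) (Y e)) := by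
  have hK : IsTensor3 fun e => cov2 (g e) (kySquare (g e) (Y e)) :=
    { smooth := fun e he a b c => (hg.loc he).smooth_cov2
        ((hg.loc he).smooth_kySquare (hY.loc he).smooth) a b c
      transform := fun e he e' he' x hx a b c => by
        rw [(hY.loc he).cov2_eq_kyCov (hg.loc he) (e.map_source hx.1)]
        rw [← (hg.rel hor he he' hx).pull3_kyCov (hY.tensor.pull he he' hx)
          ((hY.cov2_tensor hg).pull he he' hx)]
        simp only [(hY.loc he').cov2_eq_kyCov (hg.loc he') (e'.map_source hx.2)]
        rfl }
  exact (hK.cyc.cyc.sub hK.swap₂₃).congr fun _ _ _ _ _ _ _ => rfl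

theorem IsTensor2.grad_kyScalar (hY : IsTensor2 Y) (hg : IsLorentzMetric g) (hor : IsOriented M) :
    IsTensor1 fun e => SpinKY.grad (kyScalar (g e) (Y e)) := by
  refine IsTensor1.grad (fun e he => (hg.loc he).smooth_kyScalar (hY.smooth e he)) ?_
  intro e he e' he' x hx
  have h := hg.rel hor he he' hx
  simp only [kyScalar_eq]
  rw [h.contr2 (fun a b => (h.pull2_star2 (hY.pull he he' hx) a b).symm) (hY.pull he he' hx)]

theorem IsTensor2.grad_trK {K : Chart M → F2} (hK : IsTensor2 K) (hg : IsLorentzMetric g)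
    (hor : IsOriented M) : IsTensor1 fun e => SpinKY.grad (trK (g e) (K e)) := by
  refine IsTensor1.grad (fun e he => Sm.sum fun a => Sm.sum fun b =>
    ((hg.loc he).smooth_ginv a b).mul (hK.smooth e he a b)) ?_
  intro e he e' he' x hx
  simp only [trK]
  rw [(hg.rel hor he he' hx).ginv_trace]
  simp only [hK.pull he he' hx]

end Manifold

/-! ## Orthonormal frames -/

/-- The diagonal entries of the Minkowski metric. -/
def sgn : Idx → ℝ := ![-1, 1, 1, 1]

/-- The Minkowski metric. -/
def mink : F2 := fun _ a b => if a = b then sgn a else 0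

theorem sgn_mul_self (a : Idx) : sgn a * sgn a = 1 := by fin_cases a <;> simp [sgn]

theorem mink_matrix (y : Coord) : Matrix.of (mink y) = Matrix.diagonal sgn := by
  ext a b; simp [mink, Matrix.diagonal_apply]

theorem ginv_mink (y : Coord) (a b : Idx) : ginv mink y a b = if a = b then sgn a else 0 := by
  have : (Matrix.of (mink y))⁻¹ = Matrix.diagonal sgn := by
    apply Matrix.inv_eq_right_inv
    rw [mink_matrix, Matrix.diagonal_mul_diagonal, ← Matrix.diagonal_one]
    congr 1; funext a; exact sgn_mul_self a
  rw [ginv, this, Matrix.diagonal_apply]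

theorem det_mink (y : Coord) : (Matrix.of (mink y)).det = -1 := by
  rw [mink_matrix, Matrix.det_diagonal]; simp [Fin.prod_univ_four, sgn]

theorem eps_mink (y : Coord) (a b c d : Idx) : eps mink y a b c d = permSymbol a b c d := by
  simp [eps, det_mink]

theorem sum_ginv_mink (y : Coord) (F : Idx → Idx → ℝ) :
    ∑ a, ∑ b, ginv mink y a b * F a b = ∑ a, sgn a * F a a := by
  simp [ginv_mink]

/-- The Hodge dual of 2-tensors in an orthonormal frame. -/
def etaStar (T : Idx → Idx → ℝ) (a b : Idx) : ℝ :=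
  (1 / 2) * ![![0, T 2 3 - T 3 2, T 3 1 - T 1 3, T 1 2 - T 2 1],
    ![T 3 2 - T 2 3, 0, T 3 0 - T 0 3, T 0 2 - T 2 0],
    ![T 1 3 - T 3 1, T 0 3 - T 3 0, 0, T 1 0 - T 0 1],
    ![T 2 1 - T 1 2, T 2 0 - T 0 2, T 0 1 - T 1 0, 0]] a b

theorem star2_mink (T : F2) (y : Coord) (a b : Idx) :
    star2 mink T y a b = etaStar (T y) a b := by
  have : star2 mink T y a b = (1 / 2) * ∑ r, ∑ s, sgn r * sgn s * permSymbol a b r s * T y r s := by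
    rw [star2_eq, dcontr]
    simp only [ginv_mink, eps_mink, ite_mul, mul_ite, zero_mul, mul_zero, Finset.sum_ite_eq,
      Finset.mem_univ, if_true]
  rw [this, etaStar]
  congr 1
  fin_cases a <;> fin_cases b <;>
    simp [Fin.sum_univ_four, permSymbol_eq, det4, Pi.single_apply, sgn] <;> ring

theorem star3_mink (T : F3) (y : Coord) (a b c : Idx) :
    star3 mink T y a b c = etaStar (fun i j => T y i j c) a b :=
  star2_mink (fun z i j => T z i j c) y a b

theorem star4_mink (T : F4) (y : Coord) (a b c d : Idx) :
    star4 mink T y a b c d = etaStar (fun i j => T y i j c d) a b :=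
  star2_mink (fun z i j => T z i j c d) y a b

theorem traceVec_mink (T : F3) (y : Coord) (a : Idx) :
    traceVec mink T y a = (1 / 3) * ∑ b, sgn b * T y a b b := by
  rw [traceVec, sum_ginv_mink]

/-- `A` maps the standard basis to a positively oriented orthonormal frame of `G`. -/
structure IsFrame (G : Idx → Idx → ℝ) (A : Matrix Idx Idx ℝ) : Prop where
  ortho : A.transpose * Matrix.of G * A = Matrix.diagonal sgn
  det_pos : 0 < A.det

theorem LocMetric.exists_frame {U : Set Coord} {g : F2} {y : Coord} (hg : LocMetric U g)
    (hy : y ∈ U) : ∃ A, IsFrame (g y) A := by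
  obtain ⟨A, hA⟩ := hg.signature y hy
  have hA' : A.transpose * Matrix.of (g y) * A = Matrix.diagonal sgn := hA
  have hd : A.det ≠ 0 := by
    intro h0
    have h := congrArg Matrix.det hA'
    rw [Matrix.det_mul, h0, Matrix.det_diagonal] at h
    simp [Fin.prod_univ_four, sgn] at h
  rcases lt_or_gt_of_ne hd with h | h
  -- Reflecting one spatial axis reverses a negative orientation and keeps the frame orthonormal.
  · refine ⟨A * Matrix.diagonal ![1, -1, 1, 1], ?_, ?_⟩
    · have e : ∀ D G : Matrix Idx Idx ℝ, (A * D).transpose * G * (A * D)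
          = D.transpose * (A.transpose * G * A) * D := by
        intro D G; rw [Matrix.transpose_mul]; simp only [Matrix.mul_assoc]
      rw [e, hA', Matrix.diagonal_transpose, Matrix.diagonal_mul_diagonal,
        Matrix.diagonal_mul_diagonal]
      congr 1; funext a; fin_cases a <;> simp [sgn]
    · rw [Matrix.det_mul, Matrix.det_diagonal]
      simp [Fin.prod_univ_four]; exact h
  · exact ⟨A, hA', h⟩

section Frame

variable {U : Set Coord} {g : F2} {y : Coord} {A : Matrix Idx Idx ℝ}

theorem IsFrame.rel (hA : IsFrame (g y) A) (hg : LocMetric U g) (hy : y ∈ U) :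
    Rel A (mink 0) (g y) where
  metric a b := by
    have h : pull2 A (g y) a b = (A.transpose * Matrix.of (g y) * A) a b := by
      rw [pull2, Finset.sum_comm]
      simp only [Matrix.mul_apply, Finset.sum_mul, Matrix.transpose_apply, Matrix.of_apply]
      exact Finset.sum_congr rfl fun _ _ => Finset.sum_congr rfl fun _ _ => by ring
    rw [h, hA.ortho, Matrix.diagonal_apply]; rfl
  det_pos := hA.det_pos
  symm := hg.symm y hy

theorem pull1_injective (hA : A.det ≠ 0) {T S : Idx → ℝ} (h : ∀ a, pull1 A T a = pull1 A S a) :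
    T = S := by
  have e : ∀ T : Idx → ℝ, pull1 A T = Matrix.vecMul T A := by
    intro u; funext a
    simp only [pull1, Matrix.vecMul, dotProduct]
    exact Finset.sum_congr rfl fun _ _ => mul_comm _ _
  have h2 : Matrix.vecMul T A = Matrix.vecMul S A := by
    rw [← e, ← e]; exact funext h
  have h3 := congrArg (fun v => Matrix.vecMul v A⁻¹) h2
  simpa [Matrix.vecMul_vecMul, Matrix.mul_nonsing_inv _ (isUnit_iff_ne_zero.2 hA)] using h3

theorem pull2_injective (hA : A.det ≠ 0) {T S : Idx → Idx → ℝ}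
    (h : ∀ a b, pull2 A T a b = pull2 A S a b) (a b : Idx) : T a b = S a b := by
  simp only [pull2_eq] at h
  have h1 := fun b => pull1_injective hA fun a => h a b
  exact congrFun (pull1_injective hA fun b => congrFun (h1 b) a) b

/-- This licenses the proof of tensor identities on frame components. -/
theorem pull3_injective (hA : A.det ≠ 0) {T S : Idx → Idx → Idx → ℝ}
    (h : ∀ a b c, pull3 A T a b c = pull3 A S a b c) (a b c : Idx) : T a b c = S a b c := by
  simp only [pull3_eq] at h
  have h1 := fun b c => pull1_injective hA fun a => h a b c
  exact pull2_injective hA (fun b c => congrFun (h1 b c) a) b c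

theorem pull3_neg (A : Matrix Idx Idx ℝ) (T : Idx → Idx → Idx → ℝ) (a b c : Idx) :
    pull3 A (fun α β γ => -T α β γ) a b c = -pull3 A T a b c := by
  simp only [pull3_eq, pull2_eq, pull1_neg]

theorem pull3_antisymm (A : Matrix Idx Idx ℝ) {T : Idx → Idx → Idx → ℝ}
    (hT : ∀ a b c, T a b c = -T b a c) (a b c : Idx) :
    pull3 A T a b c = -pull3 A T b a c := by
  rw [← pull3_swap₁₂ A T a b c, ← pull3_neg]
  congr 1; funext a b c; exact hT a b c

theorem pull3_alt3 (A : Matrix Idx Idx ℝ) (T : Idx → Idx → Idx → ℝ) (a b c : Idx) :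
    pull3 A (alt3 T) a b c = alt3 (pull3 A T) a b c := by
  have e : alt3 T = fun α β γ => (1 / 6) * (T α β γ + (T β γ α + (T γ α β + ((-1) * T α γ β
      + ((-1) * T β α γ + (-1) * T γ β α))))) := by
    funext α β γ; rw [alt3]; ring
  rw [e, pull3_cmul]
  simp only [pull3_add A (fun α β γ => T α β γ), pull3_add A (fun α β γ => T β γ α),
    pull3_add A (fun α β γ => T γ α β), pull3_add A (fun α β γ => (-1) * T α γ β),
    pull3_add A (fun α β γ => (-1) * T β α γ), pull3_cmul, pull3_swap₁₂ A T, pull3_swap₂₃ A T,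
    pull3_cyc A T]
  rw [pull3_cyc A (fun α β γ => T γ α β), pull3_cyc A T,
    pull3_swap₁₂ A (fun α β γ => T γ α β), pull3_cyc A T, alt3]
  ring

/-- `(1/6) ε_α^{βγδ} T_{βγδ}`. -/
def epsVec (g : F2) (T : F3) : F1 := traceVec g (star3 g fun y a b c => T y c a b)

/-- Written as the trace of a dual, the vector X_α inherits smoothness and covariance from
`traceVec` and `star3`. -/
theorem LocMetric.xVec_eq (hg : LocMetric U g) (hy : y ∈ U) (K : F2) (L : F3) (a : Idx) :
    xVec g K L y a = epsVec g (xTilde g K L) y a := by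
  simp only [xVec, epsVec, traceVec, star3, epsUp3, Finset.mul_sum, Finset.sum_mul]
  have : ∀ F : Idx → Idx → Idx → Idx → ℝ, ∑ b, ∑ c, ∑ d, ∑ k, F b c d k
      = ∑ k, ∑ b, ∑ c, ∑ d, F b c d k := by
    intro F
    simp only [fun b c => Finset.sum_comm (f := F b c) (s := Finset.univ) (t := Finset.univ)]
    have e : ∀ b, ∑ c, ∑ k, ∑ d, F b c d k = ∑ k, ∑ c, ∑ d, F b c d k :=
      fun b => Finset.sum_comm
    simp only [e]
    exact Finset.sum_comm
  rw [this]
  refine Finset.sum_congr rfl fun k _ => Finset.sum_congr rfl fun b _ =>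
    Finset.sum_congr rfl fun c _ => Finset.sum_congr rfl fun d _ => ?_
  rw [hg.ginv_symm hy b k]; ring

theorem Rel.pull1_epsVec {J : Matrix Idx Idx ℝ} {g' : F2} {y' : Coord}
    (h : Rel J (g y) (g' y')) {T T' : F3} (hT : ∀ a b c, T y a b c = pull3 J (T' y') a b c)
    (a : Idx) : pull1 J (epsVec g' T' y') a = epsVec g T y a :=
  h.pull1_traceVec (fun a b c => (h.pull3_star3
    (fun a b c => by rw [hT, pull3_cyc J (T' y')]) a b c).symm) a

/-- `** = -1`. -/
theorem LocMetric.star3_star3 (hg : LocMetric U g) (hy : y ∈ U) {T : F3}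
    (hT : ∀ a b c, T y a b c = -T y b a c) (a b c : Idx) :
    star3 g (star3 g T) y a b c = -T y a b c := by
  obtain ⟨A, hA⟩ := hg.exists_frame hy
  have h := hA.rel hg hy
  set S : Idx → Idx → Idx → ℝ := pull3 A (T y)
  have hS : ∀ a b c, S a b c = -S b a c := pull3_antisymm A hT
  refine pull3_injective hA.det_pos.ne' (S := fun a b c => -T y a b c) (fun a b c => ?_) a b c
  rw [h.pull3_star3 (A := star3 mink fun _ => S)
    (fun a b c => (h.pull3_star3 (A := fun _ => S) (fun _ _ _ => rfl) a b c).symm)]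
  rw [pull3_neg]
  simp only [star3_mink]
  change _ = -S a b c
  have h0 : ∀ a c, S a a c = 0 := fun a c => by linarith [hS a a c]
  fin_cases a <;> fin_cases b <;> simp [etaStar, h0] <;>
    linarith [hS 1 0 c, hS 2 0 c, hS 3 0 c, hS 2 1 c, hS 3 1 c, hS 3 2 c]

theorem alt3_antisymm (S : Idx → Idx → Idx → ℝ) (a b c : Idx) :
    alt3 S a b c = -alt3 S b a c ∧ alt3 S a b c = -alt3 S a c b := by
  constructor <;> simp only [alt3] <;> ring

/-- The dual of a 3-form is a wedge product with the metric. -/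
theorem etaStar_of_antisymm {N : Idx → Idx → Idx → ℝ} (h1 : ∀ a b c, N a b c = -N b a c)
    (h2 : ∀ a b c, N a b c = -N a c b) {v : F1} (h : v 0 = ![N 1 2 3, N 0 2 3, -N 0 1 3, N 0 1 2])
    (a b c : Idx) : etaStar (fun i j => N i j c) a b = wedge mink v 0 a b c := by
  have z1 : ∀ a c, N a a c = 0 := fun a c => by linarith [h1 a a c]
  have z2 : ∀ a c, N a c c = 0 := fun a c => by linarith [h2 a c c]
  have z3 : ∀ a c, N a c a = 0 := fun a c => by linarith [h2 a c a, z1 a c]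
  have r : ∀ a b c, N b c a = N a b c ∧ N c a b = N a b c := fun a b c =>
    ⟨by linarith [h1 a b c, h2 b a c], by linarith [h2 a b c, h1 a c b]⟩
  have h10 := h1 1 0
  have h20 := h1 2 0
  have h30 := h1 3 0
  have h21 := h1 2 1
  have h31 := h1 3 1
  have h32 := h1 3 2
  have r1 := r 0 1 2
  have r2 := r 0 1 3
  have r3 := r 0 2 3
  have r4 := r 1 2 3
  have q1 := h2 0 2 1
  have q2 := h2 0 3 1
  have q3 := h2 0 3 2
  have q4 := h2 1 3 2
  simp only [wedge, h, mink, etaStar]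
  clear h r h1 h2
  fin_cases a <;> fin_cases b <;> fin_cases c <;>
    simp [z2, z3, h10, h20, h30, h21, h31, h32, r1, r2, r3, r4, q1, q2, q3, q4, sgn] <;> ring

theorem epsVec_mink {S : Idx → Idx → Idx → ℝ} (hS : ∀ a b c, S a b c = -S b a c) :
    epsVec mink (fun _ => S) 0
      = ![alt3 S 1 2 3, alt3 S 0 2 3, -alt3 S 0 1 3, alt3 S 0 1 2] := by
  have h21 := hS 2 1
  have h31 := hS 3 1
  have h32 := hS 3 2
  have h10 := hS 1 0
  have h20 := hS 2 0
  have h30 := hS 3 0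
  funext a
  simp only [epsVec, traceVec_mink, star3_mink]
  fin_cases a <;> simp [etaStar, sgn, Fin.sum_univ_four, alt3, h10, h20, h30, h21, h31, h32] <;>
    ring

/-- In an orthonormal frame the alternating part of T has four components, which up to sign are the
components of `epsVec`. The dual of such a 3-form is a product of that vector with the metric. -/
theorem LocMetric.star3_alt3 (hg : LocMetric U g) (hy : y ∈ U) {T : F3}
    (hT : ∀ a b c, T y a b c = -T y b a c) (a b c : Idx) :
    star3 g (fun y => alt3 (T y)) y a b c = wedge g (epsVec g T) y a b c := by
  obtain ⟨A, hA⟩ := hg.exists_frame hy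
  have h := hA.rel hg hy
  refine pull3_injective hA.det_pos.ne' (fun a b c => ?_) a b c
  have hv : ∀ a, epsVec mink (fun _ => pull3 A (T y)) 0 a = pull1 A (epsVec g T y) a := fun a =>
    (h.pull1_epsVec (T := fun _ => pull3 A (T y)) (T' := T) (fun _ _ _ => rfl) a).symm
  have ha : ∀ a b c, alt3 (pull3 A (T y)) a b c = pull3 A (alt3 (T y)) a b c := fun a b c =>
    (pull3_alt3 A (T y) a b c).symm
  have e1 := h.pull3_star3 (A := fun _ => alt3 (pull3 A (T y))) (A' := fun y => alt3 (T y)) ha a b c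
  have e2 := h.pull3_wedge (v := epsVec mink fun _ => pull3 A (T y)) (v' := epsVec g T) hv a b c
  rw [star3_mink] at e1
  have e3 := etaStar_of_antisymm (fun a b c => (alt3_antisymm _ a b c).1)
    (fun a b c => (alt3_antisymm _ a b c).2) (epsVec_mink (pull3_antisymm A hT)) a b c
  exact (e1.trans e3).trans e2.symm

end Frame

/-! ## Algebra of the reduction variables -/

theorem eps_swap₃₄ (g : F2) (y : Coord) (a b c d : Idx) :
    eps g y a b c d = -eps g y a b d c := by
  simp only [eps, permSymbol_eq, det4]; ring

theorem eps_swap₂₃ (g : F2) (y : Coord) (a b c d : Idx) :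
    eps g y a b c d = -eps g y a c b d := by
  simp only [eps, permSymbol_eq, det4]; ring

theorem eps_swap₁₂ (g : F2) (y : Coord) (a b c d : Idx) :
    eps g y a b c d = -eps g y b a c d := by
  simp only [eps, permSymbol_eq, det4]; ring

theorem eps_rotate (g : F2) (y : Coord) (a b c d : Idx) :
    eps g y a b c d = -eps g y b c d a := by
  rw [eps_swap₁₂, eps_swap₂₃, eps_swap₃₄]; ring

section StarLinear

variable (g : F2) (y : Coord)

theorem star3_add (A B : F3) (a b c : Idx) :
    star3 g (fun y a b c => A y a b c + B y a b c) y a b c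
      = star3 g A y a b c + star3 g B y a b c := by
  simp only [star3, mul_add, Finset.sum_add_distrib]

theorem star3_cmul (r : ℝ) (A : F3) (a b c : Idx) :
    star3 g (fun y a b c => r * A y a b c) y a b c = r * star3 g A y a b c := by
  simp only [star3, mul_left_comm _ r, ← Finset.mul_sum]

theorem star3_sub (A B : F3) (a b c : Idx) :
    star3 g (fun y a b c => A y a b c - B y a b c) y a b c
      = star3 g A y a b c - star3 g B y a b c := by
  simp only [star3, mul_sub, Finset.sum_sub_distrib]

theorem star3_congr {A B : F3} (h : ∀ a b c, A y a b c = B y a b c) (a b c : Idx) :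
    star3 g A y a b c = star3 g B y a b c := by
  simp only [star3, h]

theorem star3_antisymm (A : F3) (a b c : Idx) : star3 g A y a b c = -star3 g A y b a c := by
  have : ∀ r s, epsMixed g y a b r s = -epsMixed g y b a r s := by
    intro r s
    simp only [epsMixed, fun k l => eps_swap₁₂ g y a b k l, mul_neg, Finset.sum_neg_distrib]
  simp only [star3, this, neg_mul, Finset.sum_neg_distrib, mul_neg]

theorem wedge_antisymm (v : F1) (a b c : Idx) : wedge g v y a b c = -wedge g v y b a c := by
  simp only [wedge]; ring

theorem traceVec_congr {A B : F3} (h : ∀ a b c, A y a b c = B y a b c) (a : Idx) :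
    traceVec g A y a = traceVec g B y a := by
  simp only [traceVec, h]

theorem wedge_congr {v w : F1} (h : ∀ a, v y a = w y a) (a b c : Idx) :
    wedge g v y a b c = wedge g w y a b c := by
  simp only [wedge, h]

end StarLinear

section Local

variable {U : Set Coord} {g : F2} {y : Coord} (hg : LocMetric U g) (hy : y ∈ U)
include hg hy

theorem LocMetric.wedge_hook (v : F1) (a b c : Idx) : alt3 (wedge g v y) a b c = 0 := by
  simp only [alt3, wedge, hg.symm y hy b a, hg.symm y hy c a, hg.symm y hy c b]; ring

/-- Each of the two metric factors cancels one inverse metric in the mixed ε. The two resulting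
terms are equal by antisymmetry, which uses up the factor ½. -/
theorem LocMetric.star3_wedge (v : F1) (a b c : Idx) :
    star3 g (wedge g v) y a b c = -∑ d, eps g y a b c d * raise1 g v y d := by
  have e1 : ∀ r s, epsMixed g y a b r s * wedge g v y r s c
      = v y r * (g y s c * epsMixed g y a b r s) - v y s * (g y r c * epsMixed g y a b r s) := by
    intro r s; simp only [wedge]; ring
  have e2 : ∀ r, ∑ s, g y s c * epsMixed g y a b r s = ∑ k, ginv g y r k * eps g y a b k c := by
    intro r
    simp only [epsMixed, Finset.mul_sum]
    rw [Finset.sum_comm]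
    refine Finset.sum_congr rfl fun k _ => ?_
    rw [Finset.sum_comm]
    have : ∀ l, ∑ s, g y s c * (ginv g y r k * ginv g y s l * eps g y a b k l)
        = (∑ s, ginv g y l s * g y s c) * (ginv g y r k * eps g y a b k l) := by
      intro l
      rw [Finset.sum_mul]
      exact Finset.sum_congr rfl fun s _ => by rw [hg.ginv_symm hy l s]; ring
    simp only [this, hg.ginv_mul hy]
    simp
  have e3 : ∀ s, ∑ r, g y r c * epsMixed g y a b r s = ∑ l, ginv g y s l * eps g y a b c l := by
    intro s
    simp only [epsMixed, Finset.mul_sum]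
    have : ∀ r, ∑ k, ∑ l, g y r c * (ginv g y r k * ginv g y s l * eps g y a b k l)
        = ∑ l, ∑ k, g y r c * (ginv g y r k * ginv g y s l * eps g y a b k l) :=
      fun r => Finset.sum_comm
    simp only [this]
    rw [Finset.sum_comm]
    refine Finset.sum_congr rfl fun l _ => ?_
    rw [Finset.sum_comm]
    have : ∀ k, ∑ r, g y r c * (ginv g y r k * ginv g y s l * eps g y a b k l)
        = (∑ r, ginv g y k r * g y r c) * (ginv g y s l * eps g y a b k l) := by
      intro k
      rw [Finset.sum_mul]
      exact Finset.sum_congr rfl fun r _ => by rw [hg.ginv_symm hy k r]; ring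
    simp only [this, hg.ginv_mul hy]
    simp
  have e4 : ∑ r, v y r * ∑ k, ginv g y r k * eps g y a b k c
      = -∑ d, eps g y a b c d * raise1 g v y d := by
    simp only [raise1, Finset.mul_sum]
    rw [Finset.sum_comm, ← Finset.sum_neg_distrib]
    refine Finset.sum_congr rfl fun k _ => ?_
    rw [← Finset.sum_neg_distrib]
    refine Finset.sum_congr rfl fun r _ => ?_
    rw [eps_swap₃₄ g y a b k c, hg.ginv_symm hy r k]; ring
  have e5 : ∑ s, v y s * ∑ l, ginv g y s l * eps g y a b c l
      = ∑ d, eps g y a b c d * raise1 g v y d := by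
    simp only [raise1, Finset.mul_sum]
    rw [Finset.sum_comm]
    refine Finset.sum_congr rfl fun k _ => Finset.sum_congr rfl fun r _ => ?_
    rw [hg.ginv_symm hy r k]; ring
  rw [star3]
  simp only [e1, Finset.sum_sub_distrib]
  rw [Finset.sum_comm (f := fun r s => v y s * (g y r c * epsMixed g y a b r s))]
  simp only [← Finset.mul_sum, e2, e3]
  rw [e4, e5]; ring

/-- Such a dual is a 3-form, hence invisible after symmetrization of the last two indices. This is
why traces drop out of the reduced constraint. -/
theorem LocMetric.star3_wedge_swap (v : F1) (a b c : Idx) :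
    star3 g (wedge g v) y a b c = -star3 g (wedge g v) y a c b := by
  rw [hg.star3_wedge hy, hg.star3_wedge hy]
  simp only [fun d => eps_swap₂₃ g y a b c d, neg_mul, Finset.sum_neg_distrib]

theorem LocMetric.alt3_star3_wedge (v : F1) (a b c : Idx) :
    alt3 (star3 g (wedge g v) y) a b c = star3 g (wedge g v) y a b c := by
  have h1 := star3_antisymm g y (wedge g v)
  have h2 := hg.star3_wedge_swap hy v
  simp only [alt3]
  linarith [h1 a b c, h2 a b c, h1 b c a, h2 b c a, h1 c a b, h2 c a b, h1 a c b, h2 a c b,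
    h1 b a c, h2 b a c, h1 c b a, h2 c b a]

theorem LocMetric.sum_eps_raise1 (v : F1) (a b c : Idx) :
    ∑ m, eps g y m a b c * raise1 g v y m = star3 g (wedge g v) y a b c := by
  rw [hg.star3_wedge hy]
  simp only [fun m => eps_rotate g y m a b c, neg_mul, Finset.sum_neg_distrib]

theorem LocMetric.wOf_eq (D : F3) (A : F1) (a b c : Idx) :
    wOf g D A y a b c = D y a b c - star3 g (wedge g A) y a b c := by
  rw [wOf, hg.sum_eps_raise1 hy]

theorem LocMetric.star3_wOf {D : F3} (A : F1) (a b c : Idx) :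
    star3 g (wOf g D A) y a b c = star3 g D y a b c + wedge g A y a b c := by
  rw [star3_congr g y (B := fun y a b c => D y a b c - star3 g (wedge g A) y a b c)
      (hg.wOf_eq hy D A), star3_sub,
    hg.star3_star3 hy (wedge_antisymm g y A)]; ring

/-- The two terms have traces 4v and v, and the difference 3v explains the factor ⅓ in `traceVec`.
-/
theorem LocMetric.traceVec_wedge (v : F1) (a : Idx) : traceVec g (wedge g v) y a = v y a := by
  have h1 : ∑ b, ∑ c, ginv g y b c * g y b c = 4 := by
    have : ∀ b, ∑ c, ginv g y b c * g y b c = 1 := by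
      intro b
      rw [← (hg.ginv_mul hy b b).trans (if_pos rfl)]
      exact Finset.sum_congr rfl fun c _ => by rw [hg.symm y hy b c]
    simp [this]
  have h2 : ∑ b, ∑ c, ginv g y b c * (v y b * g y a c) = v y a := by
    have : ∀ b, ∑ c, ginv g y b c * (v y b * g y a c) = (if b = a then 1 else 0) * v y b := by
      intro b
      rw [← hg.ginv_mul hy b a, Finset.sum_mul]
      exact Finset.sum_congr rfl fun c _ => by rw [hg.symm y hy a c]; ring
    simp [this]
  have h3 : ∑ b, ∑ c, ginv g y b c * (v y a * g y b c) = v y a * 4 := by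
    rw [← h1]
    simp only [Finset.mul_sum]
    exact Finset.sum_congr rfl fun _ _ => Finset.sum_congr rfl fun _ _ => by ring
  simp only [traceVec, wedge, mul_sub, Finset.sum_sub_distrib]
  rw [h2, h3]; ring

theorem LocMetric.traceVec_of_antisymm {T : F3} (hT : ∀ a b c, T y a b c = -T y a c b) (a : Idx) :
    traceVec g T y a = 0 := by
  have : ∑ b, ∑ c, ginv g y b c * T y a b c = -∑ b, ∑ c, ginv g y b c * T y a b c := by
    conv_lhs => rw [Finset.sum_comm]
    simp only [← Finset.sum_neg_distrib]
    exact Finset.sum_congr rfl fun b _ => Finset.sum_congr rfl fun c _ => by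
      rw [hT, hg.ginv_symm hy c b]; ring
  rw [traceVec]; linarith

theorem LocMetric.xTilde_eq (K : F2) (L : F3) (a b c : Idx) : xTilde g K L y a b c =
    L y a b c - (1 / 3) * lamT g K y a b c + (1 / 6) * wedge g (grad (trK g K)) y a b c := by
  simp only [xTilde, wedge, hg.symm y hy c a, hg.symm y hy c b]; ring

omit hg hy in
theorem lamT_antisymm (g K : F2) (y : Coord) (a b c : Idx) :
    lamT g K y a b c = -lamT g K y b a c := by
  simp only [lamT]; ring

variable {L : F3} (hL : ∀ a b c, L y a b c = -L y b a c)
include hL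

theorem LocMetric.xTilde_antisymm (K : F2) (a b c : Idx) :
    xTilde g K L y a b c = -xTilde g K L y b a c := by
  rw [hg.xTilde_eq hy, hg.xTilde_eq hy, hL, lamT_antisymm, wedge_antisymm]; ring

theorem LocMetric.star3_xHook (K : F2) (a b c : Idx) : star3 g (xHook g K L) y a b c =
    star3 g L y a b c - (1 / 3) * star3 g (lamT g K) y a b c
      + (1 / 6) * star3 g (wedge g (grad (trK g K))) y a b c - wedge g (xVec g K L) y a b c := by
  have h1 : star3 g (xHook g K L) y a b c = star3 g (xTilde g K L) y a b c
      - star3 g (fun y => alt3 (xTilde g K L y)) y a b c :=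
    star3_sub g y (xTilde g K L) (fun y => alt3 (xTilde g K L y)) a b c
  rw [h1, hg.star3_alt3 hy (hg.xTilde_antisymm hy hL K),
    star3_congr g y (B := fun y a b c => L y a b c - (1 / 3) * lamT g K y a b c
      + (1 / 6) * wedge g (grad (trK g K)) y a b c) (hg.xTilde_eq hy K L),
    star3_add g y (fun y a b c => L y a b c - (1 / 3) * lamT g K y a b c), star3_sub, star3_cmul,
    star3_cmul, wedge_congr g y (hg.xVec_eq hy K L)]

/-- Passing from L̃ to X̃ minus its alternating part removes a product of X_α with the metric from
the dual; adding it back leaves *L - ⅓ *λ and a 3-form, which symmetrization kills. -/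
theorem LocMetric.symLast_star3_xHook (K : F2) (a b c : Idx) :
    symLast (fun y a b c => star3 g (xHook g K L) y a b c + wedge g (xVec g K L) y a b c) y a b c
      = symLast (fun y a b c => star3 g L y a b c - (1 / 3) * star3 g (lamT g K) y a b c)
        y a b c := by
  simp only [symLast, hg.star3_xHook hy hL]
  rw [hg.star3_wedge_swap hy _ a b c]; ring

omit hL in
theorem LocMetric.starW_eq (Y : F2) (a b c : Idx) : starW g Y L y a b c =
    star3 g (xHook g (kySquare g Y) L) y a b c
      - star3 g (wedge g (traceVec g (xHook g (kySquare g Y) L))) y a b c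
      + wedge g (yVec g Y L) y a b c := by
  have h1 : dTf g Y L = fun y a b c => xHook g (kySquare g Y) L y a b c
      - wedge g (traceVec g (xHook g (kySquare g Y) L)) y a b c := rfl
  rw [starW, wOfL, hg.star3_wOf hy, h1, star3_sub]

omit hL in
theorem LocMetric.symLast_starW_eq (Y : F2) (a b c : Idx) : symLast (starW g Y L) y a b c =
    symLast (fun y a b c => star3 g (xHook g (kySquare g Y) L) y a b c
      + wedge g (yVec g Y L) y a b c) y a b c := by
  simp only [symLast, hg.starW_eq hy]
  rw [hg.star3_wedge_swap hy _ a b c]; ring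

/-- This eliminates the variables X, D and Y_α: the invariant sees only *L, *λ and the gradient of
𝒵. -/
theorem LocMetric.symLast_starW (Y : F2) (a b c : Idx) : symLast (starW g Y L) y a b c =
    symLast (fun y a b c => star3 g L y a b c
      - (1 / 3) * star3 g (lamT g (kySquare g Y)) y a b c
      - (4 / 3) * wedge g (grad (kyScalar g Y)) y a b c) y a b c := by
  rw [hg.symLast_starW_eq hy]
  have h := hg.symLast_star3_xHook hy hL (kySquare g Y) a b c
  simp only [symLast, wedge, yVec] at h ⊢
  linear_combination h

omit hL in
theorem LocMetric.traceVec_dTf (Y : F2) (a : Idx) : traceVec g (dTf g Y L) y a = 0 := by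
  have h1 : dTf g Y L = fun y a b c => xHook g (kySquare g Y) L y a b c
      - wedge g (traceVec g (xHook g (kySquare g Y) L)) y a b c := rfl
  have h2 := hg.traceVec_wedge hy (traceVec g (xHook g (kySquare g Y) L)) a
  have h3 : traceVec g (dTf g Y L) y a = traceVec g (xHook g (kySquare g Y) L) y a
      - traceVec g (wedge g (traceVec g (xHook g (kySquare g Y) L))) y a := by
    rw [h1]
    simp only [traceVec, mul_sub, Finset.sum_sub_distrib]
  rw [h3, h2, sub_self]

theorem LocMetric.dTf_antisymm (Y : F2) (a b c : Idx) :
    dTf g Y L y a b c = -dTf g Y L y b a c := by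
  have h := hg.xTilde_antisymm hy hL (kySquare g Y)
  simp only [dTf, traceFree, xHook, alt3]
  linarith [h a b c]

omit hL in
theorem LocMetric.dTf_hook (Y : F2) (a b c : Idx) : alt3 (dTf g Y L y) a b c = 0 := by
  have h := hg.wedge_hook hy (traceVec g (xHook g (kySquare g Y) L)) a b c
  have e : alt3 (dTf g Y L y) a b c = alt3 (xHook g (kySquare g Y) L y) a b c
      - alt3 (wedge g (traceVec g (xHook g (kySquare g Y) L)) y) a b c := by
    simp only [alt3, dTf, traceFree, wedge]; ring
  rw [e, h]
  simp only [alt3, xHook]; ring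

end Local

/-! ### Inverting the change of variables: from D and A back to L -/

section Recon

variable {U : Set Coord} {g Y : F2} {y : Coord} (hg : LocMetric U g) (hy : y ∈ U)
  {D : F3} {A : F1}
include hg hy

theorem LocMetric.recon_eq (a b c : Idx) : recon g Y D A y a b c = D y a b c
    + (1 / 3) * lamT g (kySquare g Y) y a b c
    - star3 g (wedge g fun y a => A y a + (4 / 3) * grad (kyScalar g Y) y a) y a b c := by
  rw [hg.star3_wedge hy, recon, sub_neg_eq_add]
  congr 1
  refine Finset.sum_congr rfl fun d _ => ?_
  simp only [raise1, mul_add, Finset.sum_add_distrib, Finset.mul_sum]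
  congr 1
  exact Finset.sum_congr rfl fun _ _ => by ring

theorem LocMetric.recon_antisymm (hD : ∀ a b c, D y a b c = -D y b a c) (a b c : Idx) :
    recon g Y D A y a b c = -recon g Y D A y b a c := by
  rw [hg.recon_eq hy, hg.recon_eq hy, hD, lamT_antisymm, star3_antisymm]; ring

variable (hD : ∀ a b c, D y a b c = -D y b a c) (ht : ∀ a, traceVec g D y a = 0)
  (hh : ∀ a b c, alt3 (D y) a b c = 0)
include hD hh

omit hD in
-- The ⅓ λ in `recon` is subtracted in X̃, and neither D nor a product of a vector with the metric
-- has an alternating part. Only the ε term survives.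
theorem LocMetric.alt3_xTilde_recon (a b c : Idx) :
    alt3 (xTilde g (kySquare g Y) (recon g Y D A) y) a b c =
      -star3 g (wedge g fun y a => A y a + (4 / 3) * grad (kyScalar g Y) y a) y a b c := by
  set v : F1 := fun y a => A y a + (4 / 3) * grad (kyScalar g Y) y a
  have h1 := hg.alt3_star3_wedge hy v a b c
  have h2 := hh a b c
  have h3 := hg.wedge_hook hy (grad (trK g (kySquare g Y))) a b c
  simp only [alt3, hg.xTilde_eq hy, hg.recon_eq hy] at h1 h2 h3 ⊢
  linear_combination h2 + (1 / 6) * h3 - h1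

omit hD in
theorem LocMetric.xHook_recon (a b c : Idx) :
    xHook g (kySquare g Y) (recon g Y D A) y a b c =
      D y a b c + (1 / 6) * wedge g (grad (trK g (kySquare g Y))) y a b c := by
  rw [xHook, hg.alt3_xTilde_recon hy hh, hg.xTilde_eq hy, hg.recon_eq hy]; ring

/-- The dual of the alternating part of X̃ is the product of X_α with the metric. That part is
itself minus a dual, so ** = -1 returns the prescribed vector, which the trace then extracts. -/
theorem LocMetric.xVec_recon (a : Idx) : xVec g (kySquare g Y) (recon g Y D A) y a =
    A y a + (4 / 3) * grad (kyScalar g Y) y a := by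
  set v : F1 := fun y a => A y a + (4 / 3) * grad (kyScalar g Y) y a with hv
  have h : ∀ a b c, wedge g (xVec g (kySquare g Y) (recon g Y D A)) y a b c
      = wedge g v y a b c := by
    intro a b c
    rw [wedge_congr g y (hg.xVec_eq hy _ _), ← hg.star3_alt3 hy
      (hg.xTilde_antisymm hy (hg.recon_antisymm hy hD) _)]
    rw [star3_congr g y (B := fun y a b c => (-1) * star3 g (wedge g v) y a b c)
      (fun a b c => by rw [hg.alt3_xTilde_recon hy hh]; ring), star3_cmul,
      hg.star3_star3 hy (wedge_antisymm g y v)]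
    ring
  have h1 := traceVec_congr g y h a
  rwa [hg.traceVec_wedge hy, hg.traceVec_wedge hy] at h1

include ht

omit hD in
-- Besides D, the hook part contains only the gradient of the trace of K times the metric, a pure
-- trace which `traceFree` removes.
theorem LocMetric.dTf_recon (a b c : Idx) : dTf g Y (recon g Y D A) y a b c = D y a b c := by
  have h : ∀ a, traceVec g (xHook g (kySquare g Y) (recon g Y D A)) y a
      = (1 / 6) * grad (trK g (kySquare g Y)) y a := by
    intro a
    have h1 := hg.traceVec_wedge hy (grad (trK g (kySquare g Y))) a
    have h2 := ht a
    rw [traceVec_congr g y (B := fun y a b c => D y a b c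
      + (1 / 6) * wedge g (grad (trK g (kySquare g Y))) y a b c) (hg.xHook_recon hy hh)]
    simp only [traceVec, mul_add, Finset.sum_add_distrib, mul_left_comm _ ((1 : ℝ) / 6),
      ← Finset.mul_sum] at h1 h2 ⊢
    linear_combination h2 + (1 / 6) * h1
  simp only [dTf, traceFree, h, hg.xHook_recon hy hh, wedge]; ring

theorem LocMetric.wOfL_recon (a b c : Idx) :
    wOfL g Y (recon g Y D A) y a b c = wOf g D A y a b c := by
  have h : ∀ a, yVec g Y (recon g Y D A) y a = A y a := by
    intro a; rw [yVec, hg.xVec_recon hy hD hh]; ring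
  rw [wOfL, hg.wOf_eq hy, hg.wOf_eq hy, hg.dTf_recon hy ht hh,
    star3_congr g y (wedge_congr g y h)]

theorem LocMetric.starW_recon (a b c : Idx) :
    starW g Y (recon g Y D A) y a b c = star3 g (wOf g D A) y a b c :=
  star3_congr g y (hg.wOfL_recon hy hD ht hh) a b c

end Recon

/-! ## Polynomials on the cone of timelike vectors -/

/-- The trilinear form of an array. -/
def tri (T : Idx → Idx → Idx → ℝ) (u v w : Idx → ℝ) : ℝ :=
  ∑ β, ∑ γ, ∑ δ, T β γ δ * u β * v γ * w δ

/-- The bilinear form of an array. -/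
def bil (T : Idx → Idx → ℝ) (u v : Idx → ℝ) : ℝ := ∑ β, ∑ γ, T β γ * u β * v γ

section Forms

variable (T : Idx → Idx → Idx → ℝ) (S : Idx → Idx → ℝ) (u u' v w : Idx → ℝ) (r : ℝ)

theorem tri_add₁ : tri T (u + u') v w = tri T u v w + tri T u' v w := by
  simp only [tri, Pi.add_apply, mul_add, add_mul, Finset.sum_add_distrib]

theorem tri_add₂ : tri T v (u + u') w = tri T v u w + tri T v u' w := by
  simp only [tri, Pi.add_apply, mul_add, add_mul, Finset.sum_add_distrib]

theorem tri_add₃ : tri T v w (u + u') = tri T v w u + tri T v w u' := by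
  simp only [tri, Pi.add_apply, mul_add, Finset.sum_add_distrib]

theorem tri_smul₁ : tri T (r • u) v w = r * tri T u v w := by
  simp only [tri, Pi.smul_apply, smul_eq_mul, Finset.mul_sum]
  exact Finset.sum_congr rfl fun _ _ => Finset.sum_congr rfl fun _ _ =>
    Finset.sum_congr rfl fun _ _ => by ring

theorem tri_smul₂ : tri T v (r • u) w = r * tri T v u w := by
  simp only [tri, Pi.smul_apply, smul_eq_mul, Finset.mul_sum]
  exact Finset.sum_congr rfl fun _ _ => Finset.sum_congr rfl fun _ _ =>
    Finset.sum_congr rfl fun _ _ => by ring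

theorem tri_smul₃ : tri T v w (r • u) = r * tri T v w u := by
  simp only [tri, Pi.smul_apply, smul_eq_mul, Finset.mul_sum]
  exact Finset.sum_congr rfl fun _ _ => Finset.sum_congr rfl fun _ _ =>
    Finset.sum_congr rfl fun _ _ => by ring

theorem tri_single (a b c : Idx) :
    tri T (Pi.single a 1) (Pi.single b 1) (Pi.single c 1) = T a b c := by
  simp [tri, Pi.single_apply]

theorem bil_add₁ : bil S (u + u') v = bil S u v + bil S u' v := by
  simp only [bil, Pi.add_apply, mul_add, add_mul, Finset.sum_add_distrib]

theorem bil_add₂ : bil S v (u + u') = bil S v u + bil S v u' := by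
  simp only [bil, Pi.add_apply, mul_add, Finset.sum_add_distrib]

theorem bil_smul₁ : bil S (r • u) v = r * bil S u v := by
  simp only [bil, Pi.smul_apply, smul_eq_mul, Finset.mul_sum]
  exact Finset.sum_congr rfl fun _ _ => Finset.sum_congr rfl fun _ _ => by ring

theorem bil_smul₂ : bil S v (r • u) = r * bil S v u := by
  simp only [bil, Pi.smul_apply, smul_eq_mul, Finset.mul_sum]
  exact Finset.sum_congr rfl fun _ _ => Finset.sum_congr rfl fun _ _ => by ring

theorem bil_single (a b : Idx) : bil S (Pi.single a 1) (Pi.single b 1) = S a b := by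
  simp [bil, Pi.single_apply]

end Forms

/-- A cubic form that vanishes on an open set has vanishing symmetrization. -/
theorem sym3_eq_zero_of_open {T : Idx → Idx → Idx → ℝ} {s : Set Coord} (hs : IsOpen s)
    (hn : s.Nonempty) (h : ∀ p ∈ s, tri T p p p = 0) (a b c : Idx) : sym3 T a b c = 0 := by
  obtain ⟨p, hp⟩ := hn
  have hu : ∀ u : Coord, tri T u u u = 0 := by
    intro u
    have hc : ∀ k : ℝ, ∀ᶠ t : ℝ in 𝓝 0, p + (k * t) • u ∈ s := by
      intro k
      have : Continuous fun t : ℝ => p + (k * t) • u := by fun_prop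
      exact this.continuousAt.eventually_mem (by simpa using hs.mem_nhds hp)
    -- Together with p itself these are the four equidistant points needed for a third difference
    -- along u.
    have hne : ∃ t : ℝ, t ≠ 0 ∧ (p + (1 * t) • u ∈ s ∧ p + (2 * t) • u ∈ s
        ∧ p + (-1 * t) • u ∈ s) := by
      have h1 := ((hc 1).and ((hc 2).and (hc (-1)))).filter_mono
        (nhdsWithin_le_nhds : 𝓝[≠] (0 : ℝ) ≤ 𝓝 0)
      obtain ⟨t, ht1, ht2⟩ := (h1.and self_mem_nhdsWithin).exists
      exact ⟨t, ht2, ht1⟩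
    obtain ⟨t, ht, h1, h2, h3⟩ := hne
    have e0 := h _ hp
    have e1 := h _ h1
    have e2 := h _ h2
    have e3 := h _ h3
    simp only [tri_add₁, tri_add₂, tri_add₃, tri_smul₁, tri_smul₂, tri_smul₃] at e1 e2 e3
    -- The third difference f(2) - 3 f(1) + 3 f(0) - f(-1) of a cubic is six times its leading
    -- coefficient.
    have : t ^ 3 * tri T u u u = 0 := by
      linear_combination (1 / 6) * (e2 - 3 * e1 + 3 * e0 - e3)
    exact (mul_eq_zero.1 this).resolve_left (pow_ne_zero 3 ht)
  have k1 := hu (Pi.single a 1)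
  have k2 := hu (Pi.single b 1)
  have k3 := hu (Pi.single c 1)
  have k4 := hu (Pi.single a 1 + Pi.single b 1)
  have k5 := hu (Pi.single a 1 + Pi.single c 1)
  have k6 := hu (Pi.single b 1 + Pi.single c 1)
  have k7 := hu (Pi.single a 1 + Pi.single b 1 + Pi.single c 1)
  simp only [tri_add₁, tri_add₂, tri_add₃, tri_single] at k1 k2 k3 k4 k5 k6 k7
  -- Polarization: inclusion-exclusion over the sums of three basis vectors isolates the symmetrized
  -- component.
  rw [sym3]
  linear_combination (1 / 6) * (k7 - k4 - k5 - k6 + k1 + k2 + k3)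

/-- The quadratic analogue: a second difference along a line, followed by polarization. -/
theorem sym2_eq_zero_of_open {T : Idx → Idx → ℝ} {s : Set Coord} (hs : IsOpen s)
    (hn : s.Nonempty) (h : ∀ p ∈ s, bil T p p = 0) (a b : Idx) : T a b + T b a = 0 := by
  obtain ⟨p, hp⟩ := hn
  have hu : ∀ u : Coord, bil T u u = 0 := by
    intro u
    have hc : ∀ k : ℝ, ∀ᶠ t : ℝ in 𝓝 0, p + (k * t) • u ∈ s := by
      intro k
      have : Continuous fun t : ℝ => p + (k * t) • u := by fun_prop
      exact this.continuousAt.eventually_mem (by simpa using hs.mem_nhds hp)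
    have hne : ∃ t : ℝ, t ≠ 0 ∧ (p + (1 * t) • u ∈ s ∧ p + (-1 * t) • u ∈ s) := by
      have h1 := ((hc 1).and (hc (-1))).filter_mono
        (nhdsWithin_le_nhds : 𝓝[≠] (0 : ℝ) ≤ 𝓝 0)
      obtain ⟨t, ht1, ht2⟩ := (h1.and self_mem_nhdsWithin).exists
      exact ⟨t, ht2, ht1⟩
    obtain ⟨t, ht, h1, h3⟩ := hne
    have e0 := h _ hp
    have e1 := h _ h1
    have e3 := h _ h3
    simp only [bil_add₁, bil_add₂, bil_smul₁, bil_smul₂] at e1 e3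
    have : t ^ 2 * bil T u u = 0 := by
      linear_combination (1 / 2) * (e1 - 2 * e0 + e3)
    exact (mul_eq_zero.1 this).resolve_left (pow_ne_zero 2 ht)
  have k1 := hu (Pi.single a 1)
  have k2 := hu (Pi.single b 1)
  have k4 := hu (Pi.single a 1 + Pi.single b 1)
  simp only [bil_add₁, bil_add₂, bil_single] at k1 k2 k4
  linear_combination k4 - k1 - k2

/-! ## Frames adapted to a timelike vector -/

/-- The reflection that corrects the orientation acts on a spatial axis, so the time axis, which is
to be p̂, is not disturbed. -/
theorem IsFrame.flip {G : Idx → Idx → ℝ} {A : Matrix Idx Idx ℝ}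
    (hA : A.transpose * Matrix.of G * A = Matrix.diagonal sgn) :
    ∃ B, IsFrame G B ∧ ∀ α, B α 0 = A α 0 := by
  have hd : A.det ≠ 0 := by
    intro h0
    have h := congrArg Matrix.det hA
    rw [Matrix.det_mul, h0, Matrix.det_diagonal] at h
    simp [Fin.prod_univ_four, sgn] at h
  rcases lt_or_gt_of_ne hd with h | h
  · refine ⟨A * Matrix.diagonal ![1, -1, 1, 1], ⟨?_, ?_⟩, fun α => ?_⟩
    · have e : ∀ D G : Matrix Idx Idx ℝ, (A * D).transpose * G * (A * D)
          = D.transpose * (A.transpose * G * A) * D := by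
        intro D G; rw [Matrix.transpose_mul]; simp only [Matrix.mul_assoc]
      rw [e, hA, Matrix.diagonal_transpose, Matrix.diagonal_mul_diagonal,
        Matrix.diagonal_mul_diagonal]
      congr 1; funext a; fin_cases a <;> simp [sgn]
    · rw [Matrix.det_mul, Matrix.det_diagonal]
      simp [Fin.prod_univ_four]; exact h
    · simp
  · exact ⟨A, ⟨hA, h⟩, fun _ => rfl⟩

/-- A Lorentz transformation that takes the first basis vector to a given unit timelike
vector. -/
theorem exists_lorentz {q : Idx → ℝ} (hq : ∑ a, sgn a * q a * q a = -1) :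
    ∃ B : Matrix Idx Idx ℝ, B.transpose * Matrix.diagonal sgn * B = Matrix.diagonal sgn
      ∧ ∀ a, B a 0 = q a := by
  simp only [Fin.sum_univ_four, sgn] at hq
  simp at hq
  -- In this case q is already the first basis vector, and the reflection used otherwise would
  -- degenerate.
  by_cases h : q 0 = 1
  · refine ⟨1, by simp, fun a => ?_⟩
    rw [h] at hq
    have h1 : q 1 = 0 := by nlinarith [sq_nonneg (q 1), sq_nonneg (q 2), sq_nonneg (q 3)]
    have h2 : q 2 = 0 := by nlinarith [sq_nonneg (q 1), sq_nonneg (q 2), sq_nonneg (q 3)]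
    have h3 : q 3 = 0 := by nlinarith [sq_nonneg (q 1), sq_nonneg (q 2), sq_nonneg (q 3)]
    rw [Matrix.one_apply]
    fin_cases a <;> simp [h, h1, h2, h3]
  -- The transformation is the reflection along n = q - e₀. The Minkowski square of n is 2 (q₀ - 1),
  -- whence the coefficient c = 1/(q₀ - 1).
  · have hc : q 0 - 1 ≠ 0 := sub_ne_zero.2 h
    set n : Idx → ℝ := ![q 0 - 1, q 1, q 2, q 3] with hn
    set c := (q 0 - 1)⁻¹ with hcd
    have hcc : c * (q 0 - 1) = 1 := inv_mul_cancel₀ hc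
    have hnn : ∑ k, sgn k * n k * n k = 2 * (q 0 - 1) := by
      simp [Fin.sum_univ_four, sgn, hn]; linarith
    refine ⟨Matrix.of fun a b => (if a = b then 1 else 0) - c * n a * (sgn b * n b), ?_, ?_⟩
    · ext a b
      simp only [Matrix.mul_apply, Matrix.transpose_apply, Matrix.of_apply,
        Matrix.diagonal_apply, mul_ite, mul_zero, Finset.sum_ite_eq', Finset.mem_univ, if_true]
      have e : ∀ k, ((if k = a then (1 : ℝ) else 0) - c * n k * (sgn a * n a)) * sgn k
          * ((if k = b then 1 else 0) - c * n k * (sgn b * n b))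
          = (if k = a then (if k = b then sgn k else 0) else 0)
            - (if k = a then sgn k * (c * n k * (sgn b * n b)) else 0)
            - (if k = b then sgn k * (c * n k * (sgn a * n a)) else 0)
            + c * c * (sgn a * n a) * (sgn b * n b) * (sgn k * n k * n k) := by
        intro k; split_ifs <;> ring
      simp only [e, Finset.sum_add_distrib, Finset.sum_sub_distrib, ← Finset.mul_sum, hnn,
        Finset.sum_ite_eq', Finset.mem_univ, if_true]
      linear_combination (2 * c * sgn a * n a * sgn b * n b) * hcc
    · intro a
      have : sgn 0 * n 0 = -(q 0 - 1) := by simp [sgn, hn]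
      rw [Matrix.of_apply, this]
      have h2 : c * n a * -(q 0 - 1) = -n a := by linear_combination (-n a) * hcc
      rw [h2]
      fin_cases a <;> simp [hn]

section Local

variable {U : Set Coord} {g : F2} {y : Coord} (hg : LocMetric U g) (hy : y ∈ U)

theorem dot_eq_bil (g : F2) (y u w : Coord) : dot g y u w = bil (g y) u w := rfl

theorem isOpen_timelike (g : F2) (y : Coord) : IsOpen {p : Coord | dot g y p p < 0} := by
  apply isOpen_lt _ continuous_const
  unfold dot
  fun_prop

theorem mass_pos {g : F2} {y p : Coord} (hp : dot g y p p < 0) : 0 < mass g y p :=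
  Real.sqrt_pos.2 (neg_pos.2 hp)

theorem mass_sq {g : F2} {y p : Coord} (hp : dot g y p p < 0) :
    mass g y p * mass g y p = -dot g y p p := Real.mul_self_sqrt (neg_pos.2 hp).le

theorem IsFrame.ortho_apply {A : Matrix Idx Idx ℝ} (hA : IsFrame (g y) A) (a b : Idx) :
    bil (g y) (fun α => A α a) (fun α => A α b) = if a = b then sgn a else 0 := by
  have h := congrFun (congrFun hA.ortho a) b
  rw [Matrix.diagonal_apply] at h
  rw [← h, bil, Finset.sum_comm]
  simp only [Matrix.mul_apply, Finset.sum_mul, Matrix.transpose_apply, Matrix.of_apply]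
  exact Finset.sum_congr rfl fun _ _ => Finset.sum_congr rfl fun _ _ => by ring

include hg hy

theorem LocMetric.timelike_nonempty : {p : Coord | dot g y p p < 0}.Nonempty := by
  obtain ⟨A, hA⟩ := hg.exists_frame hy
  refine ⟨fun α => A α 0, ?_⟩
  have := hA.ortho_apply 0 0
  simp only [Set.mem_ofPred_eq, dot_eq_bil, this]
  simp [sgn]

/-- Expand p̂ in any orthonormal frame; its components form a unit timelike vector, and a Lorentz
transformation taking e₀ there rotates the frame. -/
theorem LocMetric.exists_adapted_frame {p : Coord} (hp : dot g y p p < 0) :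
    ∃ A, IsFrame (g y) A ∧ ∀ α, A α 0 = phat g y p α := by
  obtain ⟨A, hA⟩ := hg.exists_frame hy
  have hu : IsUnit A.det := isUnit_iff_ne_zero.2 hA.det_pos.ne'
  set q : Idx → ℝ := Matrix.mulVec A⁻¹ (phat g y p) with hq
  have hAq : Matrix.mulVec A q = phat g y p := by
    rw [hq, Matrix.mulVec_mulVec, Matrix.mul_nonsing_inv _ hu, Matrix.one_mulVec]
  have hd : ∀ v : Idx → ℝ, dotProduct v (Matrix.mulVec (Matrix.of (g y)) v) = dot g y v v := by
    intro v
    simp only [dotProduct, Matrix.mulVec, dot, Finset.mul_sum, Matrix.of_apply]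
    exact Finset.sum_congr rfl fun _ _ => Finset.sum_congr rfl fun _ _ => by ring
  have h1 : ∑ a, sgn a * q a * q a = -1 := by
    have e1 : ∑ a, sgn a * q a * q a = dotProduct q (Matrix.mulVec (Matrix.diagonal sgn) q) := by
      simp only [dotProduct, Matrix.mulVec_diagonal]
      exact Finset.sum_congr rfl fun _ _ => by ring
    rw [e1, ← hA.ortho, ← Matrix.mulVec_mulVec, hAq, ← Matrix.mulVec_mulVec,
      Matrix.dotProduct_mulVec, Matrix.vecMul_transpose, hAq, hd]
    have e2 : phat g y p = (mass g y p)⁻¹ • p := by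
      funext α; simp [phat, div_eq_inv_mul]
    rw [e2, dot_eq_bil, bil_smul₁, bil_smul₂, ← dot_eq_bil]
    have h3 := mass_sq hp
    have h4 := (mass_pos hp).ne'
    field_simp
    linarith
  obtain ⟨B, hB, hB0⟩ := exists_lorentz h1
  obtain ⟨C, hC, hC0⟩ := IsFrame.flip (G := g y) (A := A * B) (by
    have e : (A * B).transpose * Matrix.of (g y) * (A * B)
        = B.transpose * (A.transpose * Matrix.of (g y) * A) * B := by
      rw [Matrix.transpose_mul]; simp only [Matrix.mul_assoc]
    rw [e, hA.ortho, hB])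
  refine ⟨C, hC, fun α => ?_⟩
  rw [hC0, ← hAq, Matrix.mul_apply]
  simp only [hB0]; rfl

/-- The time axes of frames include every normalized timelike vector, and these vectors span an open
cone. The cubic form in the last three indices therefore vanishes on an open set, and only the
components a000 ever need to be computed. -/
theorem LocMetric.sym3_eq_zero {T : Idx → Idx → Idx → Idx → ℝ}
    (h : ∀ A, IsFrame (g y) A → ∀ a, pull4 A T a 0 0 0 = 0) (α β γ δ : Idx) :
    sym3 (T α) β γ δ = 0 := by
  refine sym3_eq_zero_of_open (isOpen_timelike g y) (hg.timelike_nonempty hy) ?_ β γ δ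
  intro p hp
  obtain ⟨A, hA, hA0⟩ := hg.exists_adapted_frame hy hp
  have hpA : p = mass g y p • fun α => A α 0 := by
    funext α
    simp only [Pi.smul_apply, hA0, phat, smul_eq_mul]
    field_simp [(mass_pos hp).ne']
  have h1 : ∀ a, pull1 A (fun α => tri (T α) (fun α => A α 0) (fun α => A α 0)
      fun α => A α 0) a = pull1 A 0 a := by
    intro a
    have e : pull1 A (0 : Idx → ℝ) a = 0 := by simp [pull1]
    rw [e, ← h A hA a, pull4_eq]
    congr 1; funext α
    simp only [tri, pull3]
    exact Finset.sum_congr rfl fun _ _ => Finset.sum_congr rfl fun _ _ =>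
      Finset.sum_congr rfl fun _ _ => by ring
  have h2 := congrFun (pull1_injective hA.det_pos.ne' h1) α
  simp only [Pi.zero_apply] at h2
  rw [hpA, tri_smul₁, tri_smul₂, tri_smul₃, h2]; ring

/-- The analogue for two symmetrized indices. The momentum is kept in the hypothesis because
invariants, unlike tensors, are evaluated at a given p. -/
theorem LocMetric.sym2_eq_zero {T : Idx → Idx → Idx → ℝ}
    (h : ∀ p, dot g y p p < 0 → ∀ A, IsFrame (g y) A → (∀ α, A α 0 = phat g y p α) →
      ∀ a, pull3 A T a 0 0 = 0) (α β γ : Idx) :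
    T α β γ + T α γ β = 0 := by
  refine sym2_eq_zero_of_open (isOpen_timelike g y) (hg.timelike_nonempty hy) ?_ β γ
  intro p hp
  obtain ⟨A, hA, hA0⟩ := hg.exists_adapted_frame hy hp
  have hpA : p = mass g y p • fun α => A α 0 := by
    funext α
    simp only [Pi.smul_apply, hA0, phat, smul_eq_mul]
    field_simp [(mass_pos hp).ne']
  have h1 : ∀ a, pull1 A (fun α => bil (T α) (fun α => A α 0) fun α => A α 0) a
      = pull1 A 0 a := by
    intro a
    have e : pull1 A (0 : Idx → ℝ) a = 0 := by simp [pull1]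
    rw [e, ← h p hp A hA hA0 a, pull3_eq]
    congr 1; funext α
    simp only [bil, pull2]
    exact Finset.sum_congr rfl fun _ _ => Finset.sum_congr rfl fun _ _ => by ring
  have h2 := congrFun (pull1_injective hA.det_pos.ne' h1) α
  simp only [Pi.zero_apply] at h2
  rw [hpA, bil_smul₁, bil_smul₂, h2]; ring

end Local

/-! ## Curvature in an orthonormal frame -/

section Pull4

variable (J : Matrix Idx Idx ℝ)

theorem pull4_swap₁₂ (T : Idx → Idx → Idx → Idx → ℝ) (a b c d : Idx) :
    pull4 J (fun α β γ δ => T β α γ δ) a b c d = pull4 J T b a c d := by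
  simp only [pull4_eq']
  rw [pull2_swap J (fun β α => pull2 J (fun γ δ => T β α γ δ) c d)]

theorem pull4_swap₂₃ (T : Idx → Idx → Idx → Idx → ℝ) (a b c d : Idx) :
    pull4 J (fun α β γ δ => T α γ β δ) a b c d = pull4 J T a c b d := by
  simp only [pull4_eq, pull3_swap₁₂ J (fun γ β δ => T _ γ β δ)]

theorem pull4_swap₃₄ (T : Idx → Idx → Idx → Idx → ℝ) (a b c d : Idx) :
    pull4 J (fun α β γ δ => T α β δ γ) a b c d = pull4 J T a b d c := by
  simp only [pull4_eq, pull3_swap₂₃ J (fun β δ γ => T _ β δ γ)]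

theorem pull4_pair (T : Idx → Idx → Idx → Idx → ℝ) (a b c d : Idx) :
    pull4 J (fun α β γ δ => T γ δ α β) a b c d = pull4 J T c d a b := by
  rw [pull4_swap₂₃ J (fun α γ β δ => T γ δ α β), pull4_swap₁₂ J (fun γ α β δ => T γ δ α β),
    pull4_swap₃₄ J (fun γ α δ β => T γ δ α β), pull4_swap₂₃ J (fun γ δ α β => T γ δ α β)]

theorem pull4_eq_first (T : Idx → Idx → Idx → Idx → ℝ) (a b c d : Idx) :
    pull4 J T a b c d = pull3 J (fun β γ δ => pull1 J (fun α => T α β γ δ) a) b c d := by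
  simp only [pull4_eq, pull3_eq, pull2_eq]
  rw [pull1_comm]; congr 1; funext β
  rw [pull1_comm]; congr 1; funext γ
  rw [pull1_comm]

theorem pull4_add (T S : Idx → Idx → Idx → Idx → ℝ) (a b c d : Idx) :
    pull4 J (fun α β γ δ => T α β γ δ + S α β γ δ) a b c d
      = pull4 J T a b c d + pull4 J S a b c d := by
  simp only [pull4, mul_add, Finset.sum_add_distrib]

theorem pull4_sub (T S : Idx → Idx → Idx → Idx → ℝ) (a b c d : Idx) :
    pull4 J (fun α β γ δ => T α β γ δ - S α β γ δ) a b c d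
      = pull4 J T a b c d - pull4 J S a b c d := by
  simp only [pull4, mul_sub, Finset.sum_sub_distrib]

theorem pull4_mul_left (r : ℝ) (T : Idx → Idx → Idx → Idx → ℝ) (a b c d : Idx) :
    pull4 J (fun α β γ δ => r * T α β γ δ) a b c d = r * pull4 J T a b c d := by
  simp only [pull4_eq, pull3_eq, pull2_eq, pull1_mul_left]

theorem pull4_mul₁₂ (T S : Idx → Idx → ℝ) (a b c d : Idx) :
    pull4 J (fun α β γ δ => T α β * S γ δ) a b c d = pull2 J T a b * pull2 J S c d := by
  simp only [pull4_eq, pull3_eq, pull2_eq, pull1_mul_left, pull1_mul_right]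

end Pull4

section Frame

variable {U : Set Coord} {g : F2} {y : Coord} {A : Matrix Idx Idx ℝ}

theorem IsFrame.ginv_contr (hA : IsFrame (g y) A) (hg : LocMetric U g) (hy : y ∈ U)
    (u w : Idx → ℝ) : ∑ k, ∑ l, ginv g y k l * u k * w l
      = ∑ k, sgn k * pull1 A u k * pull1 A w k := by
  rw [(hA.rel hg hy).ginv_contr]
  have := sum_ginv_mink 0 fun a b => pull1 A u a * pull1 A w b
  simp only [← mul_assoc] at this
  exact this

theorem IsFrame.dcontr (hA : IsFrame (g y) A) (hg : LocMetric U g) (hy : y ∈ U)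
    (E T : Idx → Idx → ℝ) : SpinKY.dcontr g y E T
      = ∑ k, ∑ l, sgn k * sgn l * pull2 A E k l * pull2 A T k l := by
  rw [(hA.rel hg hy).dcontr, SpinKY.dcontr]
  simp only [ginv_mink, ite_mul, mul_ite, zero_mul, mul_zero, Finset.sum_ite_eq,
      Finset.mem_univ, if_true]

theorem IsFrame.metric (hA : IsFrame (g y) A) (hg : LocMetric U g) (hy : y ∈ U) (a b : Idx) :
    pull2 A (g y) a b = if a = b then sgn a else 0 := ((hA.rel hg hy).metric a b).symm

/-- The contraction of curvature with a 2-tensor in the Ricci identity. -/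
theorem IsFrame.pull4_riemann_contr (hA : IsFrame (g y) A) (hg : LocMetric U g) (hy : y ∈ U)
    (T : Idx → Idx → ℝ) (m n a b : Idx) :
    pull4 A (fun m n a b => ∑ l, riemannUp g y l m a b * T l n) m n a b
      = ∑ l, sgn l * pull4 A (riemann g y) l m a b * pull2 A T l n := by
  have e : ∀ m n a b, ∑ l, riemannUp g y l m a b * T l n
      = ∑ k, sgn k * pull1 A (fun l => riemann g y l m a b) k * pull1 A (fun l => T l n) k := by
    intro m n a b
    rw [← hA.ginv_contr hg hy, Finset.sum_comm]
    refine Finset.sum_congr rfl fun l _ => ?_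
    rw [hg.riemannUp_eq hy, Finset.sum_mul]
    exact Finset.sum_congr rfl fun k _ => by rw [(hA.rel hg hy).ginv_symm l k]
  simp only [e]
  simp only [pull4_eq, pull3_eq, pull2_eq, pull1_sum, pull1_mul_left, pull1_mul_right]
  refine Finset.sum_congr rfl fun k _ => ?_
  have e1 := pull4_eq_first A (riemann g y) k m a b
  simp only [pull4_eq, pull3_eq, pull2_eq] at e1
  rw [pull1_comm A (fun n l => T l n), e1]

/-- The Ricci identity for a 2-tensor in an orthonormal frame. -/
theorem IsFrame.ricci_identity (hA : IsFrame (g y) A) (hg : LocMetric U g) (hy : y ∈ U) {T : F2}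
    (hT : ∀ a b, Sm U fun z => T z a b) (a b c d : Idx) :
    pull4 A (cov3 g (cov2 g T) y) a b c d - pull4 A (cov3 g (cov2 g T) y) a b d c
      + ∑ l, sgn l * (pull4 A (riemann g y) l a d c * pull2 A (T y) l b
        + pull4 A (riemann g y) l b d c * pull2 A (T y) a l) = 0 := by
  have e : ∀ m n a b, cov3 g (cov2 g T) y m n a b = cov3 g (cov2 g T) y m n b a
      + (∑ l, riemannUp g y l m a b * T y l n + ∑ l, riemannUp g y l n a b * T y m l) := by
    intro m n a b
    have := hg.ricci_identity hy hT m n a b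
    rw [Finset.sum_add_distrib] at this
    linarith
  have e1 := hA.pull4_riemann_contr hg hy (T y) a b c d
  have e2 := hA.pull4_riemann_contr hg hy (fun i j => T y j i) b a c d
  rw [← pull4_swap₁₂ A (fun m n a b => ∑ l, riemannUp g y l m a b * T y n l)] at e2
  have e3 : pull4 A (cov3 g (cov2 g T) y) a b c d = pull4 A (cov3 g (cov2 g T) y) a b d c
      + (∑ l, sgn l * pull4 A (riemann g y) l a c d * pull2 A (T y) l b
      + ∑ l, sgn l * pull4 A (riemann g y) l b c d * pull2 A (fun i j => T y j i) l a) := by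
    rw [← e1, ← e2, ← pull4_add, ← pull4_swap₃₄ A _ a b c d, ← pull4_add]
    congr 1; funext i j k l; exact e i j k l
  have e4 : ∀ l i, pull4 A (riemann g y) l i d c = -pull4 A (riemann g y) l i c d := by
    intro l i
    rw [← pull4_swap₃₄]
    have : (fun α β γ δ => riemann g y α β δ γ) = fun α β γ δ => (-1) * riemann g y α β γ δ := by
      funext p q r s; rw [riemann_antisymm_right]; ring
    rw [this, pull4_mul_left]; ring
  rw [e3]
  simp only [e4, pull2_swap]
  rw [← Finset.sum_add_distrib]
  have : ∀ P Q X : ℝ, P = -Q → X + P - X + Q = 0 := by intros; linarith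
  apply this
  rw [← Finset.sum_neg_distrib]
  exact Finset.sum_congr rfl fun _ _ => by ring

theorem IsFrame.pull2_ricci (hA : IsFrame (g y) A) (hg : LocMetric U g) (hy : y ∈ U) (m n : Idx) :
    pull2 A (ricci g y) m n = ∑ k, sgn k * pull4 A (riemann g y) k m k n := by
  have e : ∀ m n, ricci g y m n
      = ∑ k, ∑ l, ginv mink 0 k l * pull2 A (fun k l => riemann g y k m l n) k l := by
    intro m n
    rw [hg.ricci_eq hy, ← (hA.rel hg hy).ginv_trace, Finset.sum_comm]
    exact Finset.sum_congr rfl fun _ _ => Finset.sum_congr rfl fun _ _ => by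
      rw [(hA.rel hg hy).ginv_symm]
  have e' : ricci g y = fun m n => ∑ k, sgn k * pull2 A (fun k l => riemann g y k m l n) k k := by
    funext m n; rw [e, sum_ginv_mink 0 (pull2 A fun k l => riemann g y k m l n)]
  rw [e', pull2_eq]
  simp only [pull1_sum, pull1_mul_left]
  refine Finset.sum_congr rfl fun k _ => ?_
  rw [← pull2_eq A (fun m n => pull2 A (fun k l => riemann g y k m l n) k k),
    ← pull4_eq' A (fun m n k l => riemann g y k m l n)]
  rw [pull4_swap₂₃ A (fun m k n l => riemann g y k m l n),
    pull4_swap₁₂ A (fun k m n l => riemann g y k m l n),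
    pull4_swap₃₄ A (fun k m l n => riemann g y k m l n)]

/-- The algebraic symmetries of the curvature tensor of a Ricci-flat metric, in an
orthonormal frame. -/
structure IsWeyl (R : Idx → Idx → Idx → Idx → ℝ) : Prop where
  left : ∀ a b c d, R a b c d = -R b a c d
  right : ∀ a b c d, R a b c d = -R a b d c
  pair : ∀ a b c d, R a b c d = R c d a b
  cyc : ∀ a b c d, R a b c d + R a c d b + R a d b c = 0
  trace : ∀ m n, ∑ k, sgn k * R k m k n = 0

theorem IsFrame.isWeyl (hA : IsFrame (g y) A) (hg : LocMetric U g) (hy : y ∈ U)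
    (hR : ∀ m n, ricci g y m n = 0) : IsWeyl (pull4 A (riemann g y)) where
  left a b c d := by
    rw [← pull4_swap₁₂ A (riemann g y) a b]
    have : (fun α β γ δ => riemann g y β α γ δ) = fun α β γ δ => (-1) * riemann g y α β γ δ := by
      funext p q r s; rw [hg.riemann_antisymm_left hy]; ring
    rw [this, pull4_mul_left]; ring
  right a b c d := by
    rw [← pull4_swap₃₄ A (riemann g y) a b c]
    have : (fun α β γ δ => riemann g y α β δ γ) = fun α β γ δ => (-1) * riemann g y α β γ δ := by
      funext p q r s; rw [riemann_antisymm_right]; ring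
    rw [this, pull4_mul_left]; ring
  pair a b c d := by
    rw [← pull4_pair]; congr 1; funext p q r s; rw [hg.riemann_pair hy]
  cyc a b c d := by
    have h : ∀ T : Idx → Idx → Idx → Idx → ℝ, ∀ a b c d, pull4 A T a c d b
        = pull4 A (fun α β γ δ => T α γ δ β) a b c d := by
      intro T a b c d
      rw [pull4_swap₂₃ A (fun α γ β δ => T α γ δ β), pull4_swap₃₄ A (fun α γ δ β => T α γ δ β)]
    rw [h (riemann g y) a c d b, h (fun α β γ δ => riemann g y α γ δ β) a b c d,
      h (riemann g y) a b c d, ← pull4_add, ← pull4_add]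
    have : (fun α β γ δ => riemann g y α β γ δ + riemann g y α γ δ β + riemann g y α δ β γ)
        = fun α β γ δ => (0 : ℝ) * 0 := by
      funext p q r s; rw [hg.riemann_bianchi hy]; ring
    rw [this]; simp [pull4]
  trace m n := by
    rw [← hA.pull2_ricci hg hy]; simp [pull2, hR]

/-- The dual acts here on the last pair of indices, while `star4` acts on the first; interchanging
the pairs reduces one to the other. -/
theorem IsFrame.pull2_kRiemStar (hA : IsFrame (g y) A) (hg : LocMetric U g) (hy : y ∈ U) (K : F2)
    (b c : Idx) : pull2 A (kRiemStar g K y) b c = ∑ l, ∑ r, sgn l * sgn r * pull2 A (K y) l r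
      * etaStar (fun i j => pull4 A (riemann g y) l b i j) c r := by
  have e : kRiemStar g K y = fun β γ => ∑ l, ∑ r, sgn l * sgn r * pull2 A (K y) l r
      * pull2 A (fun l r => riemannStar g y l β γ r) l r := by
    funext β γ; rw [← hA.dcontr hg hy]; rfl
  rw [e, pull2_eq]
  simp only [pull1_sum, pull1_mul_left]
  refine Finset.sum_congr rfl fun l _ => Finset.sum_congr rfl fun r _ => ?_
  congr 1
  rw [← pull2_eq A (fun β γ => pull2 A (fun l r => riemannStar g y l β γ r) l r),
    ← pull4_eq' A (fun β γ l r => riemannStar g y l β γ r),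
    pull4_swap₂₃ A (fun β l γ r => riemannStar g y l β γ r),
    pull4_swap₁₂ A (fun l β γ r => riemannStar g y l β γ r), ← pull4_pair]
  have h := (hA.rel hg hy).pull4_star4 (A := fun _ => pull4 A fun r s a b => riemann g y a b r s)
    (A' := fun z r s a b => riemann g z a b r s) (fun _ _ _ _ => rfl) c r l b
  rw [star4_mink] at h
  simp only [pull4_pair A (riemann g y)] at h
  exact h

end Frame

/-! ## The algebra of the integrability conditions -/

/-- The antisymmetric array with given entries `01, 02, 03, 12, 13, 23`. -/
def bivTab {V : Type*} [Zero V] [Neg V] (p q r s t u : V) : Idx → Idx → V :=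
  ![![0, p, q, r], ![-p, 0, s, t], ![-q, -s, 0, u], ![-r, -t, -u, 0]]

/-- The totally antisymmetric array with given entries `012, 013, 023, 123`. -/
def triTab {V : Type*} [Zero V] [Neg V] (p q r s : V) : Idx → Idx → Idx → V :=
  bivTab ![0, 0, p, q] ![0, -p, 0, r] ![0, -q, -r, 0] ![p, 0, 0, s] ![q, 0, -s, 0] ![r, s, 0, 0]

/-- Entries in a general torsion-free group are allowed so that tables can be nested: the entries
may themselves be functions of the remaining indices. -/
theorem eq_bivTab {V : Type*} [AddCommGroup V] [IsAddTorsionFree V] {F : Idx → Idx → V}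
    (h : ∀ a b, F a b = -F b a) :
    F = bivTab (F 0 1) (F 0 2) (F 0 3) (F 1 2) (F 1 3) (F 2 3) := by
  have h0 : ∀ a, F a a = 0 := fun a => self_eq_neg.1 (h a a)
  funext a b
  fin_cases a <;> fin_cases b <;> simp [bivTab, h0] <;> exact h _ _

theorem eq_triTab {V : Type*} [AddCommGroup V] [IsAddTorsionFree V] {F : Idx → Idx → Idx → V}
    (h1 : ∀ a b c, F a b c = -F b a c) (h2 : ∀ a b c, F a b c = -F a c b) :
    F = triTab (F 0 1 2) (F 0 1 3) (F 0 2 3) (F 1 2 3) := by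
  have h0' : ∀ a b, F a b b = 0 := fun a b => self_eq_neg.1 (h2 a b b)
  have h0'' : ∀ a b, F a b a = 0 := fun a b => by rw [h1, h0', neg_zero]
  have h3 : ∀ a b c, F a b c = F b c a := fun a b c => by rw [h1, h2, neg_neg]
  refine (eq_bivTab fun a b => funext fun c => h1 a b c).trans ?_
  rw [triTab]
  congr 1 <;> funext c <;> fin_cases c <;> simp [h0', h0''] <;>
    first | exact h2 _ _ _ | exact h3 _ _ _ | exact (h3 _ _ _).symm

/-- The Weyl tensor with electric part `e` and magnetic part `m`. -/
def weylTab (e₁₁ e₁₂ e₁₃ e₂₂ e₂₃ m₁₁ m₁₂ m₁₃ m₂₂ m₂₃ : ℝ) : Idx → Idx → Idx → Idx → ℝ :=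
  bivTab (bivTab e₁₁ e₁₂ e₁₃ m₁₃ (-m₁₂) m₁₁) (bivTab e₁₂ e₂₂ e₂₃ m₂₃ (-m₂₂) m₁₂)
    (bivTab e₁₃ e₂₃ (-e₁₁ - e₂₂) (-m₁₁ - m₂₂) (-m₂₃) m₁₃)
    (bivTab m₁₃ m₂₃ (-m₁₁ - m₂₂) (e₁₁ + e₂₂) e₂₃ (-e₁₃))
    (bivTab (-m₁₂) (-m₂₂) (-m₂₃) e₂₃ (-e₂₂) e₁₂) (bivTab m₁₁ m₁₂ m₁₃ (-e₁₃) e₁₂ (-e₁₁))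

/-- The vanishing Ricci tensor makes the electric part trace-free and determines the purely spatial
block by it; the cyclic identity makes the magnetic part trace-free. Two symmetric trace-free 3×3
matrices, ten numbers, remain. -/
theorem IsWeyl.eq_weylTab {R : Idx → Idx → Idx → Idx → ℝ} (hR : IsWeyl R) :
    R = weylTab (R 0 1 0 1) (R 0 1 0 2) (R 0 1 0 3) (R 0 2 0 2) (R 0 2 0 3)
      (R 0 1 2 3) (-R 0 1 1 3) (R 0 1 1 2) (-R 0 2 1 3) (R 0 2 1 2) := by
  have hb : ∀ a b, R a b = bivTab (R a b 0 1) (R a b 0 2) (R a b 0 3) (R a b 1 2) (R a b 1 3)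
      (R a b 2 3) := fun a b => eq_bivTab (hR.right a b)
  have t : ∀ m n, -R 0 m 0 n + R 1 m 1 n + R 2 m 2 n + R 3 m 3 n = 0 := by
    intro m n
    have := hR.trace m n
    simpa [Fin.sum_univ_four, sgn] using this
  have r0 : ∀ a b c, R a a b c = 0 := fun a b c => by linarith [hR.left a a b c]
  have r0' : ∀ a b c, R a b c c = 0 := fun a b c => by linarith [hR.right a b c c]
  have p := hR.pair
  have t00 := t 0 0
  have t11 := t 1 1
  have t22 := t 2 2
  have t33 := t 3 3
  have t01 := t 0 1
  have t02 := t 0 2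
  have t03 := t 0 3
  have t12 := t 1 2
  have t13 := t 1 3
  have t23 := t 2 3
  have c := hR.cyc 0 1 2 3
  simp only [r0, r0', hR.left 1 0, hR.left 2 0, hR.left 3 0, hR.left 2 1, hR.left 3 1, hR.left 3 2,
    hR.right _ _ 1 0, hR.right _ _ 2 0, hR.right _ _ 3 0, hR.right _ _ 2 1, hR.right _ _ 3 1,
    hR.right _ _ 3 2] at t00 t11 t22 t33 t01 t02 t03 t12 t13 t23 c
  refine (eq_bivTab fun a b => funext fun c => funext fun d => hR.left a b c d).trans ?_
  rw [weylTab]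
  congr 1 <;> refine (hb _ _).trans ?_ <;> congr 1 <;>
    try simp only [p 0 2 0 1, p 0 3 0 1, p 0 3 0 2, p 1 2 0 1, p 1 2 0 2, p 1 2 0 3, p 1 3 0 1,
      p 1 3 0 2, p 1 3 0 3, p 2 3 0 1, p 2 3 0 2, p 2 3 0 3, p 1 3 1 2, p 2 3 1 2, p 2 3 1 3]
  all_goals linarith

/-- The double contraction in an orthonormal frame. -/
def ctr (E T : Idx → Idx → ℝ) : ℝ := ∑ k, ∑ l, sgn k * sgn l * E k l * T k l

section Tables

variable {f012 f013 f023 f123 e₁₁ e₁₂ e₁₃ e₂₂ e₂₃ m₁₁ m₁₂ m₁₃ m₂₂ m₂₃ y01 y02 y03 y12 y13 y23 : ℝ}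
  {h012 h013 h023 h123 : Idx → ℝ} {Y : Idx → Idx → ℝ} {F : Idx → Idx → Idx → ℝ}
  {R H : Idx → Idx → Idx → Idx → ℝ}
  (hY : Y = bivTab y01 y02 y03 y12 y13 y23) (hF : F = triTab f012 f013 f023 f123)
  (hH : H = triTab h012 h013 h023 h123)
  (hR : R = weylTab e₁₁ e₁₂ e₁₃ e₂₂ e₂₃ m₁₁ m₁₂ m₁₃ m₂₂ m₂₃)
  (hc : ∀ a b c d, H a b c d - H a b d c
    + ∑ l, sgn l * (R l a d c * Y l b + R l b d c * Y a l) = 0)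
include hY hF hH hR hc

/-- `F` stands for ∇Y and `H` for ∇∇Y. Since `H` is totally antisymmetric in its first three
indices, the commutators in `hc` suffice to express the required combination of second derivatives
by the curvature. -/
theorem hess_kyScalar_1 : ctr Y (etaStar fun a b => H a b 1 0)
      + ctr (fun a b => F a b 0) (etaStar fun a b => F a b 1)
      + ctr (fun a b => F a b 1) (etaStar fun a b => F a b 0)
      + ctr (fun a b => H a b 1 0) (etaStar Y)
    = ∑ l, ∑ r, sgn l * sgn r * (∑ k, sgn k * Y l k * Y k r) * etaStar (R l 1) 0 r := by
  subst hY hF hH hR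
  simp only [Fin.sum_univ_four] at hc
  have c0102 := hc 0 1 0 2
  have c0103 := hc 0 1 0 3
  have c1203 := hc 1 2 0 3
  have c0201 := hc 0 2 0 1
  have c0301 := hc 0 3 0 1
  have c1201 := hc 1 2 0 1
  have c0112 := hc 0 1 1 2
  have c1301 := hc 1 3 0 1
  have c0113 := hc 0 1 1 3
  have c1302 := hc 1 3 0 2
  have c0101 := hc 0 1 0 1
  have c2301 := hc 2 3 0 1
  have c0312 := hc 0 3 1 2
  have c0213 := hc 0 2 1 3
  simp only [bivTab, triTab, weylTab, sgn, Matrix.cons_val, Pi.neg_apply, Pi.zero_apply] at c0102 c0103 c1203 c0201 c0301 c1201 c0112 c1301 c0113 c1302 c0101 c2301 c0312 c0213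
  simp only [ctr, Fin.sum_univ_four, etaStar, bivTab, triTab, weylTab, sgn, Matrix.cons_val,
    Pi.neg_apply, Pi.zero_apply]
  -- The coefficients are linear in Y because 𝒵 is quadratic. The terms quadratic in ∇Y need no
  -- hypothesis: they cancel identically in a time-space component.
  linear_combination 1 * y13 * c0102 - 1 * y12 * c0103 + 1 * y01 * c1203 - 3 * y13 * c0201 + 3 * y12 * c0301 + 1 * y03 * c1201 + 1 * y03 * c0112 - 1 * y02 * c1301 - 1 * y02 * c0113 - 1 * y01 * c1302 + 2 * y23 * c0101 + 2 * y01 * c2301 - 1 * y01 * c0312 + 1 * y01 * c0213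

theorem hess_kyScalar_2 : ctr Y (etaStar fun a b => H a b 2 0)
      + ctr (fun a b => F a b 0) (etaStar fun a b => F a b 2)
      + ctr (fun a b => F a b 2) (etaStar fun a b => F a b 0)
      + ctr (fun a b => H a b 2 0) (etaStar Y)
    = ∑ l, ∑ r, sgn l * sgn r * (∑ k, sgn k * Y l k * Y k r) * etaStar (R l 2) 0 r := by
  subst hY hF hH hR
  simp only [Fin.sum_univ_four] at hc
  have c0102 := hc 0 1 0 2
  have c0203 := hc 0 2 0 3
  have c1203 := hc 1 2 0 3
  have c0312 := hc 0 3 1 2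
  have c0123 := hc 0 1 2 3
  have c0201 := hc 0 2 0 1
  have c1301 := hc 1 3 0 1
  have c0113 := hc 0 1 1 3
  have c0202 := hc 0 2 0 2
  have c1202 := hc 1 2 0 2
  have c0212 := hc 0 2 1 2
  have c0302 := hc 0 3 0 2
  have c1302 := hc 1 3 0 2
  have c2301 := hc 2 3 0 1
  simp only [bivTab, triTab, weylTab, sgn, Matrix.cons_val, Pi.neg_apply, Pi.zero_apply] at c0102 c0203 c1203 c0312 c0123 c0201 c1301 c0113 c0202 c1202 c0212 c0302 c1302 c2301
  simp only [ctr, Fin.sum_univ_four, etaStar, bivTab, triTab, weylTab, sgn, Matrix.cons_val,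
    Pi.neg_apply, Pi.zero_apply]
  linear_combination 3 * y23 * c0102 - 1 * y12 * c0203 + 1 * y02 * c1203 - 1 * y02 * c0312 - 1 * y02 * c0123 - 1 * y23 * c0201 - 1 * y01 * c1301 - 1 * y01 * c0113 - 2 * y13 * c0202 + 1 * y03 * c1202 + 1 * y03 * c0212 + 3 * y12 * c0302 - 2 * y02 * c1302 + 1 * y02 * c2301

theorem hess_kyScalar_3 : ctr Y (etaStar fun a b => H a b 3 0)
      + ctr (fun a b => F a b 0) (etaStar fun a b => F a b 3)
      + ctr (fun a b => F a b 3) (etaStar fun a b => F a b 0)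
      + ctr (fun a b => H a b 3 0) (etaStar Y)
    = ∑ l, ∑ r, sgn l * sgn r * (∑ k, sgn k * Y l k * Y k r) * etaStar (R l 3) 0 r := by
  subst hY hF hH hR
  simp only [Fin.sum_univ_four] at hc
  have c0103 := hc 0 1 0 3
  have c0203 := hc 0 2 0 3
  have c1203 := hc 1 2 0 3
  have c0213 := hc 0 2 1 3
  have c0123 := hc 0 1 2 3
  have c0202 := hc 0 2 0 2
  have c1201 := hc 1 2 0 1
  have c0112 := hc 0 1 1 2
  have c0301 := hc 0 3 0 1
  have c1202 := hc 1 2 0 2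
  have c0212 := hc 0 2 1 2
  have c0101 := hc 0 1 0 1
  have c2301 := hc 2 3 0 1
  have c0302 := hc 0 3 0 2
  have c1302 := hc 1 3 0 2
  simp only [bivTab, triTab, weylTab, sgn, Matrix.cons_val, Pi.neg_apply, Pi.zero_apply] at c0103 c0203 c1203 c0213 c0123 c0202 c1201 c0112 c0301 c1202 c0212 c0101 c2301 c0302 c1302
  simp only [ctr, Fin.sum_univ_four, etaStar, bivTab, triTab, weylTab, sgn, Matrix.cons_val,
    Pi.neg_apply, Pi.zero_apply]
  linear_combination 3 * y23 * c0103 - 3 * y13 * c0203 + 2 * y03 * c1203 + 1 * y03 * c0213 - 1 * y03 * c0123 - 2 * y12 * c0202 + 1 * y01 * c1201 + 1 * y01 * c0112 - 1 * y23 * c0301 + 1 * y02 * c1202 + 1 * y02 * c0212 - 2 * y12 * c0101 + 1 * y03 * c2301 + 1 * y13 * c0302 - 1 * y03 * c1302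

end Tables

/-- The tables require the total antisymmetry that the Killing-Yano equation provides. Time-space
components suffice, since the constraints are tested on components i000, where the time-time
components cancel. -/
theorem hess_kyScalar_eq {Y : Idx → Idx → ℝ} {F : Idx → Idx → Idx → ℝ}
    {R H : Idx → Idx → Idx → Idx → ℝ} (hY : ∀ a b, Y a b = -Y b a)
    (hF₁ : ∀ a b c, F a b c = -F b a c) (hF₂ : ∀ a b c, F a b c = -F a c b)
    (hH₁ : ∀ a b c d, H a b c d = -H b a c d) (hH₂ : ∀ a b c d, H a b c d = -H a c b d)
    (hR : IsWeyl R) (hc : ∀ a b c d, H a b c d - H a b d c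
      + ∑ l, sgn l * (R l a d c * Y l b + R l b d c * Y a l) = 0) {i : Idx} (hi : i ≠ 0) :
    ctr Y (etaStar fun a b => H a b i 0) + ctr (fun a b => F a b 0) (etaStar fun a b => F a b i)
      + ctr (fun a b => F a b i) (etaStar fun a b => F a b 0)
      + ctr (fun a b => H a b i 0) (etaStar Y)
    = ∑ l, ∑ r, sgn l * sgn r * (∑ k, sgn k * Y l k * Y k r) * etaStar (R l i) 0 r := by
  have eY := eq_bivTab hY
  have eF := eq_triTab hF₁ hF₂
  have eH := eq_triTab (F := H) (fun a b c => funext fun d => hH₁ a b c d)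
    fun a b c => funext fun d => hH₂ a b c d
  have eR := hR.eq_weylTab
  fin_cases i
  · exact absurd rfl hi
  · exact hess_kyScalar_1 eY eF eH eR hc
  · exact hess_kyScalar_2 eY eF eH eR hc
  · exact hess_kyScalar_3 eY eF eH eR hc

/-- The integrability condition of the Killing equation of a symmetric 2-tensor. -/
theorem dual_curvature_eq {K : Idx → Idx → ℝ} {R H : Idx → Idx → Idx → Idx → ℝ}
    (hK : ∀ a b, K a b = K b a) (hH : ∀ a b c d, H a b c d = H b a c d)
    (hcyc : ∀ a b c d, H a b c d + H b c a d + H c a b d = 0)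
    (hR : IsWeyl R) (hc : ∀ a b c d, H a b c d - H a b d c
      + ∑ l, sgn l * (R l a d c * K l b + R l b d c * K a l) = 0) {i : Idx} (hi : i ≠ 0) :
    etaStar (fun j k => -(∑ l, sgn l * R l 0 j k * K l 0) + (1 / 3) * (H k 0 j 0 - H j 0 k 0)) i 0
      = (1 / 3) * ∑ l, ∑ r, sgn l * sgn r * K l r * etaStar (R l i) 0 r := by
  -- The cyclic identity in the first three indices is the differentiated Killing equation. With the
  -- commutators it expresses this antisymmetrized second derivative of K entirely by curvature, so
  -- the rest is algebra.
  have key : ∀ j k, H k 0 j 0 - H j 0 k 0 =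
      (1 / 2) * ∑ l, sgn l * (R l 0 j k * K l 0 + R l 0 j k * K 0 l)
      - ∑ l, sgn l * (R l k 0 j * K l 0 + R l 0 0 j * K k l)
      + ∑ l, sgn l * (R l j 0 k * K l 0 + R l 0 0 k * K j l) := by
    intro j k
    linear_combination hc k 0 j 0 - hc j 0 k 0 - (1 / 2) * hc 0 0 k j + (1 / 2) * hcyc 0 0 k j
      - (1 / 2) * hcyc 0 0 j k - (1 / 2) * hH 0 k 0 j + (1 / 2) * hH 0 j 0 k
  simp only [key]
  clear hc hcyc key hH
  rw [hR.eq_weylTab]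
  generalize R 0 1 0 1 = x1, R 0 1 0 2 = x2, R 0 1 0 3 = x3, R 0 2 0 2 = x4, R 0 2 0 3 = x5,
    R 0 1 2 3 = x6, -R 0 1 1 3 = x7, R 0 1 1 2 = x8, -R 0 2 1 3 = x9, R 0 2 1 2 = x10
  have k10 := hK 1 0
  have k20 := hK 2 0
  have k30 := hK 3 0
  have k21 := hK 2 1
  have k31 := hK 3 1
  have k32 := hK 3 2
  simp only [Fin.sum_univ_four, etaStar]
  fin_cases i
  · exact absurd rfl hi
  all_goals
    simp only [bivTab, weylTab, sgn, Matrix.cons_val, Fin.mk_one, Fin.reduceFinMk, Pi.neg_apply,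
      Pi.zero_apply, k10, k20, k30, k21, k31, k32]
    ring

/-! ## Integrability conditions in one chart -/

theorem cov3_swap₁₂ (g : F2) (T : F3) (y : Coord) (a b c d : Idx) :
    cov3 g (fun z a b c => T z b a c) y a b c d = cov3 g T y b a c d := by
  simp only [cov3, Fin.sum_univ_four]; ring

theorem cov3_swap₂₃ (g : F2) (T : F3) (y : Coord) (a b c d : Idx) :
    cov3 g (fun z a b c => T z a c b) y a b c d = cov3 g T y a c b d := by
  simp only [cov3, Fin.sum_univ_four]; ring

theorem cov3_cyc (g : F2) (T : F3) (y : Coord) (a b c d : Idx) :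
    cov3 g (fun z a b c => T z b c a) y a b c d = cov3 g T y b c a d := by
  simp only [cov3, Fin.sum_univ_four]; ring

theorem star4_add (g : F2) (y : Coord) (A B : F4) (a b c d : Idx) :
    star4 g (fun y a b c d => A y a b c d + B y a b c d) y a b c d
      = star4 g A y a b c d + star4 g B y a b c d := by
  simp only [star4, mul_add, Finset.sum_add_distrib]

theorem star4_cmul (g : F2) (y : Coord) (r : ℝ) (A : F4) (a b c d : Idx) :
    star4 g (fun y a b c d => r * A y a b c d) y a b c d = r * star4 g A y a b c d := by
  simp only [star4, mul_left_comm _ r, ← Finset.mul_sum]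

/-- The time-space components of a dual involve only spatial index pairs. -/
theorem etaStar_congr {T S : Idx → Idx → ℝ} (h : ∀ j k, j ≠ 0 → k ≠ 0 → T j k = S j k)
    {i : Idx} (hi : i ≠ 0) : etaStar T i 0 = etaStar S i 0 := by
  fin_cases i
  · exact absurd rfl hi
  all_goals
    simp [etaStar, h 1 2, h 2 1, h 1 3, h 3 1, h 2 3, h 3 2]

section Frame

variable {U : Set Coord} {g : F2} {y : Coord} {A : Matrix Idx Idx ℝ} (hA : IsFrame (g y) A)
  (hg : LocMetric U g) (hy : y ∈ U)
include hA hg hy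

theorem IsFrame.pull2_star2 (T : F2) (a b : Idx) :
    pull2 A (star2 g T y) a b = etaStar (pull2 A (T y)) a b := by
  rw [(hA.rel hg hy).pull2_star2 (A := fun _ => pull2 A (T y)) fun _ _ => rfl, star2_mink]

theorem IsFrame.pull3_star3 (T : F3) (a b c : Idx) :
    pull3 A (star3 g T y) a b c = etaStar (fun i j => pull3 A (T y) i j c) a b := by
  rw [(hA.rel hg hy).pull3_star3 (A := fun _ => pull3 A (T y)) fun _ _ _ => rfl, star3_mink]

theorem IsFrame.pull4_star4 (T : F4) (a b c d : Idx) :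
    pull4 A (star4 g T y) a b c d = etaStar (fun i j => pull4 A (T y) i j c d) a b := by
  rw [(hA.rel hg hy).pull4_star4 (A := fun _ => pull4 A (T y)) fun _ _ _ _ => rfl, star4_mink]

theorem IsFrame.pull2_kySquare (Y : F2) (a b : Idx) :
    pull2 A (kySquare g Y y) a b = ∑ k, sgn k * pull2 A (Y y) a k * pull2 A (Y y) k b := by
  rw [(hA.rel hg hy).pull2_kySquare (Y := fun _ => pull2 A (Y y)) fun _ _ => rfl, kySquare]
  simp only [ginv_mink, mul_ite, ite_mul, mul_zero, zero_mul, Finset.sum_ite_eq, Finset.mem_univ,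
    if_true]
  exact Finset.sum_congr rfl fun _ _ => by ring

theorem IsFrame.contr2 (T S : F2) :
    SpinKY.contr2 g T S y = ctr (pull2 A (S y)) (pull2 A (T y)) := by
  rw [contr2_eq, hA.dcontr hg hy]; rfl

theorem IsFrame.pull2_contr2_left (T : F4) (S : F2) (c d : Idx) :
    pull2 A (fun c d => SpinKY.contr2 g (fun z i j => T z i j c d) S y) c d
      = ctr (pull2 A (S y)) (fun a b => pull4 A (T y) a b c d) := by
  simp only [hA.contr2 hg hy, ctr]
  rw [pull2_eq]
  simp only [pull1_sum, pull1_mul_left]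
  refine Finset.sum_congr rfl fun k _ => Finset.sum_congr rfl fun l _ => ?_
  rw [← pull4_pair, pull4_eq', pull2_eq A fun c d => pull2 A (fun a b => T y a b c d) k l]

theorem IsFrame.pull2_contr2_right (T : F2) (S : F4) (c d : Idx) :
    pull2 A (fun c d => SpinKY.contr2 g T (fun z i j => S z i j c d) y) c d
      = ctr (fun a b => pull4 A (S y) a b c d) (pull2 A (T y)) := by
  simp only [hA.contr2 hg hy, ctr]
  rw [pull2_eq]
  simp only [pull1_sum, pull1_mul_left, pull1_mul_right]
  refine Finset.sum_congr rfl fun k _ => Finset.sum_congr rfl fun l _ => ?_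
  rw [← pull4_pair, pull4_eq', pull2_eq A fun c d => pull2 A (fun a b => S y a b c d) k l]

theorem IsFrame.pull2_contr2_both (T S : F3) (c d : Idx) :
    pull2 A (fun c d => SpinKY.contr2 g (fun z i j => T z i j c) (fun z i j => S z i j d) y) c d
      = ctr (fun a b => pull3 A (S y) a b d) (fun a b => pull3 A (T y) a b c) := by
  simp only [hA.contr2 hg hy, ctr]
  rw [pull2_eq]
  simp only [pull1_sum, pull1_mul_left, pull1_mul_right]
  refine Finset.sum_congr rfl fun k _ => Finset.sum_congr rfl fun l _ => ?_
  rw [pull3_eq_last, pull3_eq_last]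

theorem IsFrame.pull2_hess_kyScalar {Y : F2} (hY : ∀ a b, Sm U fun z => Y z a b) (c d : Idx) :
    4 * pull2 A (cov1 g (grad (kyScalar g Y)) y) c d =
      ctr (pull2 A (Y y)) (etaStar fun a b => pull4 A (cov3 g (cov2 g Y) y) a b c d)
      + ctr (fun a b => pull3 A (cov2 g Y y) a b d) (etaStar fun a b => pull3 A (cov2 g Y y) a b c)
      + ctr (fun a b => pull3 A (cov2 g Y y) a b c) (etaStar fun a b => pull3 A (cov2 g Y y) a b d)
      + ctr (fun a b => pull4 A (cov3 g (cov2 g Y) y) a b c d) (etaStar (pull2 A (Y y))) := by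
  have e : cov1 g (grad (kyScalar g Y)) y = fun c d => _ :=
    funext fun c => funext fun d => hg.cov1_grad_kyScalar hy hY c d
  rw [e, pull2_eq]
  simp only [pull1_mul_left, pull1_add]
  have h1 := hA.pull2_contr2_left hg hy (star4 g (cov3 g (cov2 g Y))) Y c d
  have h2 := hA.pull2_contr2_both hg hy (star3 g (cov2 g Y)) (cov2 g Y) c d
  have h3 := hA.pull2_contr2_both hg hy (star3 g (cov2 g Y)) (cov2 g Y) d c
  have h4 := hA.pull2_contr2_right hg hy (star2 g Y) (cov3 g (cov2 g Y)) c d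
  rw [← pull2_swap] at h3
  simp only [pull2_eq A (fun _ _ => SpinKY.contr2 _ _ _ _)] at h1 h2 h3 h4
  rw [h1, h2, h3, h4]
  simp only [hA.pull4_star4 hg hy, hA.pull3_star3 hg hy,
    funext fun a => funext fun b => hA.pull2_star2 hg hy Y a b]
  ring

end Frame

/-! ### The Hessian of 𝒵 and the dual curvature -/

section KY

variable {U : Set Coord} {g Y : F2} {y : Coord} {A : Matrix Idx Idx ℝ} (hA : IsFrame (g y) A)
  (hg : LocMetric U g) (hy : y ∈ U) (hR : ∀ m n, ricci g y m n = 0) (hY : LocKY U g Y)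

theorem cov3_eq_neg (hU : IsOpen U) (hy : y ∈ U) {T S : F3}
    (h : ∀ z ∈ U, ∀ a b c, T z a b c = -S z a b c) (a b c d : Idx) :
    cov3 g T y a b c d = -cov3 g S y a b c d := by
  rw [cov3_congr hU hy h]
  simp only [cov3, pd_neg, Fin.sum_univ_four]; ring

include hA hg hy hR hY

/-- The total antisymmetry of ∇Y holds on all of `U`, so it may be differentiated: ∇∇Y is
antisymmetric in its first three indices. With the Ricci identity this puts the frame components in
the scope of `hess_kyScalar_eq`. -/
theorem LocKY.hess_kyScalar {i : Idx} (hi : i ≠ 0) :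
    4 * pull2 A (cov1 g (grad (kyScalar g Y)) y) i 0
      = pull2 A (kRiemStar g (kySquare g Y) y) i 0 := by
  have n2 : ∀ {T S : Idx → Idx → ℝ}, (∀ a b, T a b = -S a b) → ∀ a b,
      pull2 A T a b = -pull2 A S a b := by
    intro T S h a b
    simp only [pull2_eq, h, pull1_neg]
  have n3 : ∀ {T S : Idx → Idx → Idx → ℝ}, (∀ a b c, T a b c = -S a b c) → ∀ a b c,
      pull3 A T a b c = -pull3 A S a b c := by
    intro T S h a b c
    simp only [pull3_eq, pull2_eq, h, pull1_neg]
  have n4 : ∀ {T S : Idx → Idx → Idx → Idx → ℝ}, (∀ a b c d, T a b c d = -S a b c d) → ∀ a b c d,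
      pull4 A T a b c d = -pull4 A S a b c d := by
    intro T S h a b c d
    simp only [pull4_eq, pull3_eq, pull2_eq, h, pull1_neg]
  have d1 : ∀ z ∈ U, ∀ a b c, cov2 g Y z a b c = -cov2 g Y z b a c :=
    fun z hz => hY.cov2_antisymm hg hz
  have d2 : ∀ z ∈ U, ∀ a b c, cov2 g Y z a b c = -cov2 g Y z a c b := by
    intro z hz a b c
    rw [hY.cov2_cyc hg hz, hY.cov2_antisymm hg hz, hY.cov2_cyc hg hz, hY.cov2_cyc hg hz]
  rw [hA.pull2_hess_kyScalar hg hy hY.smooth, hA.pull2_kRiemStar hg hy]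
  simp only [hA.pull2_kySquare hg hy]
  refine hess_kyScalar_eq ?_ ?_ ?_ ?_ ?_ (hA.isWeyl hg hy hR)
    (hA.ricci_identity hg hy hY.smooth) hi
  · intro a b; rw [← pull2_swap A _ a b]; exact n2 (fun a b => hY.antisymm y hy a b) a b
  · intro a b c; rw [← pull3_swap₁₂ A _ a b c]; exact n3 (fun a b c => d1 y hy a b c) a b c
  · intro a b c; rw [← pull3_swap₂₃ A _ a b c]; exact n3 (fun a b c => d2 y hy a b c) a b c
  · intro a b c d
    rw [← pull4_swap₁₂ A _ a b c d]
    refine n4 (fun a b c d => ?_) a b c d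
    have := cov3_eq_neg (g := g) (T := cov2 g Y) (S := fun z a b c => cov2 g Y z b a c) hg.isOpen hy
      d1 a b c d
    exact this.trans (congrArg _ (cov3_swap₁₂ g (cov2 g Y) y a b c d))
  · intro a b c d
    rw [← pull4_swap₂₃ A _ a b c d]
    refine n4 (fun a b c d => ?_) a b c d
    have := cov3_eq_neg (g := g) (T := cov2 g Y) (S := fun z a b c => cov2 g Y z a c b) hg.isOpen hy
      d2 a b c d
    exact this.trans (congrArg _ (cov3_swap₂₃ g (cov2 g Y) y a b c d))

end KY

/-! ## Equivalence of the forms of the constraint -/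

theorem sym3_congr {F G : Idx → Idx → Idx → ℝ} (h : ∀ b c d, F b c d = G b c d) (b c d : Idx) :
    sym3 F b c d = sym3 G b c d := by
  simp only [sym3, h]

section Symmetrized

variable {U : Set Coord} {g : F2} {y : Coord}

/-- The covariant derivative commutes with permutations of the tensor indices, and full
symmetrization absorbs the partial one. -/
theorem sym3_cov3_symLast (hU : IsOpen U) (hy : y ∈ U) {T : F3}
    (hT : ∀ a b c, Sm U fun z => T z a b c) (a b c d : Idx) :
    sym3 (fun b c d => cov3 g T y a b c d) b c d
      = sym3 (fun b c d => cov3 g (symLast T) y a b c d) b c d := by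
  have h : ∀ b c d, cov3 g (symLast T) y a b c d
      = (1 / 2) * (cov3 g T y a b c d + cov3 g T y a c b d) := by
    intro b c d
    have d1 := fun a b c => (hT a b c).diff hU hy
    have e : symLast T = fun z i j k => (1 / 2) * (T z i j k + T z i k j) := rfl
    rw [e, cov3_cmul (1 / 2) (A := fun z i j k => T z i j k + T z i k j)
      (fun a b c => (d1 a b c).add (d1 a c b)),
      cov3_add d1 (B := fun z i j k => T z i k j) (fun a b c => d1 a c b), cov3_swap₂₃ g T y a b c d]
  simp only [sym3, h]; ring

/-- Only the part symmetric in the last two indices enters the constraint. The agreement is required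
on all of `U` because a derivative is taken. -/
theorem sym3_cov3_congr (hU : IsOpen U) (hy : y ∈ U) {T S : F3}
    (hT : ∀ a b c, Sm U fun z => T z a b c) (hS : ∀ a b c, Sm U fun z => S z a b c)
    (h : ∀ z ∈ U, ∀ a b c, symLast T z a b c = symLast S z a b c) (a b c d : Idx) :
    sym3 (fun b c d => cov3 g T y a b c d) b c d
      = sym3 (fun b c d => cov3 g S y a b c d) b c d := by
  rw [sym3_cov3_symLast hU hy hT, sym3_cov3_symLast hU hy hS]
  exact sym3_congr (fun b c d => cov3_congr hU hy h a b c d) b c d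

theorem LocMetric.smooth_wedge (hg : LocMetric U g) {v : F1} (hv : ∀ a, Sm U fun z => v z a)
    (a b c : Idx) : Sm U fun z => wedge g v z a b c :=
  ((hv a).mul (hg.smooth b c)).sub ((hv b).mul (hg.smooth a c))

theorem LocMetric.smooth_lamT (hg : LocMetric U g) {K : F2} (hK : ∀ a b, Sm U fun z => K z a b)
    (a b c : Idx) : Sm U fun z => lamT g K z a b c :=
  (hg.smooth_cov2 hK b c a).sub (hg.smooth_cov2 hK a c b)

/-- Since ∇g = 0, a product with the metric contributes just the derivative of the vector. This
produces the vector terms of the constraints. -/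
theorem LocMetric.sym3_cov3_add_wedge (hg : LocMetric U g) (hy : y ∈ U) {T : F3} {v : F1}
    (hT : ∀ a b c, Sm U fun z => T z a b c) (hv : ∀ a, Sm U fun z => v z a) (a b c d : Idx) :
    sym3 (fun b c d => cov3 g (fun z a b c => T z a b c + wedge g v z a b c) y a b c d) b c d
      = sym3 (fun b c d => cov3 g T y a b c d + cov1 g v y a b * g y c d
        - g y a b * cov1 g v y c d) b c d := by
  have h : ∀ b c d, cov3 g (fun z a b c => T z a b c + wedge g v z a b c) y a b c d
      = cov3 g T y a b c d + (cov1 g v y a d * g y b c - cov1 g v y b d * g y a c) := by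
    intro b c d
    rw [cov3_add (fun a b c => (hT a b c).diff hg.isOpen hy)
      (fun a b c => (hg.smooth_wedge hv a b c).diff hg.isOpen hy), hg.cov3_wedge hy hv]
  simp only [sym3, h]
  rw [hg.symm y hy d c, hg.symm y hy c b, hg.symm y hy d b]
  ring

end Symmetrized

/-- The curvature terms of `vTensor`. -/
def curvTerm (g K : F2) : F4 := fun y a b c d =>
  -(∑ l, riemannUp g y l d a b * K y l c)
    + (1 / 3) * (kRiem g K y d a * g y b c - kRiem g K y d b * g y a c)

/-! ### The Killing equation of K and its integrability condition -/

section KY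

variable {U : Set Coord} {g Y : F2} {y : Coord} (hY : LocKY U g Y) (hg : LocMetric U g)
  (hy : y ∈ U)
include hY hg hy

theorem LocKY.kySquare_symm (a b : Idx) : kySquare g Y y a b = kySquare g Y y b a := by
  simp only [kySquare]
  rw [Finset.sum_comm]
  refine Finset.sum_congr rfl fun k _ => Finset.sum_congr rfl fun l _ => ?_
  rw [hg.ginv_symm hy l k, hY.antisymm y hy a l, hY.antisymm y hy k b]; ring

/-- By the product rule each summand is a sum of two contractions `P` of ∇Y with Y. Total
antisymmetry of ∇Y makes `P` antisymmetric in its first two arguments, and the six terms cancel in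
pairs. -/
theorem LocKY.cov2_kySquare_cyc (a b c : Idx) : cov2 g (kySquare g Y) y a b c
    + cov2 g (kySquare g Y) y b c a + cov2 g (kySquare g Y) y c a b = 0 := by
  have d1 := hY.cov2_antisymm hg hy
  have d2 := hY.cov2_cyc hg hy
  set P : Idx → Idx → Idx → ℝ := fun a c b => ∑ k, ∑ l, ginv g y k l * cov2 g Y y a k c * Y y l b
    with hP
  have h1 : ∀ a b c, P a c b = -P c a b := by
    intro a b c
    simp only [hP, ← Finset.sum_neg_distrib]
    refine Finset.sum_congr rfl fun k _ => Finset.sum_congr rfl fun l _ => ?_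
    rw [d2 a k c, d1 k c a]; ring
  have h2 : ∀ a b c, cov2 g (kySquare g Y) y a b c = P a c b + P b c a := by
    intro a b c
    rw [hY.cov2_eq_kyCov hg hy, kyCov]
    simp only [Finset.sum_add_distrib]
    congr 1
    · exact Finset.sum_congr rfl fun _ _ => Finset.sum_congr rfl fun _ _ => by ring
    · rw [Finset.sum_comm]
      refine Finset.sum_congr rfl fun k _ => Finset.sum_congr rfl fun l _ => ?_
      rw [hg.ginv_symm hy l k, hY.antisymm y hy a l, d1 k b c]; ring
  rw [h2, h2, h2, h1 a b c, h1 b a c, h1 b c a]; ring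

theorem LocKY.cov2_kySquare_symm (a b c : Idx) :
    cov2 g (kySquare g Y) y a b c = cov2 g (kySquare g Y) y b a c := by
  have h := pd_congr hg.isOpen hy (fun z hz => hY.kySquare_symm hg hz a b) c
  simp only [cov2]
  rw [h]
  simp only [fun l => hY.kySquare_symm hg hy l b, fun l => hY.kySquare_symm hg hy a l,
    Fin.sum_univ_four]
  ring

theorem LocKY.cov3_cov2_kySquare_cyc (a b c d : Idx) : cov3 g (cov2 g (kySquare g Y)) y a b c d
    + cov3 g (cov2 g (kySquare g Y)) y b c a d + cov3 g (cov2 g (kySquare g Y)) y c a b d = 0 := by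
  have sm := hg.smooth_cov2 (hg.smooth_kySquare hY.smooth)
  have d1 := fun a b c => (sm a b c).diff hg.isOpen hy
  have e : ∀ T : F3, cov3 g (fun z a b c => T z c a b) y a b c d = cov3 g T y c a b d := by
    intro T; simp only [cov3, Fin.sum_univ_four]; ring
  rw [← cov3_cyc g _ y a b c d, ← e]
  rw [← cov3_add d1 (fun a b c => d1 b c a), ← cov3_add
    (A := fun z i j k => cov2 g (kySquare g Y) z i j k + cov2 g (kySquare g Y) z j k i)
    (fun a b c => (d1 a b c).add (d1 b c a))
    (fun a b c => d1 c a b), cov3_congr hg.isOpen hy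
    (B := fun _ _ _ _ => 0) (fun z hz a b c => hY.cov2_kySquare_cyc hg hz a b c)]
  simp [cov3, pd_const]

variable {A : Matrix Idx Idx ℝ} (hA : IsFrame (g y) A) (hR : ∀ m n, ricci g y m n = 0)
include hA hR

theorem LocKY.dual_curvature {i : Idx} (hi : i ≠ 0) :
    etaStar (fun j k => -(∑ l, sgn l * pull4 A (riemann g y) l 0 j k
        * pull2 A (kySquare g Y y) l 0)
      + (1 / 3) * (pull4 A (cov3 g (cov2 g (kySquare g Y)) y) k 0 j 0
        - pull4 A (cov3 g (cov2 g (kySquare g Y)) y) j 0 k 0)) i 0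
    = (1 / 3) * pull2 A (kRiemStar g (kySquare g Y) y) i 0 := by
  have sm := hg.smooth_kySquare hY.smooth
  rw [hA.pull2_kRiemStar hg hy]
  refine dual_curvature_eq ?_ ?_ ?_ (hA.isWeyl hg hy hR) (hA.ricci_identity hg hy sm) hi
  · intro a b
    rw [← pull2_swap]; congr 1; funext a b; exact (hY.kySquare_symm hg hy a b).symm
  · intro a b c d
    rw [← pull4_swap₁₂]; congr 1; funext a b c d
    exact ((cov3_congr (B := fun z a b c => cov2 g (kySquare g Y) z b a c) hg.isOpen hy
      (fun z hz => hY.cov2_kySquare_symm hg hz) a b c d).trans (cov3_swap₁₂ g _ y a b c d)).symm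
  · intro a b c d
    have h : ∀ (T : Idx → Idx → Idx → Idx → ℝ) a b c, pull4 A T b c a d
        = pull4 A (fun α β γ δ => T β γ α δ) a b c d := by
      intro T a b c
      rw [pull4_swap₁₂ A (fun β α γ δ => T β γ α δ), pull4_swap₂₃ A (fun β γ α δ => T β γ α δ)]
    have h' : ∀ (T : Idx → Idx → Idx → Idx → ℝ) a b c, pull4 A T c a b d
        = pull4 A (fun α β γ δ => T γ α β δ) a b c d := by
      intro T a b c
      rw [pull4_swap₂₃ A (fun α γ β δ => T γ α β δ), pull4_swap₁₂ A (fun γ α β δ => T γ α β δ)]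
    rw [h _ a b c, h' _ a b c, ← pull4_add, ← pull4_add]
    simp only [hY.cov3_cov2_kySquare_cyc hg hy]
    simp [pull4]

end KY

section Constraints

variable {U : Set Coord} {g Y : F2} {L : F3} {y : Coord} (hY : LocKY U g Y) (hg : LocMetric U g)
  (hy : y ∈ U) (hR : ∀ m n, ricci g y m n = 0) (hL : ∀ a b c, Sm U fun z => L z a b c)
  (hLa : ∀ z ∈ U, ∀ a b c, L z a b c = -L z b a c)

/-- With `j` and `k` spatial and the third index along the time axis, the metric components in the
trace terms vanish, and only the Riemann term is left. -/
theorem pull4_curvTerm {A : Matrix Idx Idx ℝ} (hA : IsFrame (g y) A) (hg : LocMetric U g)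
    (hy : y ∈ U) (K : F2) (j k : Idx) (hj : j ≠ 0) (hk : k ≠ 0) :
    pull4 A (curvTerm g K y) j k 0 0
      = -∑ l, sgn l * pull4 A (riemann g y) l 0 j k * pull2 A (K y) l 0 := by
  have e : curvTerm g K y = fun a b c d => (-1) * (∑ l, riemannUp g y l d a b * K y l c)
      + ((1 / 3) * (kRiem g K y d a * g y b c) - (1 / 3) * (kRiem g K y d b * g y a c)) := by
    funext a b c d; rw [curvTerm]; ring
  have m1 : ∀ j k, k ≠ 0 →
      pull4 A (fun a b c d => kRiem g K y d a * g y b c) j k 0 0 = 0 := by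
    intro j k hk
    rw [pull4_swap₃₄ A (fun a b d c => kRiem g K y d a * g y b c),
      pull4_swap₂₃ A (fun a d b c => kRiem g K y d a * g y b c),
      pull4_mul₁₂ A (fun a d => kRiem g K y d a), hA.metric hg hy, if_neg hk, mul_zero]
  have m2 : pull4 A (fun a b c d => kRiem g K y d b * g y a c) j k 0 0 = 0 := by
    rw [pull4_swap₁₂ A (fun b a c d => kRiem g K y d b * g y a c), m1 k j hj]
  rw [e, pull4_add, pull4_sub, pull4_mul_left, pull4_mul_left, pull4_mul_left, m1 j k hk, m2]
  have := hA.pull4_riemann_contr hg hy (K y) 0 0 j k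
  rw [← this, pull4_swap₃₄ A (fun a b d c => ∑ l, riemannUp g y l d a b * K y l c),
    pull4_pair A (fun d c a b => ∑ l, riemannUp g y l d a b * K y l c)]
  ring

/-- This is the whole difference between the constraints for L and for X: after the derivative of *L
cancels, only curvature and the derivatives of λ remain, and `LocKY.dual_curvature` relates them. -/
theorem LocKY.sym3_curvature (hY : LocKY U g Y) (hg : LocMetric U g) (hy : y ∈ U)
    (hR : ∀ m n, ricci g y m n = 0) (a b c d : Idx) :
    sym3 (fun b c d => star4 g (fun z a b c d => curvTerm g (kySquare g Y) z a b c d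
        + (1 / 3) * cov3 g (lamT g (kySquare g Y)) z a b c d) y a b c d
      - (1 / 3) * (g y a b * kRiemStar g (kySquare g Y) y c d
        - kRiemStar g (kySquare g Y) y a b * g y c d)) b c d = 0 := by
  refine hg.sym3_eq_zero hy (T := fun a b c d => star4 g (fun z a b c d =>
      curvTerm g (kySquare g Y) z a b c d
        + (1 / 3) * cov3 g (lamT g (kySquare g Y)) z a b c d) y a b c d
      - (1 / 3) * (g y a b * kRiemStar g (kySquare g Y) y c d
        - kRiemStar g (kySquare g Y) y a b * g y c d)) (fun A hA i => ?_) a b c d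
  set K := kySquare g Y
  rw [pull4_sub, pull4_mul_left, pull4_sub, pull4_mul₁₂, pull4_mul₁₂, hA.metric hg hy,
    hA.metric hg hy]
  rw [hA.pull4_star4 hg hy (fun z a b c d => curvTerm g K z a b c d
        + (1 / 3) * cov3 g (lamT g K) z a b c d)]
  -- For i = 0 the dual vanishes by antisymmetry and the two metric terms cancel; the content is in
  -- the spatial components.
  by_cases hi : i = 0
  · subst hi
    simp [etaStar]; ring
  have sm := hg.smooth_cov2 (hg.smooth_kySquare hY.smooth)
  have d1 := fun a b c => (sm a b c).diff hg.isOpen hy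
  have hl : cov3 g (lamT g K) y = fun a b c d => cov3 g (cov2 g K) y b c a d
      + (-1) * cov3 g (cov2 g K) y a c b d := by
    funext a b c d
    have e : lamT g K = fun z i j k => cov2 g K z j k i + (-1) * cov2 g K z i k j := by
      funext z i j k; rw [lamT]; ring
    rw [e, cov3_add (B := fun z i j k => (-1) * cov2 g K z i k j) (fun a b c => d1 b c a)
      (fun a b c => (d1 a c b).const_mul (-1)), cov3_cmul (-1) (A := fun z i j k => cov2 g K z i k j)
      (fun a b c => d1 a c b), cov3_cyc, cov3_swap₂₃ g (cov2 g K) y a b c d]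
  have h1 := hY.dual_curvature hg hy hA hR hi
  rw [etaStar_congr (S := fun j k => -(∑ l, sgn l * pull4 A (riemann g y) l 0 j k
        * pull2 A (K y) l 0)
      + (1 / 3) * (pull4 A (cov3 g (cov2 g K) y) k 0 j 0
        - pull4 A (cov3 g (cov2 g K) y) j 0 k 0)) ?_ hi, h1, if_neg hi, if_pos rfl]
  · simp [sgn, K]
  · intro j k hj hk
    rw [pull4_add, pull4_mul_left, pull4_curvTerm hA hg hy K j k hj hk, hl, pull4_add,
      pull4_mul_left, pull4_swap₂₃ A (fun a c b d => cov3 g (cov2 g K) y a c b d),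
      pull4_swap₁₂ A (fun b a c d => cov3 g (cov2 g K) y b c a d),
      pull4_swap₂₃ A (fun b c a d => cov3 g (cov2 g K) y b c a d)]
    ring

include hY hg hy hL hLa

/-- The vector terms are absorbed into the derivative of *X plus a product with the metric, whose
symmetric part is that of *L - ⅓ *λ; the dual is then exchanged with the derivative. -/
theorem LocKY.constraintX_eq
    (hX : ∀ a b c, Sm U fun z => star3 g (xHook g (kySquare g Y) L) z a b c)
    (hv : ∀ a, Sm U fun z => xVec g (kySquare g Y) L z a) (a b c d : Idx) :
    constraintX g (kySquare g Y) L y a b c d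
      = sym3 (fun b c d => cov3 g (star3 g L) y a b c d
        - (1 / 3) * star4 g (cov3 g (lamT g (kySquare g Y))) y a b c d
        + (1 / 3) * (g y a b * kRiemStar g (kySquare g Y) y c d
          - kRiemStar g (kySquare g Y) y a b * g y c d)) b c d := by
  set K := kySquare g Y
  have sK := hg.smooth_kySquare hY.smooth
  have sl := hg.smooth_star3 (hg.smooth_lamT sK)
  have sL := hg.smooth_star3 hL
  have h1 := hg.sym3_cov3_add_wedge hy hX hv a b c d
  have h2 := sym3_cov3_congr (g := g) hg.isOpen hy
    (T := fun z a b c => star3 g (xHook g K L) z a b c + wedge g (xVec g K L) z a b c)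
    (S := fun z a b c => star3 g L z a b c + (-(1 / 3)) * star3 g (lamT g K) z a b c)
    (fun a b c => (hX a b c).add (hg.smooth_wedge hv a b c))
    (fun a b c => (sL a b c).add ((sl a b c).cmul _))
    (fun z hz a b c => by
      rw [hg.symLast_star3_xHook hz (hLa z hz)]; simp only [symLast]; ring) a b c d
  have h3 : ∀ b c d, cov3 g (fun z a b c => star3 g L z a b c
      + (-(1 / 3)) * star3 g (lamT g K) z a b c) y a b c d
      = cov3 g (star3 g L) y a b c d - (1 / 3) * star4 g (cov3 g (lamT g K)) y a b c d := by
    intro b c d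
    rw [cov3_add (fun a b c => (sL a b c).diff hg.isOpen hy)
      (B := fun z a b c => (-(1 / 3)) * star3 g (lamT g K) z a b c)
      (fun a b c => ((sl a b c).cmul _).diff hg.isOpen hy),
      cov3_cmul _ (fun a b c => (sl a b c).diff hg.isOpen hy),
      hg.cov3_star3 hy (hg.smooth_lamT sK)]
    ring
  simp only [h3] at h2
  rw [h1] at h2
  simp only [constraintX, sym3] at h2 ⊢
  linear_combination h2

include hR

theorem LocKY.constraintX_eq_constraintV
    (hX : ∀ a b c, Sm U fun z => star3 g (xHook g (kySquare g Y) L) z a b c)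
    (hv : ∀ a, Sm U fun z => xVec g (kySquare g Y) L z a) (a b c d : Idx) :
    constraintX g (kySquare g Y) L y a b c d = constraintV g (kySquare g Y) L y a b c d := by
  rw [hY.constraintX_eq hg hy hL hLa hX hv]
  have h := hY.sym3_curvature hg hy hR a b c d
  have hV : vTensor g (kySquare g Y) L = fun z a b c d => cov3 g L z a b c d
      + curvTerm g (kySquare g Y) z a b c d := by
    funext z a b c d; simp only [vTensor, curvTerm, mul_comm (kySquare g Y z _ _)]; ring
  simp only [constraintV, hV, star4_add, star4_cmul, ← hg.cov3_star3 hy hL] at h ⊢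
  simp only [sym3] at h ⊢
  linear_combination -h

omit hL hLa in
-- The difference is built from 4 ∇∇𝒵 - K·R*, whose time-space components vanish in every frame. Its
-- time-time component occurs twice with opposite signs, so `LocMetric.sym3_eq_zero` applies.
theorem LocKY.constraintX_eq_constraintKY
    (hv : ∀ a, Sm U fun z => xVec g (kySquare g Y) L z a) (a b c d : Idx) :
    constraintX g (kySquare g Y) L y a b c d = constraintKY g Y L y a b c d := by
  set K := kySquare g Y
  have hz : ∀ a, Sm U fun z => grad (kyScalar g Y) z a :=
    fun a => Sm.pd hg.isOpen (hg.smooth_kyScalar hY.smooth) a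
  have h : sym3 (fun b c d => (4 * cov1 g (grad (kyScalar g Y)) y a b - kRiemStar g K y a b)
      * g y c d - g y a b * (4 * cov1 g (grad (kyScalar g Y)) y c d - kRiemStar g K y c d))
      b c d = 0 := by
    set Q : Idx → Idx → ℝ := fun a b =>
      4 * cov1 g (grad (kyScalar g Y)) y a b - kRiemStar g K y a b
    refine hg.sym3_eq_zero hy (T := fun a b c d => Q a b * g y c d - g y a b * Q c d)
      (fun A hA i => ?_) a b c d
    rw [pull4_sub, pull4_mul₁₂, pull4_mul₁₂, hA.metric hg hy, hA.metric hg hy]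
    by_cases hi : i = 0
    · subst hi; ring
    have : pull2 A Q i 0 = 0 := by
      have e := hY.hess_kyScalar hA hg hy hR hi
      simp only [Q, pull2_eq, pull1_sub, pull1_mul_left] at e ⊢
      rw [e, sub_self]
    rw [this, if_neg hi]; ring
  have hc : ∀ a b, cov1 g (yVec g Y L) y a b
      = cov1 g (xVec g K L) y a b - (4 / 3) * cov1 g (grad (kyScalar g Y)) y a b := by
    intro a b
    have : pd b (fun z => yVec g Y L z a) y = pd b (fun z => xVec g K L z a) y
        - (4 / 3) * pd b (fun z => grad (kyScalar g Y) z a) y := by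
      simp only [yVec]
      rw [pd_sub ((hv a).diff hg.isOpen hy) (((hz a).cmul _).diff hg.isOpen hy),
        pd_cmul _ ((hz a).diff hg.isOpen hy)]
    rw [cov1, this]
    simp only [cov1, yVec, Fin.sum_univ_four]; ring
  simp only [constraintX, constraintKY, hc, sym3] at h ⊢
  linear_combination (1 / 3) * h

omit hR

omit hY hL hLa in
theorem LocMetric.constraintKY_eq_killingMixed
    (hX : ∀ a b c, Sm U fun z => star3 g (xHook g (kySquare g Y) L) z a b c)
    (hv : ∀ a, Sm U fun z => yVec g Y L z a) (hW : ∀ a b c, Sm U fun z => starW g Y L z a b c)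
    (a b c d : Idx) : constraintKY g Y L y a b c d = killingMixed g (starW g Y L) y a b c d := by
  have h1 := hg.sym3_cov3_add_wedge hy hX hv a b c d
  have h2 := sym3_cov3_congr (g := g) hg.isOpen hy
    (T := fun z a b c => star3 g (xHook g (kySquare g Y) L) z a b c + wedge g (yVec g Y L) z a b c)
    (fun a b c => (hX a b c).add (hg.smooth_wedge hv a b c)) hW
    (fun z hz a b c => (hg.symLast_starW_eq hz Y a b c).symm) a b c d
  rw [constraintKY, killingMixed, ← h2, h1]

end Constraints

/-! ## Spin tensors in an adapted frame -/

theorem sum_pair_comm (F : Idx → Idx → Idx → Idx → ℝ) :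
    ∑ a, ∑ b, ∑ c, ∑ d, F a b c d = ∑ c, ∑ d, ∑ a, ∑ b, F a b c d := by
  have e : ∀ a, ∑ b, ∑ c, ∑ d, F a b c d = ∑ c, ∑ d, ∑ b, F a b c d := by
    intro a
    rw [Finset.sum_comm]
    exact Finset.sum_congr rfl fun _ _ => Finset.sum_comm
  simp only [e]
  rw [Finset.sum_comm]
  exact Finset.sum_congr rfl fun _ _ => Finset.sum_comm

/-- `V_{αβγδ} S^{αβ} p^γ p^δ`. -/
def spinForm (V : Idx → Idx → Idx → Idx → ℝ) (S : Biv) (p : Coord) : ℝ :=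
  ∑ α, ∑ β, S α β * ∑ γ, ∑ δ, V α β γ δ * p γ * p δ

/-- `S` has the components `s` in the frame `A`. -/
def push2 (A : Matrix Idx Idx ℝ) (s : Idx → Idx → ℝ) : Biv := fun α β =>
  ∑ a, ∑ b, s a b * A α a * A β b

theorem sum_push2 (A : Matrix Idx Idx ℝ) (s B : Idx → Idx → ℝ) :
    ∑ α, ∑ β, push2 A s α β * B α β = ∑ a, ∑ b, s a b * pull2 A B a b := by
  simp only [push2, pull2, Finset.sum_mul, Finset.mul_sum]
  rw [sum_pair_comm]
  exact Finset.sum_congr rfl fun _ _ => Finset.sum_congr rfl fun _ _ =>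
    Finset.sum_congr rfl fun _ _ => Finset.sum_congr rfl fun _ _ => by ring

theorem spinForm_push2 (A : Matrix Idx Idx ℝ) (s : Idx → Idx → ℝ)
    (V : Idx → Idx → Idx → Idx → ℝ) {p : Coord} {m : ℝ} (hp : ∀ α, p α = m * A α 0) :
    spinForm V (push2 A s) p = m ^ 2 * ∑ a, ∑ b, s a b * pull4 A V a b 0 0 := by
  rw [spinForm, sum_push2]
  simp only [Finset.mul_sum]
  refine Finset.sum_congr rfl fun a _ => Finset.sum_congr rfl fun b _ => ?_
  have : (fun α β => ∑ γ, ∑ δ, V α β γ δ * p γ * p δ)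
      = fun α β => m ^ 2 * pull2 A (fun γ δ => V α β γ δ) 0 0 := by
    funext α β
    simp only [pull2, Finset.mul_sum, hp]
    exact Finset.sum_congr rfl fun _ _ => Finset.sum_congr rfl fun _ _ => by ring
  rw [this, pull4_eq', pull2_eq, pull2_eq]
  simp only [pull1_mul_left]; ring

section Local

variable {U : Set Coord} {g : F2} {y p : Coord} {A : Matrix Idx Idx ℝ}

theorem phat_spec (hp : dot g y p p < 0) (hA0 : ∀ α, A α 0 = phat g y p α) (α : Idx) :
    p α = mass g y p * A α 0 := by
  rw [hA0, phat]; field_simp [(mass_pos hp).ne']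

/-- With the time axis along p, the Tulczyjew condition removes the time components: a spin tensor
is a spatial bivector with three free components. -/
theorem IsFrame.exists_push2 (hA : IsFrame (g y) A) (hp : dot g y p p < 0)
    (hA0 : ∀ α, A α 0 = phat g y p α) {S : Biv} (hS : IsSpin g y p S) :
    ∃ s : Idx → Idx → ℝ, (∀ a b, s a b = -s b a) ∧ (∀ a, s a 0 = 0) ∧ S = push2 A s := by
  have hu : IsUnit A.det := isUnit_iff_ne_zero.2 hA.det_pos.ne'
  have hut : IsUnit A.transpose.det := by rwa [Matrix.det_transpose]
  set M : Matrix Idx Idx ℝ := Matrix.of S with hM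
  set s : Matrix Idx Idx ℝ := A⁻¹ * M * A⁻¹.transpose with hs
  have h1 : A * s * A.transpose = M := by
    rw [hs, ← Matrix.mul_assoc, ← Matrix.mul_assoc, Matrix.mul_nonsing_inv _ hu, one_mul,
      Matrix.mul_assoc, ← Matrix.transpose_mul, Matrix.mul_nonsing_inv _ hu,
      Matrix.transpose_one, mul_one]
  have hMt : M.transpose = -M := by
    ext a b; simp only [hM, Matrix.transpose_apply, Matrix.neg_apply, Matrix.of_apply]
    exact hS.1 b a
  have hst : s.transpose = -s := by
    rw [hs, Matrix.transpose_mul, Matrix.transpose_mul, hMt, Matrix.transpose_transpose]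
    simp only [Matrix.mul_assoc, Matrix.neg_mul, Matrix.mul_neg]
  refine ⟨s, fun a b => ?_, fun a => ?_, ?_⟩
  · have := congrFun (congrFun hst b) a
    exact this
  · have h2 : M * (Matrix.of (g y) * A) = A * (s * Matrix.diagonal sgn) := by
      rw [← h1, ← hA.ortho]; simp only [Matrix.mul_assoc]
    have h3 : ∀ α, (M * (Matrix.of (g y) * A)) α 0 = 0 := by
      intro α
      have e := hS.2 α
      have : mass g y p * (M * (Matrix.of (g y) * A)) α 0 = 0 := by
        rw [← e]
        simp only [Matrix.mul_apply, Finset.mul_sum, hM, Matrix.of_apply, phat_spec hp hA0]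
        exact Finset.sum_congr rfl fun _ _ => Finset.sum_congr rfl fun _ _ => by ring
      exact (mul_eq_zero.1 this).resolve_left (mass_pos hp).ne'
    have h4 : s * Matrix.diagonal sgn = A⁻¹ * (M * (Matrix.of (g y) * A)) := by
      rw [h2, ← Matrix.mul_assoc A⁻¹, Matrix.nonsing_inv_mul _ hu, one_mul]
    have h5 := congrFun (congrFun h4 a) 0
    rw [Matrix.mul_diagonal, Matrix.mul_apply] at h5
    simp only [h3, mul_zero, Finset.sum_const_zero] at h5
    simpa [sgn] using h5
  · funext α β
    have := congrFun (congrFun h1 α) β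
    rw [Matrix.mul_apply] at this
    simp only [Matrix.mul_apply, Finset.sum_mul, Matrix.transpose_apply] at this
    refine Eq.trans this.symm ?_
    simp only [push2]
    rw [Finset.sum_comm]
    exact Finset.sum_congr rfl fun _ _ => Finset.sum_congr rfl fun _ _ => by ring

theorem IsFrame.isSpin_push2 (hA : IsFrame (g y) A) {m : ℝ} (hp : ∀ α, p α = m * A α 0)
    {s : Idx → Idx → ℝ} (hs : ∀ a b, s a b = -s b a) (hs0 : ∀ a, s a 0 = 0) :
    IsSpin g y p (push2 A s) := by
  refine ⟨fun α β => ?_, fun α => ?_⟩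
  · simp only [push2]
    rw [Finset.sum_comm, ← Finset.sum_neg_distrib]
    refine Finset.sum_congr rfl fun b _ => ?_
    rw [← Finset.sum_neg_distrib]
    exact Finset.sum_congr rfl fun a _ => by rw [hs]; ring
  · have h1 : ∀ a b, s a b * bil (g y) (fun α => A α b) (fun α => A α 0) = 0 := by
      intro a b
      rw [hA.ortho_apply]
      split_ifs with h
      · rw [h, hs0, zero_mul]
      · rw [mul_zero]
    have h2 : ∑ β, ∑ γ, push2 A s α β * (g y β γ * p γ)
        = ∑ a, ∑ b, m * A α a * (s a b * bil (g y) (fun α => A α b) fun α => A α 0) := by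
      simp only [push2, bil, Finset.sum_mul, Finset.mul_sum, hp]
      rw [sum_pair_comm]
      exact Finset.sum_congr rfl fun _ _ => Finset.sum_congr rfl fun _ _ =>
        Finset.sum_congr rfl fun _ _ => Finset.sum_congr rfl fun _ _ => by ring
    rw [h2]; simp [h1]

theorem tri_sym3 (T : Idx → Idx → Idx → ℝ) (u : Idx → ℝ) : tri (sym3 T) u u u = tri T u u u := by
  simp only [tri, sym3, Fin.sum_univ_four]; ring

/-- The linear form of a tensor vanishes on all spin tensors if and only if the symmetrization
of its left dual vanishes. -/
theorem LocMetric.spinForm_eq_zero_iff (hg : LocMetric U g) (hy : y ∈ U) (V : F4) :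
    (∀ p, dot g y p p < 0 → ∀ S, IsSpin g y p S → spinForm (V y) S p = 0)
      ↔ ∀ α β γ δ, sym3 (fun β γ δ => star4 g V y α β γ δ) β γ δ = 0 := by
  constructor
  · intro h
    refine hg.sym3_eq_zero hy (T := star4 g V y) fun A hA i => ?_
    rw [hA.pull4_star4 hg hy]
    have hA0 : ∀ α, A α 0 = 1 * A α 0 := fun α => (one_mul _).symm
    have hp : dot g y (fun α => A α 0) (fun α => A α 0) < 0 := by
      rw [dot_eq_bil, hA.ortho_apply]; simp [sgn]
    -- The elementary bivectors e_j ∧ e_k with spatial j and k are admissible spins for the momentum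
    -- e₀, and they isolate single components.
    have key : ∀ j k : Idx, j ≠ 0 → k ≠ 0 → j ≠ k →
        pull4 A (V y) j k 0 0 - pull4 A (V y) k j 0 0 = 0 := by
      intro j k hj hk hjk
      set s : Idx → Idx → ℝ := fun a b =>
        (if a = j then (if b = k then 1 else 0) else 0)
          - (if a = k then (if b = j then 1 else 0) else 0) with hs
      have h1 : ∀ a b, s a b = -s b a := by intro a b; simp only [hs]; split_ifs <;> ring
      have h2 : ∀ a, s a 0 = 0 := by
        intro a; simp [hs, hj.symm, hk.symm]
      have := h _ hp _ (hA.isSpin_push2 hA0 h1 h2)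
      rw [spinForm_push2 A s (V y) hA0] at this
      simpa [hs, sub_mul, Finset.sum_sub_distrib] using this
    fin_cases i
    · simp [etaStar]
    · simp [etaStar, key 3 2]
    · simp [etaStar, key 1 3]
    · simp [etaStar, key 2 1]
  · intro h p hp S hS
    obtain ⟨A, hA, hA0⟩ := hg.exists_adapted_frame hy hp
    obtain ⟨s, hs, hs0, rfl⟩ := hA.exists_push2 hp hA0 hS
    rw [spinForm_push2 A s (V y) (phat_spec hp hA0)]
    have h1 : ∀ i, etaStar (fun j k => pull4 A (V y) j k 0 0) i 0 = 0 := by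
      intro i
      rw [← hA.pull4_star4 hg hy, pull4_eq]
      have e : (fun α => pull3 A (fun β γ δ => star4 g V y α β γ δ) 0 0 0) = fun _ => 0 := by
        funext α
        have := tri_sym3 (fun β γ δ => star4 g V y α β γ δ) fun α => A α 0
        have h0 : sym3 (fun β γ δ => star4 g V y α β γ δ) = fun _ _ _ => 0 := by
          funext β γ δ; exact h α β γ δ
        rw [h0] at this
        simp only [tri, zero_mul, Finset.sum_const_zero] at this
        rw [this]
        simp only [pull3]
        exact Finset.sum_congr rfl fun _ _ => Finset.sum_congr rfl fun _ _ =>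
          Finset.sum_congr rfl fun _ _ => by ring
      rw [e]; simp [pull1]
    have k1 := h1 1
    have k2 := h1 2
    have k3 := h1 3
    simp [etaStar] at k1 k2 k3
    have z : ∀ a, s 0 a = 0 := fun a => by rw [hs, hs0, neg_zero]
    have d : ∀ a, s a a = 0 := fun a => self_eq_neg.1 (hs a a)
    have : ∑ a, ∑ b, s a b * pull4 A (V y) a b 0 0 = 0 := by
      simp only [Fin.sum_univ_four, z, hs0, d, hs 2 1, hs 3 1, hs 3 2]
      -- The three spatial components of the spin pair with the three components of the dual, up to
      -- the signs of the cyclic order.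
      linear_combination (-s 2 3) * k1 + (s 1 3) * k2 - (s 1 2) * k3
    rw [this, mul_zero]

end Local

/-! ## The rate of change along the Mathisson-Papapetrou-Tulczyjew equations -/

/-- The components of the momentum. -/
def momentumL (μ : Idx) : Phase →L[ℝ] ℝ :=
  (ContinuousLinearMap.proj (R := ℝ) (φ := fun _ : Idx => ℝ) μ).comp
    ((ContinuousLinearMap.fst ℝ Coord Biv).comp (ContinuousLinearMap.snd ℝ Coord (Coord × Biv)))

/-- The components of the spin tensor. -/
def spinL (μ ν : Idx) : Phase →L[ℝ] ℝ :=
  (ContinuousLinearMap.proj (R := ℝ) (φ := fun _ : Idx => ℝ) ν).comp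
    ((ContinuousLinearMap.proj (R := ℝ) (φ := fun _ : Idx => Idx → ℝ) μ).comp
      ((ContinuousLinearMap.snd ℝ Coord Biv).comp
        (ContinuousLinearMap.snd ℝ Coord (Coord × Biv))))

theorem fderiv_quadInv {K : F2} {L : F3} {y p : Coord} {S : Biv}
    (hK : ∀ a b, DifferentiableAt ℝ (fun z => K z a b) y)
    (hL : ∀ a b c, DifferentiableAt ℝ (fun z => L z a b c) y) (v w : Coord) (s : Biv) :
    fderiv ℝ (quadInv K L) (y, p, S) (v, w, s)
      = (∑ μ, ∑ ν, ((∑ k, v k * pd k (fun z => K z μ ν) y) * p μ * p ν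
          + K y μ ν * (w μ * p ν + p μ * w ν)))
        + ∑ μ, ∑ ν, ∑ ρ, ((∑ k, v k * pd k (fun z => L z μ ν ρ) y) * S μ ν * p ρ
          + L y μ ν ρ * (s μ ν * p ρ + S μ ν * w ρ)) := by
  have hy : HasFDerivAt (fun z : Phase => z.1) (ContinuousLinearMap.fst ℝ Coord (Coord × Biv))
    (y, p, S) := hasFDerivAt_fst
  have hp : ∀ μ, HasFDerivAt (fun z : Phase => z.2.1 μ) (momentumL μ) (y, p, S) :=
    fun μ => (momentumL μ).hasFDerivAt
  have hS : ∀ μ ν, HasFDerivAt (fun z : Phase => z.2.2 μ ν) (spinL μ ν) (y, p, S) :=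
    fun μ ν => (spinL μ ν).hasFDerivAt
  have hK' : ∀ μ ν, HasFDerivAt (fun z : Phase => K z.1 μ ν)
      ((fderiv ℝ (fun z => K z μ ν) y).comp (ContinuousLinearMap.fst ℝ Coord (Coord × Biv)))
      (y, p, S) := fun μ ν =>
    HasFDerivAt.comp (y, p, S) (f := fun z : Phase => z.1) (hK μ ν).hasFDerivAt hy
  have hL' : ∀ μ ν ρ, HasFDerivAt (fun z : Phase => L z.1 μ ν ρ)
      ((fderiv ℝ (fun z => L z μ ν ρ) y).comp (ContinuousLinearMap.fst ℝ Coord (Coord × Biv)))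
      (y, p, S) := fun μ ν ρ =>
    HasFDerivAt.comp (y, p, S) (f := fun z : Phase => z.1) (hL μ ν ρ).hasFDerivAt hy
  have h := (HasFDerivAt.fun_sum (u := Finset.univ) fun μ _ =>
      HasFDerivAt.fun_sum (u := Finset.univ) fun ν _ =>
        ((hK' μ ν).mul (hp μ)).mul (hp ν)).add
    (HasFDerivAt.fun_sum (u := Finset.univ) fun μ _ =>
      HasFDerivAt.fun_sum (u := Finset.univ) fun ν _ =>
        HasFDerivAt.fun_sum (u := Finset.univ) fun ρ _ =>
          ((hL' μ ν ρ).mul (hS μ ν)).mul (hp ρ))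
  have e := congrArg (fun F => F (v, w, s)) h.fderiv
  refine Eq.trans e ?_
  simp only [ContinuousLinearMap.add_apply, ContinuousLinearMap.sum_apply,
    ContinuousLinearMap.smul_apply, ContinuousLinearMap.comp_apply, smul_eq_mul,
    ContinuousLinearMap.coe_fst', fderiv_eq_sum_pd, Pi.mul_apply]
  have em : ∀ μ, momentumL μ (v, w, s) = w μ := fun _ => rfl
  have es : ∀ μ ν, spinL μ ν (v, w, s) = s μ ν := fun _ _ => rfl
  simp only [em, es]
  congr 1
  · exact Finset.sum_congr rfl fun _ _ => Finset.sum_congr rfl fun _ _ => by ring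
  · exact Finset.sum_congr rfl fun _ _ => Finset.sum_congr rfl fun _ _ =>
      Finset.sum_congr rfl fun _ _ => by ring

theorem sum_adjoint (N : Idx → Idx → ℝ) (X Z : Idx → ℝ) :
    ∑ μ, (∑ l, N l μ * X l) * Z μ = ∑ l, X l * ∑ μ, N l μ * Z μ := by
  simp only [Finset.sum_mul, Finset.mul_sum]
  rw [Finset.sum_comm]
  exact Finset.sum_congr rfl fun _ _ => Finset.sum_congr rfl fun _ _ => by ring

/-- The connection along `v`. -/
def connMat (g : F2) (y v : Coord) (l m : Idx) : ℝ := ∑ k, christoffel g y l k m * v k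

theorem sum_cov2 (g K : F2) (y v : Coord) (a b : Idx) :
    ∑ k, v k * cov2 g K y a b k = ∑ k, v k * pd k (fun z => K z a b) y
      - ∑ l, connMat g y v l a * K y l b - ∑ l, connMat g y v l b * K y a l := by
  simp only [cov2, connMat, Fin.sum_univ_four]; ring

theorem sum_cov3 (g : F2) (L : F3) (y v : Coord) (a b c : Idx) :
    ∑ k, v k * cov3 g L y a b c k = ∑ k, v k * pd k (fun z => L z a b c) y
      - ∑ l, connMat g y v l a * L y l b c - ∑ l, connMat g y v l b * L y a l c
      - ∑ l, connMat g y v l c * L y a b l := by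
  simp only [cov3, connMat, Fin.sum_univ_four]; ring

/-- Parallel transport of p is traded for connection terms on K, which complete its partial
derivative to a covariant one. -/
theorem transport_quad (N K dK : Idx → Idx → ℝ) (p : Idx → ℝ) :
    ∑ μ, ∑ ν, (dK μ ν * p μ * p ν + K μ ν * ((-∑ m, N μ m * p m) * p ν
        + p μ * (-∑ m, N ν m * p m)))
      = ∑ μ, ∑ ν, (dK μ ν - ∑ l, N l μ * K l ν - ∑ l, N l ν * K μ l) * p μ * p ν := by
  simp only [Fin.sum_univ_four]; ring

/-- The three connection terms of L are transferred one index at a time by `sum_adjoint`: two come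
from the transport of S, the third from that of p. -/
theorem transport_cubic (N : Idx → Idx → ℝ) (L dL : Idx → Idx → Idx → ℝ) (p : Idx → ℝ) (S : Biv) :
    ∑ μ, ∑ ν, ∑ ρ, (dL μ ν ρ * S μ ν * p ρ
        + L μ ν ρ * ((-∑ m, (N μ m * S m ν + N ν m * S μ m)) * p ρ
        + S μ ν * (-∑ m, N ρ m * p m)))
      = ∑ μ, ∑ ν, ∑ ρ, (dL μ ν ρ - ∑ l, N l μ * L l ν ρ - ∑ l, N l ν * L μ l ρ
        - ∑ l, N l ρ * L μ ν l) * S μ ν * p ρ := by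
  have h1 : ∑ μ, ∑ ν, ∑ ρ, (∑ l, N l μ * L l ν ρ) * (S μ ν * p ρ)
      = ∑ μ, ∑ ν, ∑ ρ, L μ ν ρ * ((∑ m, N μ m * S m ν) * p ρ) := by
    rw [Finset.sum_comm, Finset.sum_comm (γ := Idx) (f := fun μ ν => ∑ ρ, L μ ν ρ * _)]
    refine Finset.sum_congr rfl fun ν _ => ?_
    rw [Finset.sum_comm, Finset.sum_comm (f := fun μ ρ => L μ ν ρ * _)]
    refine Finset.sum_congr rfl fun ρ _ => ?_
    rw [sum_adjoint]
    simp only [Finset.sum_mul, mul_assoc]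
  have h2 : ∑ μ, ∑ ν, ∑ ρ, (∑ l, N l ν * L μ l ρ) * (S μ ν * p ρ)
      = ∑ μ, ∑ ν, ∑ ρ, L μ ν ρ * ((∑ m, N ν m * S μ m) * p ρ) := by
    refine Finset.sum_congr rfl fun μ _ => ?_
    rw [Finset.sum_comm, Finset.sum_comm (f := fun ν ρ => L μ ν ρ * _)]
    refine Finset.sum_congr rfl fun ρ _ => ?_
    rw [sum_adjoint]
    simp only [Finset.sum_mul, mul_assoc]
  have h3 : ∑ μ, ∑ ν, ∑ ρ, (∑ l, N l ρ * L μ ν l) * (S μ ν * p ρ)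
      = ∑ μ, ∑ ν, ∑ ρ, L μ ν ρ * (S μ ν * ∑ m, N ρ m * p m) := by
    refine Finset.sum_congr rfl fun μ _ => Finset.sum_congr rfl fun ν _ => ?_
    rw [sum_adjoint]
    refine Finset.sum_congr rfl fun ρ _ => ?_
    simp only [Finset.mul_sum]
    exact Finset.sum_congr rfl fun _ _ => by ring
  have e1 : ∀ μ ν ρ, dL μ ν ρ * S μ ν * p ρ
        + L μ ν ρ * ((-∑ m, (N μ m * S m ν + N ν m * S μ m)) * p ρ
        + S μ ν * (-∑ m, N ρ m * p m)) = dL μ ν ρ * S μ ν * p ρ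
        - L μ ν ρ * ((∑ m, N μ m * S m ν) * p ρ) - L μ ν ρ * ((∑ m, N ν m * S μ m) * p ρ)
        - L μ ν ρ * (S μ ν * ∑ m, N ρ m * p m) := by
    intro μ ν ρ; rw [Finset.sum_add_distrib]; ring
  have e2 : ∀ μ ν ρ, (dL μ ν ρ - ∑ l, N l μ * L l ν ρ - ∑ l, N l ν * L μ l ρ
        - ∑ l, N l ρ * L μ ν l) * S μ ν * p ρ = dL μ ν ρ * S μ ν * p ρ
        - (∑ l, N l μ * L l ν ρ) * (S μ ν * p ρ) - (∑ l, N l ν * L μ l ρ) * (S μ ν * p ρ)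
        - (∑ l, N l ρ * L μ ν l) * (S μ ν * p ρ) := by
    intro μ ν ρ; ring
  simp only [e1, e2, Finset.sum_sub_distrib, h1, h2, h3]

/-- `½ R^μ_{ναβ} v^ν S^{αβ}`. -/
def spinForce (g : F2) (y v : Coord) (S : Biv) (μ : Idx) : ℝ :=
  (1 / 2) * ∑ ν, ∑ α, ∑ β, riemannUp g y μ ν α β * v ν * S α β

/-- The rate of change, as a function of the velocity. -/
def rateForm (g K : F2) (L : F3) (y p : Coord) (S : Biv) (v : Coord) : ℝ :=
  (∑ μ, ∑ ν, ((∑ k, v k * cov2 g K y μ ν k) * p μ * p ν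
      - K y μ ν * (spinForce g y v S μ * p ν + p μ * spinForce g y v S ν)))
    + ∑ μ, ∑ ν, ∑ ρ, ((∑ k, v k * cov3 g L y μ ν ρ k) * S μ ν * p ρ
      + L y μ ν ρ * ((p μ * v ν - p ν * v μ) * p ρ - S μ ν * spinForce g y v S ρ))

/-- All Christoffel symbols of the equations of motion are absorbed into covariant derivatives. Only
the spin force and the bivector p ∧ v remain. -/
theorem rate_quadInv {g K : F2} {L : F3} {y : Coord}
    (hK : ∀ a b, DifferentiableAt ℝ (fun z => K z a b) y)
    (hL : ∀ a b c, DifferentiableAt ℝ (fun z => L z a b c) y) (p : Coord) (S : Biv) :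
    rate g (quadInv K L) (y, p, S) = rateForm g K L y p S (velocity g y p S) := by
  set v := velocity g y p S with hv
  have hw : ∀ μ, -(∑ α, ∑ β, christoffel g y μ α β * v α * p β)
      - (1 / 2) * ∑ ν, ∑ α, ∑ β, riemannUp g y μ ν α β * v ν * S α β
      = (-∑ m, connMat g y v μ m * p m) - spinForce g y v S μ := by
    intro μ
    rw [spinForce]; congr 2
    rw [Finset.sum_comm]; simp only [connMat, Finset.sum_mul]
  have hs : ∀ μ ν, -(∑ α, ∑ β, (christoffel g y μ α β * v α * S β ν
        + christoffel g y ν α β * v α * S μ β)) + (p μ * v ν - p ν * v μ)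
      = (-∑ m, (connMat g y v μ m * S m ν + connMat g y v ν m * S μ m))
        + (p μ * v ν - p ν * v μ) := by
    intro μ ν
    congr 2
    rw [Finset.sum_comm]; simp only [connMat, Finset.sum_mul, Finset.sum_add_distrib]
  have h : rate g (quadInv K L) (y, p, S) = fderiv ℝ (quadInv K L) (y, p, S)
      (v, fun μ => (-∑ m, connMat g y v μ m * p m) - spinForce g y v S μ,
        fun μ ν => (-∑ m, (connMat g y v μ m * S m ν + connMat g y v ν m * S μ m))
        + (p μ * v ν - p ν * v μ)) := by
    simp only [← hw, ← hs]; rfl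
  rw [h, fderiv_quadInv hK hL, rateForm]
  have h1 := transport_quad (connMat g y v) (K y)
    (fun μ ν => ∑ k, v k * pd k (fun z => K z μ ν) y) p
  have h2 := transport_cubic (connMat g y v) (L y)
    (fun μ ν ρ => ∑ k, v k * pd k (fun z => L z μ ν ρ) y) p S
  simp only [← sum_cov2, ← sum_cov3] at h1 h2
  simp only [Finset.sum_sub_distrib, Finset.sum_add_distrib (s := Finset.univ (α := Idx)), mul_add, mul_sub,
    add_mul, sub_mul] at h1 h2 ⊢
  linear_combination h1 + h2

/-! ## Quasi-invariance and the constraint -/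

theorem spinForce_add (g : F2) (y u v : Coord) (S : Biv) (μ : Idx) :
    spinForce g y (u + v) S μ = spinForce g y u S μ + spinForce g y v S μ := by
  simp only [spinForce, Pi.add_apply, mul_add, add_mul, Finset.sum_add_distrib]

theorem spinForce_smul (g : F2) (y : Coord) (r : ℝ) (v : Coord) (S : Biv) (μ : Idx) :
    spinForce g y (r • v) S μ = r * spinForce g y v S μ := by
  simp only [spinForce, Pi.smul_apply, smul_eq_mul, Finset.mul_sum]
  exact Finset.sum_congr rfl fun _ _ => Finset.sum_congr rfl fun _ _ =>
    Finset.sum_congr rfl fun _ _ => by ring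

/-- `rateForm` as a linear map. -/
def rateLin (g K : F2) (L : F3) (y p : Coord) (S : Biv) : Coord →ₗ[ℝ] ℝ where
  toFun := rateForm g K L y p S
  map_add' u v := by
    simp only [rateForm, spinForce_add, Pi.add_apply, mul_add, add_mul, mul_sub, sub_mul,
      Finset.sum_add_distrib, Finset.sum_sub_distrib]
    ring
  map_smul' r v := by
    simp only [rateForm, spinForce_smul, Pi.smul_apply, smul_eq_mul, RingHom.id_apply, mul_add]
    congr 1
    · simp only [Finset.mul_sum, Finset.sum_mul]
      refine Finset.sum_congr rfl fun _ _ => Finset.sum_congr rfl fun _ _ => ?_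
      rw [mul_sub, Finset.mul_sum]
      congr 1
      · exact Finset.sum_congr rfl fun _ _ => by ring
      · ring
    · simp only [Finset.mul_sum, Finset.sum_mul]
      refine Finset.sum_congr rfl fun _ _ => Finset.sum_congr rfl fun _ _ =>
        Finset.sum_congr rfl fun _ _ => ?_
      rw [mul_add, Finset.mul_sum]
      congr 1
      · exact Finset.sum_congr rfl fun _ _ => by ring
      · ring

section Local

variable {U : Set Coord} {g K : F2} {L : F3} {y p : Coord}

/-- The part of `rateForm` that is quadratic in the spin. -/
def rateQuad (g : F2) (L : F3) (y p : Coord) (S : Biv) : ℝ :=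
  ∑ μ, ∑ ν, ∑ ρ, L y μ ν ρ * S μ ν * spinForce g y p S ρ

/-- At v = p the bivector p ∧ v vanishes, and the derivative of K drops out by the Killing equation.
By symmetry of K its two force terms coincide, which cancels the ½ in the force and gives the
curvature term of V. -/
theorem rateForm_self (hKs : ∀ a b, K y a b = K y b a)
    (hK : ∀ a b c, sym3 (cov2 g K y) a b c = 0) {S : Biv} (hS : IsSpin g y p S) :
    rateForm g K L y p S p = spinForm (vTensor g K L y) S p - rateQuad g L y p S := by
  have h1 : ∑ μ, ∑ ν, (∑ k, p k * cov2 g K y μ ν k) * p μ * p ν = 0 := by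
    have := tri_sym3 (cov2 g K y) p
    have h0 : sym3 (cov2 g K y) = fun _ _ _ => 0 := by
      funext a b c; exact hK a b c
    rw [h0] at this
    simp only [tri, zero_mul, Finset.sum_const_zero] at this
    rw [this]
    refine Finset.sum_congr rfl fun _ _ => Finset.sum_congr rfl fun _ _ => ?_
    simp only [Finset.sum_mul]
    exact Finset.sum_congr rfl fun _ _ => by ring
  have h2 : ∑ μ, ∑ ν, K y μ ν * (spinForce g y p S μ * p ν + p μ * spinForce g y p S ν)
      = ∑ α, ∑ β, S α β * ∑ γ, ∑ δ, (∑ l, K y l γ * riemannUp g y l δ α β) * p γ * p δ := by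
    have e1 : ∑ μ, ∑ ν, K y μ ν * (spinForce g y p S μ * p ν + p μ * spinForce g y p S ν)
        = 2 * ∑ μ, (∑ ν, K y μ ν * p ν) * spinForce g y p S μ := by
      simp only [mul_add, Finset.sum_add_distrib]
      rw [Finset.sum_comm (f := fun μ ν => K y μ ν * (p μ * spinForce g y p S ν))]
      simp only [Finset.sum_mul, fun μ ν => hKs μ ν]
      rw [two_mul]
      congr 1
      · exact Finset.sum_congr rfl fun _ _ => Finset.sum_congr rfl fun _ _ => by
          rw [hKs]; ring
      · exact Finset.sum_congr rfl fun _ _ => Finset.sum_congr rfl fun _ _ => by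
          rw [hKs]; ring
    have e2 : 2 * ∑ μ, (∑ ν, K y μ ν * p ν) * spinForce g y p S μ
        = ∑ l, ∑ δ, ∑ α, ∑ β, S α β * ((∑ γ, K y l γ * p γ) * riemannUp g y l δ α β * p δ) := by
      simp only [spinForce, Finset.mul_sum]
      exact Finset.sum_congr rfl fun _ _ => Finset.sum_congr rfl fun _ _ =>
        Finset.sum_congr rfl fun _ _ => Finset.sum_congr rfl fun _ _ => by ring
    rw [e1, e2, sum_pair_comm]
    refine Finset.sum_congr rfl fun α _ => Finset.sum_congr rfl fun β _ => ?_
    simp only [← Finset.mul_sum]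
    congr 1
    simp only [Fin.sum_univ_four]; ring
  -- The metric factor lowers the index of p that is contracted with S, so the Tulczyjew condition
  -- kills the trace terms of V whatever their coefficient.
  have h3 : ∀ N : Idx → Idx → ℝ, ∑ α, ∑ β, S α β * ∑ γ, ∑ δ, N δ α * g y β γ * p γ * p δ = 0 := by
    intro N
    have : ∀ α, ∑ β, S α β * ∑ γ, ∑ δ, N δ α * g y β γ * p γ * p δ
        = (∑ δ, N δ α * p δ) * ∑ β, ∑ γ, S α β * (g y β γ * p γ) := by
      intro α; simp only [Fin.sum_univ_four]; ring
    simp only [this, hS.2, mul_zero, Finset.sum_const_zero]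
  have h4 : ∀ N : Idx → Idx → ℝ, ∑ α, ∑ β, S α β * ∑ γ, ∑ δ, N δ β * g y α γ * p γ * p δ = 0 := by
    intro N
    rw [Finset.sum_comm]
    have := h3 N
    rw [← neg_eq_zero, ← Finset.sum_neg_distrib] at this
    rw [← this]
    refine Finset.sum_congr rfl fun β _ => ?_
    rw [← Finset.sum_neg_distrib]
    exact Finset.sum_congr rfl fun α _ => by rw [hS.1 α β]; ring
  have h5 : spinForm (vTensor g K L y) S p
      = ∑ α, ∑ β, S α β * (∑ γ, ∑ δ, cov3 g L y α β γ δ * p γ * p δ)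
        - ∑ α, ∑ β, S α β * (∑ γ, ∑ δ, (∑ l, K y l γ * riemannUp g y l δ α β) * p γ * p δ)
        + (1 / 3) * (∑ α, ∑ β, S α β * (∑ γ, ∑ δ, kRiem g K y δ α * g y β γ * p γ * p δ)
          - ∑ α, ∑ β, S α β * (∑ γ, ∑ δ, kRiem g K y δ β * g y α γ * p γ * p δ)) := by
    have e : ∀ α β, ∑ γ, ∑ δ, vTensor g K L y α β γ δ * p γ * p δ
        = ∑ γ, ∑ δ, cov3 g L y α β γ δ * p γ * p δ
        - ∑ γ, ∑ δ, (∑ l, K y l γ * riemannUp g y l δ α β) * p γ * p δ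
        + (1 / 3) * (∑ γ, ∑ δ, kRiem g K y δ α * g y β γ * p γ * p δ
          - ∑ γ, ∑ δ, kRiem g K y δ β * g y α γ * p γ * p δ) := by
      intro α β
      rw [← Finset.sum_sub_distrib, ← Finset.sum_sub_distrib, Finset.mul_sum,
        ← Finset.sum_add_distrib]
      refine Finset.sum_congr rfl fun γ _ => ?_
      rw [← Finset.sum_sub_distrib, ← Finset.sum_sub_distrib, Finset.mul_sum,
        ← Finset.sum_add_distrib]
      refine Finset.sum_congr rfl fun δ _ => ?_
      rw [vTensor]; ring
    simp only [spinForm, e]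
    rw [← Finset.sum_sub_distrib, ← Finset.sum_sub_distrib, Finset.mul_sum,
        ← Finset.sum_add_distrib]
    refine Finset.sum_congr rfl fun α _ => ?_
    rw [← Finset.sum_sub_distrib, ← Finset.sum_sub_distrib, Finset.mul_sum,
        ← Finset.sum_add_distrib]
    exact Finset.sum_congr rfl fun β _ => by ring
  have h6 : ∑ μ, ∑ ν, ∑ ρ, (∑ k, p k * cov3 g L y μ ν ρ k) * S μ ν * p ρ
      = ∑ α, ∑ β, S α β * (∑ γ, ∑ δ, cov3 g L y α β γ δ * p γ * p δ) := by
    refine Finset.sum_congr rfl fun _ _ => Finset.sum_congr rfl fun _ _ => ?_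
    simp only [Finset.mul_sum, Finset.sum_mul]
    exact Finset.sum_congr rfl fun _ _ => Finset.sum_congr rfl fun _ _ => by ring
  rw [h5, h3, h4, ← h2, ← h6, rateForm, rateQuad]
  have e7 : ∀ μ ν ρ, L y μ ν ρ * ((p μ * p ν - p ν * p μ) * p ρ - S μ ν * spinForce g y p S ρ)
      = -(L y μ ν ρ * S μ ν * spinForce g y p S ρ) := by intros; ring
  simp only [e7, Finset.sum_add_distrib, Finset.sum_sub_distrib, Finset.sum_neg_distrib, h1]
  ring

theorem isBigO_comp (α β : Idx) (l : Filter Biv) : (fun S : Biv => S α β) =O[l] fun S => ‖S‖ :=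
  IsBigO.of_bound 1 (Filter.Eventually.of_forall fun S => by
    rw [one_mul, norm_norm]; exact (norm_le_pi_norm (S α) β).trans (norm_le_pi_norm S α))

theorem isBigO_sq_one : (fun S : Biv => ‖S‖ ^ 2) =O[𝓝 0] fun _ => (1 : ℝ) :=
  (Continuous.continuousAt (by fun_prop)).isBigO_one ℝ

theorem isBigO_dMat (g : F2) (y p : Coord) (α β : Idx) :
    (fun S => dMat g y p S α β) =O[𝓝 0] fun S : Biv => ‖S‖ ^ 2 := by
  unfold dMat
  refine IsBigO.const_mul_left (IsBigO.fun_sum fun ν _ => IsBigO.fun_sum fun γ _ =>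
    IsBigO.fun_sum fun δ _ => ?_) _
  have h := ((isBigO_comp α ν (𝓝 0)).mul (isBigO_comp γ δ (𝓝 0))).const_mul_left
    (riemann g y ν β γ δ)
  refine (h.congr_left fun S => by ring).congr_right fun S => by ring

theorem tendsto_sq : Filter.Tendsto (fun S : Biv => ‖S‖ ^ 2) (𝓝 0) (𝓝 0) := by
  have : Continuous fun S : Biv => ‖S‖ ^ 2 := by fun_prop
  simpa using this.tendsto 0

theorem isBigO_dVec (g : F2) (y p : Coord) (α : Idx) :
    (fun S => dVec g y p S α) =O[𝓝 0] fun S : Biv => ‖S‖ ^ 2 := by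
  have h1 : (fun S => ∑ β, dMat g y p S α β * p β) =O[𝓝 0] fun S : Biv => ‖S‖ ^ 2 :=
    IsBigO.fun_sum fun β _ => ((isBigO_dMat g y p α β).const_mul_left (p β)).congr_left
      fun S => mul_comm _ _
  have h2 : (fun S => ∑ β, dMat g y p S β β) =O[𝓝 0] fun S : Biv => ‖S‖ ^ 2 :=
    IsBigO.fun_sum fun β _ => isBigO_dMat g y p β β
  have h3 : Filter.Tendsto (fun S => 1 - (∑ β, dMat g y p S β β) / 2) (𝓝 0) (𝓝 1) := by
    have := (h2.trans_tendsto tendsto_sq).div_const 2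
    simpa using this.const_sub 1
  have h4 := (h3.inv₀ one_ne_zero).isBigO_one ℝ
  exact ((h1.mul h4).congr_left fun S => by rw [dVec]; exact (div_eq_mul_inv _ _).symm).congr_right
    fun S => mul_one _

/-- The kinetic mass is x ↦ μ/√(1 - x) evaluated at an x of order S²; differentiability at 0 gives
the estimate. -/
theorem isBigO_kineticMass (hp : dot g y p p < 0) :
    (fun S => kineticMass g y p S - mass g y p) =O[𝓝 0] fun S : Biv => ‖S‖ ^ 2 := by
  set m := mass g y p
  have h1 : (fun S => dot g y (dVec g y p S) (dVec g y p S) / m ^ 2)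
      =O[𝓝 0] fun S : Biv => ‖S‖ ^ 2 := by
    unfold dot
    have h : (fun S => ∑ α, ∑ β, g y α β * dVec g y p S α * dVec g y p S β)
        =O[𝓝 0] fun S : Biv => ‖S‖ ^ 2 := by
      refine IsBigO.fun_sum fun α _ => IsBigO.fun_sum fun β _ => ?_
      have := ((isBigO_dVec g y p α).mul ((isBigO_dVec g y p β).trans isBigO_sq_one)).const_mul_left
        (g y α β)
      exact (this.congr_left fun S => by ring).congr_right fun S => mul_one _
    exact (h.const_mul_left (m ^ 2)⁻¹).congr_left fun S => by rw [div_eq_inv_mul]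
  have h2 := h1.trans_tendsto tendsto_sq
  have h3 : HasDerivAt (fun x : ℝ => m / Real.sqrt (1 - x))
      ((0 * Real.sqrt (1 - 0) - m * (-1 / (2 * Real.sqrt (1 - 0)))) / Real.sqrt (1 - 0) ^ 2) 0 := by
    refine (hasDerivAt_const (0 : ℝ) m).div ?_ (by simp)
    have := ((hasDerivAt_id (0 : ℝ)).const_sub 1).sqrt (by simp)
    exact this
  have h4 := h3.isBigO_sub.comp_tendsto h2
  refine IsBigO.trans (h4.congr_left fun S => ?_) (h1.congr_left fun S => ?_)
  · simp [kineticMass, m]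
  · simp

/-- Both the kinetic mass and the correction `dVec` deviate at second order in the spin, so momentum
and velocity are parallel to first order. -/
theorem isBigO_velocity (hp : dot g y p p < 0) (α : Idx) :
    (fun S => velocity g y p S α - (mass g y p)⁻¹ * p α) =O[𝓝 0] fun S : Biv => ‖S‖ ^ 2 := by
  set m := mass g y p with hm
  have hm0 : m ≠ 0 := (mass_pos hp).ne'
  have h1 := isBigO_kineticMass hp
  have h2 := isBigO_dVec g y p α
  have h3 : (fun S => p α + dVec g y p S α) =O[𝓝 0] fun _ : Biv => (1 : ℝ) :=
    (isBigO_const_const _ one_ne_zero _).add (h2.trans isBigO_sq_one)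
  have h4 := ((h1.mul h3).const_mul_left (m ^ 2)⁻¹).congr_right fun S => mul_one _
  refine (h4.add (h2.const_mul_left m⁻¹)).congr_left fun S => ?_
  rw [velocity, ← hm]
  field_simp
  ring

/-- The rate is linear in the velocity, with coefficients continuous in S and hence bounded near S =
0. Replacing v by p/μ therefore costs O(S²), and so does the spin force acting through L. -/
theorem isBigO_rate (hKs : ∀ a b, K y a b = K y b a)
    (hK : ∀ a b c, sym3 (cov2 g K y) a b c = 0)
    (hKd : ∀ a b, DifferentiableAt ℝ (fun z => K z a b) y)
    (hLd : ∀ a b c, DifferentiableAt ℝ (fun z => L z a b c) y) (hp : dot g y p p < 0) :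
    (fun S => rate g (quadInv K L) (y, p, S)
      - (mass g y p)⁻¹ * spinForm (vTensor g K L y) S p)
      =O[𝓝[{S | IsSpin g y p S}] 0] fun S => ‖S‖ ^ 2 := by
  set m := mass g y p with hm
  have h1 : (fun S => ∑ σ, (velocity g y p S σ - m⁻¹ * p σ)
      * rateForm g K L y p S (fun j => if σ = j then 1 else 0)) =O[𝓝 0] fun S : Biv => ‖S‖ ^ 2 := by
    refine IsBigO.fun_sum fun σ _ => ?_
    have hc : Continuous fun S => rateForm g K L y p S (fun j => if σ = j then 1 else 0) := by
      unfold rateForm spinForce; fun_prop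
    exact ((isBigO_velocity hp σ).mul (hc.continuousAt.isBigO_one ℝ)).congr_right
      fun S => mul_one _
  have h2 : (fun S => m⁻¹ * rateQuad g L y p S) =O[𝓝 0] fun S : Biv => ‖S‖ ^ 2 := by
    refine IsBigO.const_mul_left ?_ _
    unfold rateQuad
    refine IsBigO.fun_sum fun μ _ => IsBigO.fun_sum fun ν _ => IsBigO.fun_sum fun ρ _ => ?_
    have hf : (fun S => spinForce g y p S ρ) =O[𝓝 0] fun S : Biv => ‖S‖ := by
      unfold spinForce
      exact IsBigO.const_mul_left (IsBigO.fun_sum fun ν _ => IsBigO.fun_sum fun α _ =>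
        IsBigO.fun_sum fun β _ => (isBigO_comp α β _).const_mul_left _) _
    exact (((isBigO_comp μ ν _).const_mul_left (L y μ ν ρ)).mul hf).congr_right
      fun S => (sq _).symm
  refine ((h1.sub h2).mono nhdsWithin_le_nhds).congr' ?_ Filter.EventuallyEq.rfl
  filter_upwards [self_mem_nhdsWithin] with S hS
  have e1 := LinearMap.pi_apply_eq_sum_univ (rateLin g K L y p S)
    (velocity g y p S - m⁻¹ • p)
  rw [map_sub, map_smul] at e1
  have e2 : ∀ v, rateLin g K L y p S v = rateForm g K L y p S v := fun _ => rfl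
  simp only [e2, smul_eq_mul, Pi.sub_apply, Pi.smul_apply] at e1
  rw [← e1, rate_quadInv hKd hLd, rateForm_self hKs hK hS]
  ring

/-- The leading term is homogeneous of degree one in S, so it is O(S²) only if it vanishes. -/
theorem isBigO_rate_iff (hKs : ∀ a b, K y a b = K y b a)
    (hK : ∀ a b c, sym3 (cov2 g K y) a b c = 0)
    (hKd : ∀ a b, DifferentiableAt ℝ (fun z => K z a b) y)
    (hLd : ∀ a b c, DifferentiableAt ℝ (fun z => L z a b c) y) (hp : dot g y p p < 0) :
    ((fun S => rate g (quadInv K L) (y, p, S))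
      =O[𝓝[{S | IsSpin g y p S}] 0] fun S => ‖S‖ ^ 2)
    ↔ ∀ S, IsSpin g y p S → spinForm (vTensor g K L y) S p = 0 := by
  have h := isBigO_rate hKs hK hKd hLd hp
  have hm := (mass_pos hp).ne'
  constructor
  · intro hr S hS
    have h1 : (fun S => (mass g y p)⁻¹ * spinForm (vTensor g K L y) S p)
        =O[𝓝[{S | IsSpin g y p S}] 0] fun S => ‖S‖ ^ 2 :=
      (hr.sub h).congr_left fun S => by ring
    have hs : ∀ t : ℝ, spinForm (vTensor g K L y) (t • S) p
        = t * spinForm (vTensor g K L y) S p := by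
      intro t
      simp only [spinForm, Pi.smul_apply, smul_eq_mul, Finset.mul_sum]
      exact Finset.sum_congr rfl fun _ _ => Finset.sum_congr rfl fun _ _ =>
        Finset.sum_congr rfl fun _ _ => Finset.sum_congr rfl fun _ _ => by ring
    -- The spin conditions are linear, so the whole ray through an admissible spin stays admissible
    -- and the estimate can be restricted to it.
    have ht : Filter.Tendsto (fun t : ℝ => t • S) (𝓝[≠] 0) (𝓝[{S | IsSpin g y p S}] 0) := by
      refine tendsto_nhdsWithin_iff.2 ⟨?_, Filter.Eventually.of_forall fun t => ?_⟩
      · have : Continuous fun t : ℝ => t • S := by fun_prop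
        have h0 := this.tendsto 0
        rw [zero_smul] at h0
        exact h0.mono_left nhdsWithin_le_nhds
      · refine ⟨fun α β => ?_, fun α => ?_⟩
        · simp only [Pi.smul_apply, smul_eq_mul, hS.1 α β, mul_neg]
        · have := hS.2 α
          simp only [← Finset.mul_sum] at this
          simp only [Pi.smul_apply, smul_eq_mul, mul_assoc, ← Finset.mul_sum, this, mul_zero]
    have h2 := h1.comp_tendsto ht
    set c := (mass g y p)⁻¹ * spinForm (vTensor g K L y) S p with hc
    have h3 : (fun t : ℝ => t * c) =O[𝓝[≠] 0] fun t : ℝ => t * t := by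
      have e : ((fun S => (mass g y p)⁻¹ * spinForm (vTensor g K L y) S p) ∘ fun t : ℝ => t • S)
          = fun t => t * c := by
        funext t; simp only [Function.comp, hs, hc]; ring
      rw [e] at h2
      refine h2.trans ?_
      refine IsBigO.of_bound (‖S‖ ^ 2) (Filter.Eventually.of_forall fun t => ?_)
      simp only [Function.comp, norm_smul, norm_mul, norm_pow, norm_norm]
      apply le_of_eq; ring
    -- Dividing by t turns the quadratic bound into a constant bounded by a multiple of t, which
    -- must be zero.
    have h4 : (fun _ : ℝ => c) =O[𝓝[≠] 0] fun t : ℝ => t := by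
      have h5 := (isBigO_refl (fun t : ℝ => t⁻¹) (𝓝[≠] 0)).mul h3
      refine h5.congr' ?_ ?_
      · filter_upwards [self_mem_nhdsWithin] with t ht
        rw [← mul_assoc, inv_mul_cancel₀ ht, one_mul]
      · filter_upwards [self_mem_nhdsWithin] with t ht
        rw [← mul_assoc, inv_mul_cancel₀ ht, one_mul]
    have h6 : Filter.Tendsto (fun _ : ℝ => c) (𝓝[≠] 0) (𝓝 0) :=
      h4.trans_tendsto (Filter.tendsto_id.mono_left nhdsWithin_le_nhds)
    have h7 := tendsto_nhds_unique h6 tendsto_const_nhds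
    rw [hc] at h7
    exact (mul_eq_zero.1 h7.symm).resolve_left (inv_ne_zero hm)
  · intro h0
    refine h.congr' ?_ Filter.EventuallyEq.rfl
    filter_upwards [self_mem_nhdsWithin] with S hS
    rw [h0 S hS]; ring

end Local

/-! ## The invariants in an adapted frame -/

section Local

variable {U : Set Coord} {g : F2} {y p : Coord} {A : Matrix Idx Idx ℝ} {s : Idx → Idx → ℝ}

theorem quadInv_push2 (K : F2) {L : F3} (hp : dot g y p p < 0)
    (hA0 : ∀ α, A α 0 = phat g y p α) (hs : ∀ a b, s a b = -s b a) (hs0 : ∀ a, s a 0 = 0)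
    (hL : ∀ a b c, L y a b c = -L y b a c) :
    quadInv K L (y, p, push2 A s) = (∑ μ, ∑ ν, K y μ ν * p μ * p ν) + 2 * mass g y p
      * (s 1 2 * pull3 A (L y) 1 2 0 + s 1 3 * pull3 A (L y) 1 3 0
        + s 2 3 * pull3 A (L y) 2 3 0) := by
  have e : ∀ μ ν, ∑ ρ, L y μ ν ρ * push2 A s μ ν * p ρ
      = push2 A s μ ν * (mass g y p * pull1 A (fun ρ => L y μ ν ρ) 0) := by
    intro μ ν
    simp only [pull1, Finset.mul_sum]
    exact Finset.sum_congr rfl fun ρ _ => by rw [phat_spec hp hA0 ρ]; ring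
  have e2 : ∀ a b, pull2 A (fun μ ν => mass g y p * pull1 A (fun ρ => L y μ ν ρ) 0) a b
      = mass g y p * pull3 A (L y) a b 0 := by
    intro a b; rw [pull3_eq', pull2_eq, pull2_eq]; simp only [pull1_mul_left]
  have z : ∀ a, s 0 a = 0 := fun a => by rw [hs, hs0, neg_zero]
  have d : ∀ a, s a a = 0 := fun a => self_eq_neg.1 (hs a a)
  have ha := pull3_antisymm A hL
  simp only [quadInv, e]
  rw [sum_push2]
  simp only [e2, Fin.sum_univ_four, z, hs0, d, hs 2 1, hs 3 1, hs 3 2, ha 2 1, ha 3 1, ha 3 2]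
  ring

/-- In an adapted frame the spin vector is, up to sign, the spatial dual of the bivector `s`. -/
theorem IsFrame.sum_spinVec (hA : IsFrame (g y) A) (hg : LocMetric U g) (hy : y ∈ U)
    (hA0 : ∀ α, A α 0 = phat g y p α) (hs : ∀ a b, s a b = -s b a) (T : Idx → ℝ) :
    ∑ α, T α * spinVec g y p (push2 A s) α
      = -(pull1 A T 1 * s 2 3) + pull1 A T 2 * s 1 3 - pull1 A T 3 * s 1 2 := by
  set E : Idx → ℝ := fun k => ∑ β, ∑ γ, ∑ δ, eps g y k β γ δ * phat g y p β
    * push2 A s γ δ with hE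
  have e1 : ∑ α, T α * spinVec g y p (push2 A s) α
      = (1 / 2) * ∑ α, ∑ k, ginv g y α k * T α * E k := by
    simp only [spinVec, hE, Finset.mul_sum]
    exact Finset.sum_congr rfl fun _ _ => Finset.sum_congr rfl fun _ _ =>
      Finset.sum_congr rfl fun _ _ => Finset.sum_congr rfl fun _ _ =>
      Finset.sum_congr rfl fun _ _ => by ring
  have e2 : ∀ a, pull1 A E a = ∑ c, ∑ d, s c d * permSymbol a 0 c d := by
    intro a
    have h1 : E = fun k => ∑ c, ∑ d, s c d * pull3 A (fun β γ δ => eps g y k β γ δ) 0 c d := by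
      funext k
      simp only [hE, pull3_eq]
      have : ∀ β, ∑ γ, ∑ δ, eps g y k β γ δ * phat g y p β * push2 A s γ δ
          = A β 0 * ∑ c, ∑ d, s c d * pull2 A (fun γ δ => eps g y k β γ δ) c d := by
        intro β
        rw [← sum_push2, hA0]
        simp only [Finset.mul_sum]
        exact Finset.sum_congr rfl fun _ _ => Finset.sum_congr rfl fun _ _ => by ring
      simp only [this]
      have := pull1_sum A (fun c β => ∑ d, s c d * pull2 A (fun γ δ => eps g y k β γ δ) c d) 0
      rw [pull1] at this
      rw [this]
      simp only [pull1_sum, pull1_mul_left]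
    rw [h1]
    simp only [pull1_sum, pull1_mul_left]
    refine Finset.sum_congr rfl fun c _ => Finset.sum_congr rfl fun d _ => ?_
    have := (hA.rel hg hy).pull4_eps a 0 c d
    rw [eps_mink, pull4_eq] at this
    rw [this]
  have z : ∀ a, s a a = 0 := fun a => self_eq_neg.1 (hs a a)
  rw [e1, hA.ginv_contr hg hy]
  simp only [e2, Fin.sum_univ_four, z, hs 1 0, hs 2 0, hs 3 0, hs 2 1, hs 3 1, hs 3 2, sgn]
  simp [permSymbol_eq, det4, Pi.single_apply]
  ring

theorem IsFrame.mixedInv_push2 (hA : IsFrame (g y) A) (hg : LocMetric U g) (hy : y ∈ U)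
    (hA0 : ∀ α, A α 0 = phat g y p α) (hs : ∀ a b, s a b = -s b a) (T : F3) :
    mixedInv g T (y, p, push2 A s) = 2 * mass g y p * (-(pull3 A (T y) 1 0 0 * s 2 3)
      + pull3 A (T y) 2 0 0 * s 1 3 - pull3 A (T y) 3 0 0 * s 1 2) := by
  have e : ∀ a, pull3 A (T y) a 0 0
      = pull1 A (fun α => ∑ β, ∑ γ, T y α β γ * phat g y p β * phat g y p γ) a := by
    intro a
    rw [pull3_eq]
    congr 1; funext α
    simp only [pull2, hA0]
    exact Finset.sum_congr rfl fun _ _ => Finset.sum_congr rfl fun _ _ => by ring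
  rw [e, e, e, ← hA.sum_spinVec hg hy hA0 hs, mixedInv]
  congr 1
  simp only [Finset.sum_mul]
  exact Finset.sum_congr rfl fun _ _ => Finset.sum_congr rfl fun _ _ =>
    Finset.sum_congr rfl fun _ _ => by ring

theorem mixedInv_symLast (g : F2) (T : F3) (y p : Coord) (S : Biv) :
    mixedInv g (symLast T) (y, p, S) = mixedInv g T (y, p, S) := by
  have h : ∀ α, ∑ β, ∑ γ, T y α γ β * spinVec g y p S α * phat g y p β * phat g y p γ
      = ∑ β, ∑ γ, T y α β γ * spinVec g y p S α * phat g y p β * phat g y p γ := by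
    intro α
    rw [Finset.sum_comm]
    exact Finset.sum_congr rfl fun _ _ => Finset.sum_congr rfl fun _ _ => by ring
  simp only [mixedInv, symLast]
  congr 1
  refine Finset.sum_congr rfl fun α _ => ?_
  have e : ∀ β γ, 1 / 2 * (T y α β γ + T y α γ β) * spinVec g y p S α * phat g y p β
      * phat g y p γ = (1 / 2) * (T y α β γ * spinVec g y p S α * phat g y p β * phat g y p γ)
        + (1 / 2) * (T y α γ β * spinVec g y p S α * phat g y p β * phat g y p γ) := by
    intros; ring
  simp only [e, Finset.sum_add_distrib, ← Finset.mul_sum, h]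
  ring

theorem mixedInv_congr {T T' : F3} (h : ∀ a b c, T y a b c = T' y a b c) (S : Biv) :
    mixedInv g T (y, p, S) = mixedInv g T' (y, p, S) := by
  simp only [mixedInv, h]

/-- The invariant that is linear in the spin, in terms of the left dual. -/
theorem LocMetric.quadInv_zero_eq (hg : LocMetric U g) (hy : y ∈ U) {L : F3}
    (hL : ∀ a b c, L y a b c = -L y b a c) (hp : dot g y p p < 0) {S : Biv}
    (hS : IsSpin g y p S) :
    quadInv 0 L (y, p, S) = mixedInv g (symLast (star3 g L)) (y, p, S) := by
  obtain ⟨A, hA, hA0⟩ := hg.exists_adapted_frame hy hp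
  obtain ⟨s, hs, hs0, rfl⟩ := hA.exists_push2 hp hA0 hS
  have ha := pull3_antisymm A hL
  rw [mixedInv_symLast, hA.mixedInv_push2 hg hy hA0 hs, quadInv_push2 0 hp hA0 hs hs0 hL]
  simp only [hA.pull3_star3 hg hy]
  simp [etaStar, ha 3 2, ha 3 1, ha 2 1]
  left; ring

/-- A tensor of mixed symmetry is determined by its invariant. -/
theorem LocMetric.eq_zero_of_mixedInv (hg : LocMetric U g) (hy : y ∈ U) {T N : F3}
    (hN : ∀ a b c, N y a b c = -N y b a c) (hT : ∀ a b c, T y a b c = symLast N y a b c)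
    (h : ∀ p, dot g y p p < 0 → ∀ S, IsSpin g y p S → mixedInv g T (y, p, S) = 0)
    (a b c : Idx) : T y a b c = 0 := by
  have key := hg.sym2_eq_zero hy (T := T y) (fun p hp A hA hA0 i => ?_) a b c
  · have : T y a c b = T y a b c := by rw [hT, hT]; simp only [symLast]; ring
    linarith
  have hm := (mass_pos hp).ne'
  have hv : ∀ s : Idx → Idx → ℝ, (∀ a b, s a b = -s b a) → (∀ a, s a 0 = 0) →
      -(pull3 A (T y) 1 0 0 * s 2 3) + pull3 A (T y) 2 0 0 * s 1 3
        - pull3 A (T y) 3 0 0 * s 1 2 = 0 := by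
    intro s hs hs0
    have := h p hp _ (hA.isSpin_push2 (phat_spec hp hA0) hs hs0)
    rw [hA.mixedInv_push2 hg hy hA0 hs] at this
    exact (mul_eq_zero.1 this).resolve_left (mul_ne_zero two_ne_zero hm)
  fin_cases i
  -- The spin vector has no time component, so the invariant says nothing about T_{000}; that
  -- component vanishes by the antisymmetry of N.
  · have e : T y = fun a b c => (1 / 2) * (N y a b c + N y a c b) := by
      funext a b c; exact hT a b c
    have e0 := pull3_antisymm A hN 0 0 0
    have e1 : pull3 A (T y) 0 0 0 = (1 / 2) * (pull3 A (N y) 0 0 0 + pull3 A (N y) 0 0 0) := by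
      rw [e]
      nth_rw 3 [← pull3_swap₂₃]
      simp only [pull3_eq, pull2_eq, pull1_mul_left, pull1_add]
    change pull3 A (T y) 0 0 0 = 0
    rw [e1]; linarith
  -- Each unit spatial bivector picks out one of the three spatial components.
  · have := hv (bivTab 0 0 0 0 0 1) (by intro a b; fin_cases a <;> fin_cases b <;> simp [bivTab])
      (by intro a; fin_cases a <;> simp [bivTab])
    simpa [bivTab] using this
  · have := hv (bivTab 0 0 0 0 1 0) (by intro a b; fin_cases a <;> fin_cases b <;> simp [bivTab])
      (by intro a; fin_cases a <;> simp [bivTab])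
    simpa [bivTab] using this
  · have := hv (bivTab 0 0 0 1 0 0) (by intro a b; fin_cases a <;> fin_cases b <;> simp [bivTab])
      (by intro a; fin_cases a <;> simp [bivTab])
    simpa [bivTab] using this

end Local

/-! ## Rüdiger's invariant in an adapted frame -/

theorem pull3_sub (A : Matrix Idx Idx ℝ) (T S : Idx → Idx → Idx → ℝ) (a b c : Idx) :
    pull3 A (fun α β γ => T α β γ - S α β γ) a b c = pull3 A T a b c - pull3 A S a b c := by
  simp only [pull3_eq, pull2_eq, pull1_sub]

section Frame

variable {U : Set Coord} {g : F2} {y p : Coord} {A : Matrix Idx Idx ℝ} (hA : IsFrame (g y) A)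
  (hg : LocMetric U g) (hy : y ∈ U)
include hA hg hy

theorem IsFrame.pull1_grad_kyScalar {Y : F2} (hY : ∀ a b, Sm U fun z => Y z a b) (c : Idx) :
    pull1 A (grad (kyScalar g Y) y) c = (1 / 4) *
      (ctr (pull2 A (Y y)) (etaStar fun a b => pull3 A (cov2 g Y y) a b c)
        + ctr (fun a b => pull3 A (cov2 g Y y) a b c) (etaStar (pull2 A (Y y)))) := by
  have e : grad (kyScalar g Y) y = fun c => (1 / 4) *
      (∑ k, ∑ l, sgn k * sgn l * pull2 A (Y y) k l
          * pull2 A (fun i j => star3 g (cov2 g Y) y i j c) k l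
        + ∑ k, ∑ l, sgn k * sgn l * pull2 A (fun i j => cov2 g Y y i j c) k l
          * pull2 A (star2 g Y y) k l) := by
    funext c
    rw [grad, hg.pd_kyScalar hy hY, hA.contr2 hg hy, hA.contr2 hg hy]; rfl
  rw [e]
  simp only [pull1_mul_left, pull1_add, pull1_sum, pull1_mul_right]
  simp only [← pull3_eq_last, hA.pull3_star3 hg hy, hA.pull2_star2 hg hy]
  rfl

theorem IsFrame.pull1_kyXi {Y : F2} (hY : ∀ a b, Sm U fun z => Y z a b) (c : Idx) :
    pull1 A (kyXi g Y y) c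
      = -(1 / 3) * ∑ k, sgn k * etaStar (fun i j => pull3 A (cov2 g Y y) i j k) k c := by
  have e : kyXi g Y y = fun c => -(1 / 3) *
      ∑ k, sgn k * pull2 A (fun i j => star3 g (cov2 g Y) y i c j) k k := by
    funext c
    simp only [kyXi, hg.cov2_star2 hy hY]
    rw [(hA.rel hg hy).ginv_trace, sum_ginv_mink 0 (pull2 A _)]
  rw [e]
  simp only [pull1_mul_left, pull1_sum]
  congr 1
  refine Finset.sum_congr rfl fun k _ => ?_
  rw [← hA.pull3_star3 hg hy, ← pull3_swap₂₃, pull3_eq_last]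

theorem IsFrame.pull3_cov2_kySquare {Y : F2} (hY : LocKY U g Y) (a b c : Idx) :
    pull3 A (cov2 g (kySquare g Y) y) a b c = ∑ k, sgn k
      * (pull3 A (cov2 g Y y) a k c * pull2 A (Y y) k b
        + pull2 A (Y y) a k * pull3 A (cov2 g Y y) k b c) := by
  have e : cov2 g (kySquare g Y) y = kyCov g Y (cov2 g Y) y := by
    funext a b c; exact hY.cov2_eq_kyCov hg hy a b c
  rw [e, (hA.rel hg hy).pull3_kyCov (Y := fun _ => pull2 A (Y y))
    (dY := fun _ => pull3 A (cov2 g Y y)) (fun _ _ => rfl) (fun _ _ _ => rfl), kyCov]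
  simp only [ginv_mink, mul_ite, ite_mul, mul_zero, zero_mul, Finset.sum_add_distrib,
    Finset.sum_ite_eq, Finset.mem_univ, if_true, mul_add]
  congr 1 <;> exact Finset.sum_congr rfl fun _ _ => by ring

end Frame

section KY

variable {U : Set Coord} {g Y : F2} {y p : Coord}

/-- Antisymmetry of Y turns one factor around, which produces the minus sign in front of L_α L^α. -/
theorem LocKY.sum_kySquare (hY : LocKY U g Y) (hy : y ∈ U) :
    ∑ μ, ∑ ν, kySquare g Y y μ ν * p μ * p ν
      = -(∑ α, ∑ β, ginv g y α β * lVec Y y p α * lVec Y y p β) := by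
  simp only [kySquare, Finset.sum_mul]
  rw [sum_pair_comm, ← Finset.sum_neg_distrib]
  refine Finset.sum_congr rfl fun k _ => ?_
  rw [← Finset.sum_neg_distrib]
  refine Finset.sum_congr rfl fun l _ => ?_
  simp only [lVec, Fin.sum_univ_four, fun a => hY.antisymm y hy a k]
  ring

/-- The algebraic identity behind the form of Rüdiger's invariant. -/
theorem rudiger_identity {F : Idx → Idx → Idx → ℝ} {Y s : Idx → Idx → ℝ}
    (hY : ∀ a b, Y a b = -Y b a) (hF₁ : ∀ a b c, F a b c = -F b a c)
    (hF₂ : ∀ a b c, F a b c = -F a c b) {Z lam : Idx → ℝ} {x : ℝ}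
    {k : Idx → Idx → Idx → ℝ}
    (hZ : ∀ c, Z c = (1 / 4) * (ctr Y (etaStar fun a b => F a b c)
      + ctr (fun a b => F a b c) (etaStar Y)))
    (hx : x = -(1 / 3) * ∑ k, sgn k * etaStar (fun i j => F i j k) k 0)
    (hk : ∀ a b c, k a b c = ∑ m, sgn m * (F a m c * Y m b + Y a m * F m b c))
    (hl : ∀ a, lam a = etaStar (fun i j => k j 0 i - k i 0 j) a 0) :
    (2 / 3) * (-(Z 1 * s 2 3) + Z 2 * s 1 3 - Z 3 * s 1 2)
      - 2 * (-(Y 1 0 * s 2 3) + Y 2 0 * s 1 3 - Y 3 0 * s 1 2) * x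
      - (2 / 3) * (-(lam 1 * s 2 3) + lam 2 * s 1 3 - lam 3 * s 1 2) = 0 := by
  have eY := eq_bivTab hY
  have eF := eq_triTab hF₁ hF₂
  clear hY hF₁ hF₂
  generalize Y 0 1 = y₀₁, Y 0 2 = y₀₂, Y 0 3 = y₀₃, Y 1 2 = y₁₂, Y 1 3 = y₁₃, Y 2 3 = y₂₃ at eY
  generalize F 0 1 2 = f₀₁₂, F 0 1 3 = f₀₁₃, F 0 2 3 = f₀₂₃, F 1 2 3 = f₁₂₃ at eF
  subst eY eF
  simp only [hZ, hx, hl, hk, ctr, etaStar, Fin.sum_univ_four, bivTab, triTab, sgn,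
    Matrix.cons_val, Pi.neg_apply, Pi.zero_apply]
  ring

variable {L : F3}

/-- The decomposition of a quadratic invariant into Rüdiger's invariant and a mixed-symmetry
tensor. -/
theorem LocKY.quadInv_eq (hY : LocKY U g Y) (hg : LocMetric U g) (hy : y ∈ U)
    (hL : ∀ a b c, L y a b c = -L y b a c) (hp : dot g y p p < 0) {S : Biv}
    (hS : IsSpin g y p S) : quadInv (kySquare g Y) L (y, p, S)
      = rudiger g Y (y, p, S) + mixedInv g (symLast (starW g Y L)) (y, p, S) := by
  obtain ⟨A, hA, hA0⟩ := hg.exists_adapted_frame hy hp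
  obtain ⟨s, hs, hs0, rfl⟩ := hA.exists_push2 hp hA0 hS
  have ha := pull3_antisymm A hL
  have hm := (mass_pos hp).ne'
  rw [mixedInv_congr (hg.symLast_starW hy hL Y), mixedInv_symLast,
    hA.mixedInv_push2 hg hy hA0 hs, quadInv_push2 _ hp hA0 hs hs0 hL, hY.sum_kySquare hy]
  set lam := lamT g (kySquare g Y) with hlam
  have hW : ∀ a : Idx, a ≠ 0 → pull3 A (fun a b c => star3 g L y a b c - 1 / 3 * star3 g lam y a b c
      - 4 / 3 * wedge g (grad (kyScalar g Y)) y a b c) a 0 0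
      = etaStar (fun i j => pull3 A (L y) i j 0) a 0
        - 1 / 3 * etaStar (fun i j => pull3 A (lam y) i j 0) a 0
        + 4 / 3 * pull1 A (grad (kyScalar g Y) y) a := by
    intro a ha0
    have hw : pull3 A (wedge g (grad (kyScalar g Y)) y) a 0 0
        = -pull1 A (grad (kyScalar g Y) y) a := by
      rw [(hA.rel hg hy).pull3_wedge (v := fun _ => pull1 A (grad (kyScalar g Y) y))
        (fun _ => rfl), wedge, mink, mink, if_pos rfl, if_neg ha0]
      simp [sgn]
    rw [pull3_sub, pull3_sub, pull3_cmul, pull3_cmul, hA.pull3_star3 hg hy,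
      hA.pull3_star3 hg hy, hw]
    ring
  have hl : ∀ a, etaStar (fun i j => pull3 A (lam y) i j 0) a 0
      = etaStar (fun i j => pull3 A (cov2 g (kySquare g Y) y) j 0 i
        - pull3 A (cov2 g (kySquare g Y) y) i 0 j) a 0 := by
    intro a
    congr 1; funext i j
    have e : lam y = fun a b c => cov2 g (kySquare g Y) y b c a - cov2 g (kySquare g Y) y a c b :=
      rfl
    rw [e, pull3_sub, pull3_swap₂₃ A (fun a c b => cov2 g (kySquare g Y) y a c b),
      pull3_swap₁₂ A (fun b a c => cov2 g (kySquare g Y) y b c a),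
      pull3_swap₂₃ A (fun b c a => cov2 g (kySquare g Y) y b c a)]
  have hYa : ∀ a b, pull2 A (Y y) a b = -pull2 A (Y y) b a := by
    intro a b
    rw [← pull2_swap A _ a b]
    have e : (fun α β => Y y β α) = fun α β => -Y y α β := by
      funext α β; exact hY.antisymm y hy β α
    rw [e]
    simp only [pull2_eq, pull1_neg, neg_neg]
  have hF₁ := pull3_antisymm A (fun a b c => hY.cov2_antisymm hg hy a b c)
  have hF₂ : ∀ a b c, pull3 A (cov2 g Y y) a b c = -pull3 A (cov2 g Y y) a c b := by
    intro a b c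
    rw [← pull3_swap₂₃ A _ a b c, ← pull3_neg]
    congr 1; funext a b c
    rw [hY.cov2_cyc hg hy, hY.cov2_antisymm hg hy, hY.cov2_cyc hg hy, hY.cov2_cyc hg hy]
  have key := rudiger_identity (s := s) hYa hF₁ hF₂ (hA.pull1_grad_kyScalar hg hy hY.smooth)
    (hA.pull1_kyXi hg hy hY.smooth 0) (hA.pull3_cov2_kySquare hg hy hY) hl
  have h1 : ∑ α, spinVec g y p (push2 A s) α * grad (kyScalar g Y) y α
      = ∑ α, grad (kyScalar g Y) y α * spinVec g y p (push2 A s) α :=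
    Finset.sum_congr rfl fun _ _ => mul_comm _ _
  have h2 : ∀ a, pull1 A (lVec Y y p) a = mass g y p * pull2 A (Y y) a 0 := by
    intro a
    have : lVec Y y p = fun α => mass g y p * pull1 A (fun l => Y y α l) 0 := by
      funext α
      simp only [lVec, pull1, Finset.mul_sum]
      exact Finset.sum_congr rfl fun l _ => by rw [phat_spec hp hA0 l]; ring
    rw [this, pull1_mul_left, pull2_eq]
  have h3 : ∑ β, kyXi g Y y β * p β = mass g y p * pull1 A (kyXi g Y y) 0 := by
    simp only [pull1, Finset.mul_sum]
    exact Finset.sum_congr rfl fun β _ => by rw [phat_spec hp hA0 β]; ring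
  simp only [rudiger]
  rw [h1, hA.sum_spinVec hg hy hA0 hs, hA.sum_spinVec hg hy hA0 hs, h2, h2, h2, h3, hW 1 (by simp),
    hW 2 (by simp), hW 3 (by simp)]
  have e1 : etaStar (fun i j => pull3 A (L y) i j 0) 1 0 = -pull3 A (L y) 2 3 0 := by
    simp [etaStar, ha 3 2]; ring
  have e2 : etaStar (fun i j => pull3 A (L y) i j 0) 2 0 = pull3 A (L y) 1 3 0 := by
    simp [etaStar, ha 3 1]; ring
  have e3 : etaStar (fun i j => pull3 A (L y) i j 0) 3 0 = -pull3 A (L y) 1 2 0 := by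
    simp [etaStar, ha 2 1]; ring
  rw [e1, e2, e3]
  field_simp
  linear_combination (-(3 : ℝ) * mass g y p) * key

end KY

/-! ## The fields of the reduction on the manifold -/

section Fields

variable {M : Type*} [TopologicalSpace M] [ChartedSpace Coord M]

theorem IsTensor3.wOf {g : Chart M → F2} (hg : IsLorentzMetric g) (hor : IsOriented M)
    {D : Chart M → F3} {A : Chart M → F1} (hD : IsTensor3 D) (hA : IsTensor1 A) :
    IsTensor3 fun e => wOf (g e) (D e) (A e) :=
  (hD.sub ((hA.wedge hg hor).star3 hg hor)).congr fun _ he _ hy a b c =>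
    (hg.loc he).wOf_eq hy _ _ a b c

theorem IsTensor3.traceFree {g : Chart M → F2} (hg : IsLorentzMetric g) (hor : IsOriented M)
    {T : Chart M → F3} (hT : IsTensor3 T) : IsTensor3 fun e => traceFree (g e) (T e) :=
  hT.sub ((hT.traceVec hg hor).wedge hg hor)

theorem IsAntisymmFirst.star3 {g : Chart M → F2} (hg : IsLorentzMetric g) (hor : IsOriented M)
    {T : Chart M → F3} (hT : IsTensor3 T) : IsAntisymmFirst fun e => star3 (g e) (T e) :=
  ⟨hT.star3 hg hor, fun _ _ _ _ _ _ _ => star3_antisymm _ _ _ _ _ _⟩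

theorem IsAntisymmFirst.wOf {g : Chart M → F2} (hg : IsLorentzMetric g) (hor : IsOriented M)
    {D : Chart M → F3} {A : Chart M → F1} (hD : IsAntisymmFirst D) (hA : IsTensor1 A) :
    IsAntisymmFirst fun e => wOf (g e) (D e) (A e) where
  tensor := hD.tensor.wOf hg hor hA
  antisymm e he y hy a b c := by
    rw [(hg.loc he).wOf_eq hy, (hg.loc he).wOf_eq hy, hD.antisymm e he y hy a b c,
      star3_antisymm _ _ _ a b c]
    ring

theorem IsTraceFree.traceVec {g : Chart M → F2} {D : Chart M → F3} (hD : IsTraceFree g D)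
    {e : Chart M} (he : e ∈ atlas Coord M) {y : Coord} (hy : y ∈ e.target) (a : Idx) :
    traceVec (g e) (D e) y a = 0 := by
  rw [SpinKY.traceVec, hD.trace e he y hy a, mul_zero]

theorem IsTraceFree.wOf {g : Chart M → F2} (hg : IsLorentzMetric g) (hor : IsOriented M)
    {D : Chart M → F3} {A : Chart M → F1} (hD : IsTraceFree g D) (hA : IsTensor1 A) :
    IsTraceFree g fun e => wOf (g e) (D e) (A e) where
  toIsAntisymmFirst := hD.toIsAntisymmFirst.wOf hg hor hA
  trace e he y hy a := by
    have h1 := hD.trace e he y hy a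
    have h2 := (hg.loc he).traceVec_of_antisymm hy ((hg.loc he).star3_wedge_swap hy (A e)) a
    simp only [SpinKY.traceVec] at h2
    simp only [(hg.loc he).wOf_eq hy, mul_sub, Finset.sum_sub_distrib]
    linarith

theorem IsTraceFreeHook.zero (g : Chart M → F2) : IsTraceFreeHook g 0 where
  tensor := IsTensor3.zero
  antisymm _ _ _ _ _ _ _ := by simp
  trace _ _ _ _ _ := by simp
  hook _ _ _ _ _ _ _ := by simp [alt3]

/-- With Y = 0 both K and Rüdiger's invariant vanish, so the invariants that are linear in the spin
become a special case of the general correspondence. -/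
theorem IsKillingYano.zero (g : Chart M → F2) : IsKillingYano g 0 where
  tensor := ⟨fun _ _ _ _ => Sm.const 0, fun _ _ _ _ _ _ _ _ => by simp⟩
  antisymm _ _ _ _ _ _ := by simp
  killing _ _ _ _ _ _ _ := by simp [cov2, pd]

theorem kySquare_zero (g : F2) : kySquare g 0 = 0 := by
  funext y a b
  simp [kySquare]

theorem rudiger_zero (g : F2) : rudiger g 0 = 0 := by
  have h : kyScalar g 0 = fun _ => 0 := by
    funext y
    simp [kyScalar, star2]
  funext ⟨y, p, S⟩
  simp [rudiger, lVec, h, grad, pd]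

variable [IsManifold 𝓘(ℝ, Coord) ∞ M] {g Y : Chart M → F2} {L : Chart M → F3}

theorem IsKillingYano.xTilde_tensor (hY : IsKillingYano g Y) (hg : IsLorentzMetric g)
    (hor : IsOriented M) (hL : IsTensor3 L) :
    IsTensor3 fun e => xTilde (g e) (kySquare (g e) (Y e)) (L e) :=
  ((hL.sub ((hY.lamT_tensor hg hor).cmul (1 / 3))).add
    ((((hY.tensor.kySquare hg hor).grad_trK hg hor).wedge hg hor).cmul (1 / 6))).congr
    fun _ he _ hy a b c => (hg.loc he).xTilde_eq hy _ _ a b c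

theorem IsKillingYano.xHook_tensor (hY : IsKillingYano g Y) (hg : IsLorentzMetric g)
    (hor : IsOriented M) (hL : IsTensor3 L) :
    IsTensor3 fun e => xHook (g e) (kySquare (g e) (Y e)) (L e) :=
  (hY.xTilde_tensor hg hor hL).sub (hY.xTilde_tensor hg hor hL).alt3

theorem IsKillingYano.xVec_tensor (hY : IsKillingYano g Y) (hg : IsLorentzMetric g)
    (hor : IsOriented M) (hL : IsTensor3 L) :
    IsTensor1 fun e => xVec (g e) (kySquare (g e) (Y e)) (L e) :=
  (((hY.xTilde_tensor hg hor hL).cyc.star3 hg hor).traceVec hg hor).congr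
    fun _ he _ hy a => (hg.loc he).xVec_eq hy _ _ a

theorem IsKillingYano.yVec_tensor (hY : IsKillingYano g Y) (hg : IsLorentzMetric g)
    (hor : IsOriented M) (hL : IsTensor3 L) : IsTensor1 fun e => yVec (g e) (Y e) (L e) :=
  ((hY.xVec_tensor hg hor hL).add ((hY.tensor.grad_kyScalar hg hor).cmul (-(4 / 3)))).congr
    fun _ _ _ _ _ => by rw [yVec]; ring

theorem IsKillingYano.dTf_traceFreeHook (hY : IsKillingYano g Y) (hg : IsLorentzMetric g)
    (hor : IsOriented M) (hL : IsAntisymmFirst L) :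
    IsTraceFreeHook g fun e => dTf (g e) (Y e) (L e) where
  tensor := (hY.xHook_tensor hg hor hL.tensor).traceFree hg hor
  antisymm e he y hy := (hg.loc he).dTf_antisymm hy (hL.antisymm e he y hy) (Y e)
  trace e he y hy a := by
    have h := (hg.loc he).traceVec_dTf (L := L e) hy (Y e) a
    rw [traceVec] at h
    linarith
  hook e he y hy := (hg.loc he).dTf_hook hy (Y e)

theorem IsKillingYano.wOfL_traceFree (hY : IsKillingYano g Y) (hg : IsLorentzMetric g)
    (hor : IsOriented M) (hL : IsAntisymmFirst L) :
    IsTraceFree g fun e => wOfL (g e) (Y e) (L e) :=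
  (hY.dTf_traceFreeHook hg hor hL).toIsTraceFree.wOf hg hor (hY.yVec_tensor hg hor hL.tensor)

theorem IsKillingYano.starW_antisymmFirst (hY : IsKillingYano g Y) (hg : IsLorentzMetric g)
    (hor : IsOriented M) (hL : IsAntisymmFirst L) :
    IsAntisymmFirst fun e => starW (g e) (Y e) (L e) :=
  IsAntisymmFirst.star3 hg hor (hY.wOfL_traceFree hg hor hL).tensor

theorem IsKillingYano.recon_antisymmFirst (hY : IsKillingYano g Y) (hg : IsLorentzMetric g)
    (hor : IsOriented M) {D : Chart M → F3} {A : Chart M → F1} (hD : IsAntisymmFirst D)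
    (hA : IsTensor1 A) : IsAntisymmFirst fun e => recon (g e) (Y e) (D e) (A e) where
  tensor :=
    ((hD.tensor.add ((hY.lamT_tensor hg hor).cmul (1 / 3))).sub
      (((hA.add ((hY.tensor.grad_kyScalar hg hor).cmul (4 / 3))).wedge hg hor).star3
        hg hor)).congr fun _ he _ hy a b c => (hg.loc he).recon_eq hy a b c
  antisymm e he y hy := (hg.loc he).recon_antisymm hy (hD.antisymm e he y hy)

theorem IsKillingYano.kySquare_killing (hY : IsKillingYano g Y) (hg : IsLorentzMetric g)
    (hor : IsOriented M) : IsKillingTensor g fun e => kySquare (g e) (Y e) where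
  tensor := hY.tensor.kySquare hg hor
  symm _ he _ hy := (hY.loc he).kySquare_symm (hg.loc he) hy
  killing e he y hy a b c := by
    have h := (hY.loc he).cov2_kySquare_cyc (hg.loc he) hy a b c
    have s := (hY.loc he).cov2_kySquare_symm (hg.loc he) hy
    rw [sym3, s a c b, s b a c, s c b a]
    linarith

/-! ## Quasi-invariants -/

theorem IsKillingYano.isQuasiInvariant_iff (hY : IsKillingYano g Y) (hg : IsLorentzMetric g)
    (hor : IsOriented M) (hL : IsTensor3 L) :
    IsQuasiInvariant g (fun e => quadInv (kySquare (g e) (Y e)) (L e)) ↔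
      Vanishes4 fun e => constraintV (g e) (kySquare (g e) (Y e)) (L e) := by
  have hK := hY.kySquare_killing hg hor
  refine forall₂_congr fun e he => forall₂_congr fun y hy => ?_
  refine Iff.trans ?_ ((hg.loc he).spinForm_eq_zero_iff hy
    (vTensor (g e) (kySquare (g e) (Y e)) (L e)))
  exact forall₂_congr fun p hp => isBigO_rate_iff (hK.symm e he y hy) (hK.killing e he y hy)
    (fun a b => Sm.diff (hK.tensor.smooth e he a b) e.open_target hy)
    (fun a b c => Sm.diff (hL.smooth e he a b c) e.open_target hy) hp

/-- The four constraint tensors coincide component by component; the equation of motion enters only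
in the equivalence of the first two statements. -/
theorem IsKillingYano.constraints_tfae (hY : IsKillingYano g Y) (hg : IsLorentzMetric g)
    (hor : IsOriented M) (hRic : IsRicciFlat g) (hL : IsAntisymmFirst L) :
    [IsQuasiInvariant g (fun e => quadInv (kySquare (g e) (Y e)) (L e)),
      Vanishes4 (fun e => constraintV (g e) (kySquare (g e) (Y e)) (L e)),
      Vanishes4 (fun e => constraintX (g e) (kySquare (g e) (Y e)) (L e)),
      Vanishes4 (fun e => constraintKY (g e) (Y e) (L e)),
      Vanishes4 (fun e => killingMixed (g e) (starW (g e) (Y e) (L e)))].TFAE := by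
  have hX := (hY.xHook_tensor hg hor hL.tensor).star3 hg hor
  have hv := hY.xVec_tensor hg hor hL.tensor
  have hy' := hY.yVec_tensor hg hor hL.tensor
  have hW := (hY.starW_antisymmFirst hg hor hL).tensor
  have e1 : ∀ e ∈ atlas Coord M, ∀ y ∈ e.target, ∀ a b c d,
      constraintX (g e) (kySquare (g e) (Y e)) (L e) y a b c d
        = constraintV (g e) (kySquare (g e) (Y e)) (L e) y a b c d := fun e he y hy =>
    (hY.loc he).constraintX_eq_constraintV (hg.loc he) hy (hRic e he y hy) (hL.tensor.smooth e he)
      (hL.antisymm e he) (hX.smooth e he) (hv.smooth e he)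
  have e2 : ∀ e ∈ atlas Coord M, ∀ y ∈ e.target, ∀ a b c d,
      constraintX (g e) (kySquare (g e) (Y e)) (L e) y a b c d
        = constraintKY (g e) (Y e) (L e) y a b c d := fun e he y hy =>
    (hY.loc he).constraintX_eq_constraintKY (hg.loc he) hy (hRic e he y hy)
      (hv.smooth e he)
  have e3 : ∀ e ∈ atlas Coord M, ∀ y ∈ e.target, ∀ a b c d,
      constraintKY (g e) (Y e) (L e) y a b c d
        = killingMixed (g e) (starW (g e) (Y e) (L e)) y a b c d := fun e he y hy =>
    (hg.loc he).constraintKY_eq_killingMixed hy (hX.smooth e he) (hy'.smooth e he) (hW.smooth e he)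
  have congr4 : ∀ {C C' : Chart M → F4}, (∀ e ∈ atlas Coord M, ∀ y ∈ e.target, ∀ a b c d,
      C e y a b c d = C' e y a b c d) → (Vanishes4 C ↔ Vanishes4 C') := fun h =>
    forall₂_congr fun e he => forall₂_congr fun y hy => forall₄_congr fun a b c d => by
      rw [h e he y hy a b c d]
  tfae_have 1 ↔ 2 := hY.isQuasiInvariant_iff hg hor hL.tensor
  tfae_have 3 ↔ 2 := congr4 e1
  tfae_have 3 ↔ 4 := congr4 e2
  tfae_have 4 ↔ 5 := congr4 e3
  tfae_finish

theorem IsKillingYano.isQuasiInvariant_iff_killingMixed (hY : IsKillingYano g Y)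
    (hg : IsLorentzMetric g) (hor : IsOriented M) (hRic : IsRicciFlat g)
    (hL : IsAntisymmFirst L) :
    IsQuasiInvariant g (fun e => quadInv (kySquare (g e) (Y e)) (L e)) ↔
      Vanishes4 (fun e => killingMixed (g e) (starW (g e) (Y e) (L e))) :=
  (hY.constraints_tfae hg hor hRic hL).out 0 4

theorem IsKillingYano.quadInv_agree (hY : IsKillingYano g Y) (hg : IsLorentzMetric g)
    (hL : IsAntisymmFirst L) :
    AgreeOnPhase g (fun e => quadInv (kySquare (g e) (Y e)) (L e))
      (fun e z => rudiger (g e) (Y e) z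
        + mixedInv (g e) (symLast (starW (g e) (Y e) (L e))) z) :=
  fun e he y hy _ hp _ hS =>
    (hY.loc he).quadInv_eq (hg.loc he) hy (hL.antisymm e he y hy) hp hS

theorem symLast_congr {A B : F3} {y : Coord} (h : ∀ a b c, A y a b c = B y a b c) (a b c : Idx) :
    symLast A y a b c = symLast B y a b c := by
  simp only [symLast, h]

theorem starW_recon_sameField (hg : IsLorentzMetric g) {D : Chart M → F3} {A : Chart M → F1}
    (hD : IsTraceFreeHook g D) :
    SameField (fun e => starW (g e) (Y e) (recon (g e) (Y e) (D e) (A e)))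
      (fun e => star3 (g e) (wOf (g e) (D e) (A e))) := fun e he y hy =>
  (hg.loc he).starW_recon hy (hD.antisymm e he y hy) (hD.toIsTraceFree.traceVec he hy)
    (hD.hook e he y hy)

theorem killingMixed_congr {T T' : Chart M → F3} (h : SameField T T') :
    Vanishes4 (fun e => killingMixed (g e) (T e)) ↔
      Vanishes4 (fun e => killingMixed (g e) (T' e)) :=
  forall₂_congr fun e he => forall₂_congr fun y hy => forall₄_congr fun a b c d => by
    simp only [killingMixed, cov3_congr e.open_target hy (fun z hz => h e he z hz)]

theorem IsKillingYano.quadInv_recon_agree (hY : IsKillingYano g Y) (hg : IsLorentzMetric g)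
    (hor : IsOriented M) {D : Chart M → F3} {A : Chart M → F1}
    (hD : IsTraceFreeHook g D) (hA : IsTensor1 A) :
    AgreeOnPhase g (fun e => quadInv (kySquare (g e) (Y e)) (recon (g e) (Y e) (D e) (A e)))
      (fun e z => rudiger (g e) (Y e) z
        + mixedInv (g e) (symLast (star3 (g e) (wOf (g e) (D e) (A e)))) z) :=
  fun e he y hy p hp S hS => by
    refine (hY.quadInv_agree hg (hY.recon_antisymmFirst hg hor hD.toIsAntisymmFirst hA)
      e he y hy p hp S hS).trans ?_
    refine congrArg _ (mixedInv_congr (symLast_congr fun a b c => ?_) S)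
    exact starW_recon_sameField hg hD e he y hy a b c

theorem add_eps_eq_wOf (hg : IsLorentzMetric g) (D : Chart M → F3) (A : Chart M → F1)
    {e : Chart M} (he : e ∈ atlas Coord M) {y : Coord} (hy : y ∈ e.target) (a b c : Idx) :
    D e y a b c + ∑ d, eps (g e) y a b c d * raise1 (g e) (A e) y d
      = wOf (g e) (D e) (A e) y a b c := by
  rw [(hg.loc he).wOf_eq hy, (hg.loc he).star3_wedge hy]
  ring

theorem quadInv_zero_agree (hg : IsLorentzMetric g) {D : Chart M → F3} {A : Chart M → F1}
    (hW : IsAntisymmFirst fun e => wOf (g e) (D e) (A e)) :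
    AgreeOnPhase g
      (fun e => quadInv 0 (fun y α β γ =>
        D e y α β γ + ∑ δ, eps (g e) y α β γ δ * raise1 (g e) (A e) y δ))
      (fun e => mixedInv (g e) (symLast (star3 (g e) (wOf (g e) (D e) (A e))))) :=
  fun e he y hy p hp S hS => by
    refine Eq.trans ?_ ((hg.loc he).quadInv_zero_eq hy (hW.antisymm e he y hy) hp hS)
    simp only [quadInv, add_eps_eq_wOf hg D A he hy]

theorem mixedInv_eq_zero {g : F2} {T : F3} {y : Coord} (h : ∀ a b c, T y a b c = 0) (p : Coord)
    (S : Biv) : mixedInv g T (y, p, S) = 0 := by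
  simp [mixedInv, h]

theorem mixedInv_sub (g : F2) (T T' : F3) (y p : Coord) (S : Biv) :
    mixedInv g (fun y a b c => T y a b c - T' y a b c) (y, p, S)
      = mixedInv g T (y, p, S) - mixedInv g T' (y, p, S) := by
  simp only [mixedInv, sub_mul, Finset.sum_sub_distrib, mul_sub]

/-! ## The correspondence with the mixed-symmetry Killing tensors -/

/-- The difference is again the symmetrization of a tensor antisymmetric in its first two indices,
and its invariant is zero. -/
theorem IsMixedKilling.sameField (hg : IsLorentzMetric g) {T T' : Chart M → F3}
    (hT : IsMixedKilling g T) (hT' : IsMixedKilling g T')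
    (h : AgreeOnPhase g (fun e => mixedInv (g e) (T e)) (fun e => mixedInv (g e) (T' e))) :
    SameField T T' := by
  obtain ⟨N, hN, hTN⟩ := hT.young
  obtain ⟨N', hN', hTN'⟩ := hT'.young
  intro e he y hy a b c
  refine sub_eq_zero.1 ((hg.loc he).eq_zero_of_mixedInv hy
    (T := fun y a b c => T e y a b c - T' e y a b c)
    (N := fun y a b c => N e y a b c - N' e y a b c) (fun a b c => ?_) (fun a b c => ?_)
    (fun p hp S hS => ?_) a b c)
  · rw [hN.antisymm e he y hy, hN'.antisymm e he y hy]; ring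
  · rw [hTN e he y hy, hTN' e he y hy]
    simp only [symLast]; ring
  · rw [mixedInv_sub, sub_eq_zero]
    exact h e he y hy p hp S hS

theorem IsKillingYano.symLast_starW_mixedKilling (hY : IsKillingYano g Y)
    (hg : IsLorentzMetric g) (hor : IsOriented M) (hRic : IsRicciFlat g)
    (hL : IsAntisymmFirst L)
    (hQ : IsQuasiInvariant g (fun e => quadInv (kySquare (g e) (Y e)) (L e))) :
    IsMixedKilling g fun e => symLast (starW (g e) (Y e) (L e)) where
  young := ⟨_, hY.starW_antisymmFirst hg hor hL, fun _ _ _ _ _ _ _ => rfl⟩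
  tensor := (hY.starW_antisymmFirst hg hor hL).tensor.symLast
  killing e he y hy a b c d :=
    (sym3_cov3_symLast e.open_target hy ((hY.starW_antisymmFirst hg hor hL).tensor.smooth e he)
      a b c d).symm.trans
      ((hY.isQuasiInvariant_iff_killingMixed hg hor hRic hL).1 hQ e he y hy a b c d)

theorem IsKillingYano.exists_mixedKilling (hY : IsKillingYano g Y)
    (hg : IsLorentzMetric g) (hor : IsOriented M) (hRic : IsRicciFlat g)
    (hL : IsAntisymmFirst L)
    (hQ : IsQuasiInvariant g (fun e => quadInv (kySquare (g e) (Y e)) (L e))) :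
    ∃ T : Chart M → F3, IsMixedKilling g T ∧
      AgreeOnPhase g (fun e => quadInv (kySquare (g e) (Y e)) (L e))
        (fun e z => rudiger (g e) (Y e) z + mixedInv (g e) (T e) z) ∧
      ∀ T' : Chart M → F3, IsMixedKilling g T' →
        AgreeOnPhase g (fun e => quadInv (kySquare (g e) (Y e)) (L e))
          (fun e z => rudiger (g e) (Y e) z + mixedInv (g e) (T' e) z) →
        SameField T' T := by
  have hT := hY.symLast_starW_mixedKilling hg hor hRic hL hQ
  have h := hY.quadInv_agree hg hL
  exact ⟨_, hT, h, fun T' hT' h' => hT'.sameField hg hT fun e he y hy p hp S hS =>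
    add_left_cancel ((h' e he y hy p hp S hS).symm.trans (h e he y hy p hp S hS))⟩

theorem star3_wOf_zero (g : F2) (y : Coord) (a b c : Idx) : star3 g (wOf g 0 0) y a b c = 0 := by
  simp [star3, wOf, raise1]

/-- For D = A = 0 the tensor *W is zero. Subtracting *N from L adds N to *L because ** = -1, and the
symmetric part of *W depends on L only through *L. -/
theorem IsKillingYano.symLast_starW_recon_sub (hg : IsLorentzMetric g)
    (hL : IsAntisymmFirst fun e => recon (g e) (Y e) 0 0) {N : Chart M → F3}
    (hN : IsAntisymmFirst N) {e : Chart M} (he : e ∈ atlas Coord M) {y : Coord}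
    (hy : y ∈ e.target) (a b c : Idx) :
    symLast (starW (g e) (Y e) fun y a b c =>
      recon (g e) (Y e) 0 0 y a b c - star3 (g e) (N e) y a b c) y a b c
      = symLast (N e) y a b c := by
  have h0 := (hg.loc he).symLast_starW hy (hL.antisymm e he y hy) (Y e) a b c
  have h1 : symLast (starW (g e) (Y e) (recon (g e) (Y e) 0 0)) y a b c = 0 := by
    refine (symLast_congr (B := star3 (g e) (wOf (g e) 0 0)) (fun a b c =>
      starW_recon_sameField (A := 0) hg (IsTraceFreeHook.zero g) e he y hy a b c) a b c).trans ?_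
    simp only [symLast, star3_wOf_zero]; ring
  have h2 : ∀ a b c, star3 (g e) (fun y a b c =>
      recon (g e) (Y e) 0 0 y a b c - star3 (g e) (N e) y a b c) y a b c
      = star3 (g e) (recon (g e) (Y e) 0 0) y a b c + N e y a b c := by
    intro a b c
    have h3 := (hg.loc he).star3_star3 hy (hN.antisymm e he y hy) a b c
    have h4 : star3 (g e) (fun y a b c =>
        recon (g e) (Y e) 0 0 y a b c - star3 (g e) (N e) y a b c) y a b c
        = star3 (g e) (recon (g e) (Y e) 0 0) y a b c
          - star3 (g e) (star3 (g e) (N e)) y a b c := by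
      simp only [star3, mul_sub, Finset.sum_sub_distrib]
    rw [h4, h3, sub_neg_eq_add]
  rw [(hg.loc he).symLast_starW hy (fun a b c => by
    rw [hL.antisymm e he y hy, star3_antisymm _ _ _ a b c]; ring)]
  rw [h1] at h0
  simp only [symLast, h2] at h0 ⊢
  linear_combination -h0

theorem IsKillingYano.exists_quasiInvariant (hY : IsKillingYano g Y)
    (hg : IsLorentzMetric g) (hor : IsOriented M) (hRic : IsRicciFlat g) {T : Chart M → F3}
    (hT : IsMixedKilling g T) :
    ∃ L : Chart M → F3, IsAntisymmFirst L ∧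
      IsQuasiInvariant g (fun e => quadInv (kySquare (g e) (Y e)) (L e)) ∧
      AgreeOnPhase g (fun e => quadInv (kySquare (g e) (Y e)) (L e))
        (fun e z => rudiger (g e) (Y e) z + mixedInv (g e) (T e) z) := by
  obtain ⟨N, hN, hTN⟩ := hT.young
  have hR : IsAntisymmFirst fun e => recon (g e) (Y e) 0 0 :=
    hY.recon_antisymmFirst hg hor (IsTraceFreeHook.zero g).toIsAntisymmFirst IsTensor1.zero
  have hL : IsAntisymmFirst fun e y a b c =>
      recon (g e) (Y e) 0 0 y a b c - star3 (g e) (N e) y a b c :=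
    ⟨hR.tensor.sub (hN.tensor.star3 hg hor), fun e he y hy a b c => by
      rw [hR.antisymm e he y hy, star3_antisymm _ _ _ a b c]; ring⟩
  have hW : ∀ e ∈ atlas Coord M, ∀ y ∈ e.target, ∀ a b c,
      symLast (starW (g e) (Y e) fun y a b c =>
        recon (g e) (Y e) 0 0 y a b c - star3 (g e) (N e) y a b c) y a b c = T e y a b c :=
    fun e he y hy a b c => (IsKillingYano.symLast_starW_recon_sub hg hR hN he hy a b c).trans
      (hTN e he y hy a b c).symm
  refine ⟨_, hL, ?_, fun e he y hy p hp S hS => ?_⟩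
  · refine (hY.isQuasiInvariant_iff_killingMixed hg hor hRic hL).2 fun e he y hy a b c d => ?_
    refine (sym3_cov3_congr e.open_target hy
      ((hY.starW_antisymmFirst hg hor hL).tensor.smooth e he) (hT.tensor.smooth e he)
      (fun z hz a b c => ?_) a b c d).trans (hT.killing e he y hy a b c d)
    -- The symmetrization of *W is T itself, which is already symmetric in its last two indices.
    rw [hW e he z hz]
    simp only [symLast, hTN e he z hz]
    ring
  · exact (hY.quadInv_agree hg hL e he y hy p hp S hS).trans
      (congrArg _ (mixedInv_congr (hW e he y hy) S))

end Fields

end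

end SpinKY

theorem mainTheorem2 {M : Type*} [TopologicalSpace M] [ChartedSpace Coord M]
    [IsManifold 𝓘(ℝ, Coord) ∞ M] (hor : IsOriented M)
    (g : Chart M → F2) (hg : IsLorentzMetric g) (hRic : IsRicciFlat g)
    (Y : Chart M → F2) (hY : IsKillingYano g Y) :
    -- `K = Y·Y` is a Killing tensor
    IsKillingTensor g (fun e => kySquare (g e) (Y e)) ∧
    -- reduction of the constraint, for an arbitrary `L`
    (∀ L : Chart M → F3, IsAntisymmFirst L →
      [IsQuasiInvariant g (fun e => quadInv (kySquare (g e) (Y e)) (L e)),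
        Vanishes4 (fun e => constraintV (g e) (kySquare (g e) (Y e)) (L e)),
        Vanishes4 (fun e => constraintX (g e) (kySquare (g e) (Y e)) (L e)),
        Vanishes4 (fun e => constraintKY (g e) (Y e) (L e)),
        Vanishes4 (fun e => killingMixed (g e) (starW (g e) (Y e) (L e)))].TFAE ∧
      IsTraceFreeHook g (fun e => dTf (g e) (Y e) (L e)) ∧
      IsTensor1 (fun e => yVec (g e) (Y e) (L e)) ∧
      IsTraceFree g (fun e => wOfL (g e) (Y e) (L e)) ∧
      IsAntisymmFirst (fun e => starW (g e) (Y e) (L e)) ∧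
      AgreeOnPhase g (fun e => quadInv (kySquare (g e) (Y e)) (L e))
        (fun e => quadInv (kySquare (g e) (Y e))
          (recon (g e) (Y e) (dTf (g e) (Y e) (L e)) (yVec (g e) (Y e) (L e)))) ∧
      AgreeOnPhase g (fun e => quadInv (kySquare (g e) (Y e)) (L e))
        (fun e z => rudiger (g e) (Y e) z
          + mixedInv (g e) (symLast (starW (g e) (Y e) (L e))) z)) ∧
    -- reconstruction of `L` from `D` and `A`, and the purely algebraic condition
    (∀ (D : Chart M → F3) (A : Chart M → F1), IsTraceFreeHook g D → IsTensor1 A →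
      IsAntisymmFirst (fun e => recon (g e) (Y e) (D e) (A e)) ∧
      SameField (fun e => starW (g e) (Y e) (recon (g e) (Y e) (D e) (A e)))
        (fun e => star3 (g e) (wOf (g e) (D e) (A e))) ∧
      SameField (fun e => star3 (g e) (wOf (g e) (D e) (A e)))
        (fun e y α β γ => star3 (g e) (D e) y α β γ
          - (g e y γ α * A e y β - g e y γ β * A e y α)) ∧
      (IsQuasiInvariant g
          (fun e => quadInv (kySquare (g e) (Y e)) (recon (g e) (Y e) (D e) (A e))) ↔
        Vanishes4 (fun e => killingMixed (g e) (star3 (g e) (wOf (g e) (D e) (A e))))) ∧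
      AgreeOnPhase g
        (fun e => quadInv 0 (fun y α β γ =>
          D e y α β γ + ∑ δ, eps (g e) y α β γ δ * raise1 (g e) (A e) y δ))
        (fun e => mixedInv (g e) (symLast (star3 (g e) (wOf (g e) (D e) (A e))))) ∧
      (SameField (fun e => symLast (star3 (g e) (wOf (g e) (D e) (A e)))) 0 ↔
        AgreeOnPhase g
          (fun e => quadInv 0 (fun y α β γ =>
            D e y α β γ + ∑ δ, eps (g e) y α β γ δ * raise1 (g e) (A e) y δ)) 0)) ∧
    -- Rüdiger's invariant is the quasi-invariant with `D = 0` and `A = 0`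
    (IsQuasiInvariant g
        (fun e => quadInv (kySquare (g e) (Y e)) (recon (g e) (Y e) 0 0)) ∧
      AgreeOnPhase g (fun e => quadInv (kySquare (g e) (Y e)) (recon (g e) (Y e) 0 0))
        (fun e => rudiger (g e) (Y e))) ∧
    -- one-to-one correspondence with the mixed-symmetry Killing tensors
    (∀ L : Chart M → F3, IsAntisymmFirst L →
      IsQuasiInvariant g (fun e => quadInv (kySquare (g e) (Y e)) (L e)) →
      ∃ T : Chart M → F3, IsMixedKilling g T ∧
        AgreeOnPhase g (fun e => quadInv (kySquare (g e) (Y e)) (L e))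
          (fun e z => rudiger (g e) (Y e) z + mixedInv (g e) (T e) z) ∧
        ∀ T' : Chart M → F3, IsMixedKilling g T' →
          AgreeOnPhase g (fun e => quadInv (kySquare (g e) (Y e)) (L e))
            (fun e z => rudiger (g e) (Y e) z + mixedInv (g e) (T' e) z) →
          SameField T' T) ∧
    (∀ T : Chart M → F3, IsMixedKilling g T →
      ∃ L : Chart M → F3, IsAntisymmFirst L ∧
        IsQuasiInvariant g (fun e => quadInv (kySquare (g e) (Y e)) (L e)) ∧
        AgreeOnPhase g (fun e => quadInv (kySquare (g e) (Y e)) (L e))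
          (fun e z => rudiger (g e) (Y e) z + mixedInv (g e) (T e) z)) ∧
    -- the same for the quasi-invariants that are homogeneously linear in the spin
    (∀ L : Chart M → F3, IsAntisymmFirst L →
      IsQuasiInvariant g (fun e => quadInv 0 (L e)) →
      ∃ T : Chart M → F3, IsMixedKilling g T ∧
        AgreeOnPhase g (fun e => quadInv 0 (L e)) (fun e => mixedInv (g e) (T e)) ∧
        ∀ T' : Chart M → F3, IsMixedKilling g T' →
          AgreeOnPhase g (fun e => quadInv 0 (L e)) (fun e => mixedInv (g e) (T' e)) →
          SameField T' T) ∧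
    (∀ T : Chart M → F3, IsMixedKilling g T →
      ∃ L : Chart M → F3, IsAntisymmFirst L ∧
        IsQuasiInvariant g (fun e => quadInv 0 (L e)) ∧
        AgreeOnPhase g (fun e => quadInv 0 (L e)) (fun e => mixedInv (g e) (T e))) := by
  refine ⟨hY.kySquare_killing hg hor, fun L hL => ⟨hY.constraints_tfae hg hor hRic hL,
    hY.dTf_traceFreeHook hg hor hL, hY.yVec_tensor hg hor hL.tensor,
    hY.wOfL_traceFree hg hor hL, hY.starW_antisymmFirst hg hor hL, ?_,
    hY.quadInv_agree hg hL⟩, fun D A hD hA => ?_, ⟨?_, ?_⟩,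
    fun L hL hQ => hY.exists_mixedKilling hg hor hRic hL hQ,
    fun T hT => hY.exists_quasiInvariant hg hor hRic hT, fun L hL hQ => ?_, fun T hT => ?_⟩
  -- Both functions are Rüdiger's invariant plus the contribution of the same *W, although the two
  -- tensors L may differ.
  · exact fun e he y hy p hp S hS => (hY.quadInv_agree hg hL e he y hy p hp S hS).trans
      (hY.quadInv_recon_agree hg hor (hY.dTf_traceFreeHook hg hor hL)
        (hY.yVec_tensor hg hor hL.tensor) e he y hy p hp S hS).symm
  · have hR := hY.recon_antisymmFirst hg hor hD.toIsAntisymmFirst hA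
    have hW := hD.toIsAntisymmFirst.wOf hg hor hA
    have hq := quadInv_zero_agree hg hW
    refine ⟨hR, starW_recon_sameField hg hD, fun e he y hy α β γ => ?_,
      (hY.isQuasiInvariant_iff_killingMixed hg hor hRic hR).trans
        (killingMixed_congr (starW_recon_sameField hg hD)), hq, fun h => ?_, fun h => ?_⟩
    · refine ((hg.loc he).star3_wOf hy (A e) α β γ).trans ?_
      simp only [wedge, hg.symm e he y hy γ α, hg.symm e he y hy γ β]
      ring
    · exact fun e he y hy p hp S hS => (hq e he y hy p hp S hS).trans
        (mixedInv_eq_zero (h e he y hy) p S)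
    · exact fun e he y hy => (hg.loc he).eq_zero_of_mixedInv hy
        (fun a b c => star3_antisymm _ _ _ a b c) (fun _ _ _ => rfl)
        fun p hp S hS => (hq e he y hy p hp S hS).symm.trans (h e he y hy p hp S hS)
  · have hD := IsTraceFreeHook.zero g
    refine (hY.isQuasiInvariant_iff_killingMixed hg hor hRic
      (hY.recon_antisymmFirst hg hor hD.toIsAntisymmFirst IsTensor1.zero)).2 ?_
    -- For D = A = 0 the tensor *W is zero, so its Killing equation holds trivially.
    refine (killingMixed_congr (starW_recon_sameField hg hD)).2 ?_
    refine (killingMixed_congr (T' := fun _ _ _ _ _ => 0) fun e _ y _ α β γ =>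
      star3_wOf_zero (g e) y α β γ).2 fun e _ y _ α β γ δ => ?_
    simp [killingMixed, cov3, pd, sym3]
  · intro e he y hy p hp S hS
    refine (hY.quadInv_recon_agree hg hor (IsTraceFreeHook.zero g) IsTensor1.zero
      e he y hy p hp S hS).trans (add_eq_left.2 (mixedInv_eq_zero (fun a b c => ?_) p S))
    change (1 / 2) * (star3 (g e) (wOf (g e) 0 0) y a b c
      + star3 (g e) (wOf (g e) 0 0) y a c b) = 0
    rw [star3_wOf_zero, star3_wOf_zero, add_zero, mul_zero]
  -- The zero Killing-Yano tensor turns the general correspondence into the one for invariants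
  -- linear in the spin.
  · have hZ := IsKillingYano.zero g
    have h := hZ.exists_mixedKilling hg hor hRic (L := L) hL
    simp only [Pi.zero_apply, kySquare_zero, rudiger_zero, zero_add] at h
    exact h hQ
  · have h := (IsKillingYano.zero g).exists_quasiInvariant hg hor hRic hT
    simp only [Pi.zero_apply, kySquare_zero, rudiger_zero, zero_add] at h
    exact h
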